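/- Let $m, N\ge 1$ be integers and let $\alpha_1,\dots,\alpha_m$ and $\lambda_1,\dots,\lambda_m$ be real numbers with $\lambda_i=\alpha_i-\alpha_{i-1}$ (indices modulo $m$, so $\sum_i\lambda_i=0$). Let $\mathcal N_m(\lambda,\mathbb C)$ be the set of complex $mN\times mN$ matrices $A$, written as $m\times m$ matrices of $N\times N$ blocks $A_{ij}$, such that $A_{ij}=0$ unless $j-i\equiv 1 \pmod m$, and $[A,A^\dagger]=\mathrm{diag}(\lambda_1 I_N,\dots,\lambda_m I_N)$. Let $dM$ be the measure on $\mathcal N_m(\lambda,\mathbb C)$ induced by the Euclidean metric on all complex matrices, i.e. its Riemannian volume (the normalized Hausdorff measure) in its dimension $mN^2+N$. Put $Q(x)=\prod_{i=1}^m(x+\alpha_i)$ and $$\Sigma=\{(z,x)\in\mathbb C\times\mathbb R:\ x+\alpha_i\ge 0\ \text{for all } i,\ |z|^2=Q(x)\},$$ with coordinates $x$ and $\theta=\arg z\in[0,2\pi)$. For $((z_j,x_j))_{j}\in\Sigma^N$ and $S\in U(N)^m$, consider the matrix with blocks $A_{k,k+1}=S_kD_kS_{k+1}^\dagger$ and all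 other blocks zero, where $D_k=\mathrm{diag}(z^k_1,\dots,z^k_N)$, $|z^k_j|^2=x_j+\alpha_k$ and $\prod_k z_j^k=z_j$ (the phase of $z_j$ being put in $z_j^1$). It depends on $S$ only through its class in $U(N)^m/U(1)^N$, where $U(1)^N$ is the diagonal torus of $U(N)$ embedded diagonally in $U(N)^m$. These matrices are exactly the elements of $\mathcal N_m(\lambda,\mathbb C)$, and this gives a bijection between the $U(N)^m$-orbits in $\mathcal N_m(\lambda,\mathbb C)$ and the points of $\Sigma^N/S_N$. In these coordinates, $$dM=\frac1{2^N}\prod_{i}\sqrt{Q'(x_i)}\ \prod_{i<j}|z_i-z_j|^2\ dx_1\cdots dx_N\,d\theta_1\cdots d\theta_N\,dU$$ on $\Sigma^N/S_N$; that is, $dM$ is $\frac1{N!}$ times the image of the measure on the right-hand side on $\Sigma^N\times U(N)^m/U(1)^N$. Here $dU$ is the invariant measure on $U(N)^m/U(1)^N$, normalized as the quotient of the Euclidean volume of $U(N)^m$ (for the metric $\mathrm{Tr}(XX^\dagger)$) by the measure $d\varphi_1\cdots d\varphi_N$ on $U(1)^N$, so that its total mass is $\mathrm{vol}(U(N))^m/(2\pi)^N$.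 -/

import Mathlib

open MeasureTheory
open scoped Matrix ENNReal Nat

noncomputable section

namespace GenNormal

/-! ### Generalized normal matrices and their Euclidean measure -/

/-- Complex `mN × mN` matrices, seen as `m × m` matrices of blocks of size `N × N`:
`A (i, a) (j, b)` is the entry `(a, b)` of the block `A_{ij}`. -/
abbrev BlockMat (m N : ℕ) : Type := Matrix (Fin m × Fin N) (Fin m × Fin N) ℂ

/-- The generalized normal matrices `N_m(lam, ℂ)`: the block `A_{ij}` vanishes unless
`j = i + 1` modulo `m` (addition in `Fin m` is cyclic), and `[A, A†] = diag(lam_i I_N)`. -/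
def genNormal (m N : ℕ) [NeZero m] (lam : Fin m → ℝ) : Set (BlockMat m N) :=
  {A | (∀ i j, j ≠ i + 1 → ∀ a b, A (i, a) (j, b) = 0) ∧
    A * Aᴴ - Aᴴ * A = Matrix.diagonal fun p => (lam p.1 : ℂ)}

/-- The Euclidean space of complex `n × n` matrices, with distance
`dist A B = (∑ |A_{kl} - B_{kl}|²)^{1/2}`. -/
abbrev MatSpace (n : Type) [Fintype n] : Type := EuclideanSpace ℂ (n × n)

/-- A matrix as a point of the Euclidean space of matrices. -/
def toSpace {n : Type} [Fintype n] (A : Matrix n n ℂ) : MatSpace n :=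
  WithLp.toLp 2 fun p => A p.1 p.2

/-- The Euclidean measure on `N_m(lam, ℂ)`: the volume (Hausdorff measure, normalized to be
Lebesgue measure on Euclidean spaces, hence Riemannian volume on submanifolds) in the dimension
`m N² + N = 2N + dim U(N)^m / U(1)^N` of `N_m(lam, ℂ)`, for the metric induced by the Euclidean
metric on all complex matrices. -/
def euclideanMeasure (m N : ℕ) [NeZero m] (lam : Fin m → ℝ) :
    Measure (MatSpace (Fin m × Fin N)) :=
  (Measure.euclideanHausdorffMeasure (m * N ^ 2 + N)).restrict (toSpace '' genNormal m N lam)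

/-! ### The surface `Σ` -/

/-- `Q(x) = ∏ i, (x + α_i)`. -/
def Q {m : ℕ} (α : Fin m → ℝ) : Polynomial ℝ :=
  ∏ i, (Polynomial.X + Polynomial.C (α i))

/-- The surface `Σ`: the pairs `(z, x)` with `x + α_i ≥ 0` for all `i` and `|z|² = Q(x)`. -/
def surface {m : ℕ} (α : Fin m → ℝ) : Set (ℂ × ℝ) :=
  {p | (∀ i, 0 ≤ p.2 + α i) ∧ ‖p.1‖ ^ 2 = (Q α).eval p.2}

/-- The point of `Σ` with coordinates `(x, θ)`, i.e. `(z, x)` with `z = √Q(x) e^{iθ}`. -/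
def chart {m : ℕ} (α : Fin m → ℝ) (q : ℝ × ℝ) : ℂ × ℝ :=
  ((Real.sqrt ((Q α).eval q.1) : ℂ) * Complex.exp (q.2 * Complex.I), q.1)

/-- The measure `dx dθ` on `Σ`. -/
def surfaceMeasure {m : ℕ} (α : Fin m → ℝ) : Measure (ℂ × ℝ) :=
  Measure.map (chart α)
    ((volume : Measure (ℝ × ℝ)).restrict
      ({x : ℝ | ∀ i, 0 ≤ x + α i} ×ˢ Set.Ico 0 (2 * Real.pi)))

/-- The density `2^{-N} ∏_i √Q'(x_i) ∏_{i<j} |z_i - z_j|²` at the points `p_j = (z_j, x_j)`. -/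
def density {m N : ℕ} (α : Fin m → ℝ) (p : Fin N → ℂ × ℝ) : ℝ :=
  (1 / 2 ^ N) * (∏ i, Real.sqrt ((Q α).derivative.eval (p i).2)) *
    ∏ i, ∏ j ∈ Finset.Ioi i, ‖(p i).1 - (p j).1‖ ^ 2

/-! ### The group `U(N)^m`, its diagonal torus `U(1)^N`, and the homogeneous space -/

/-- The group `U(N)`. -/
abbrev U (N : ℕ) : Type := Matrix.unitaryGroup (Fin N) ℂ

instance instMeasurableSpaceU (N : ℕ) : MeasurableSpace (U N) := borel _

instance instBorelSpaceU (N : ℕ) : BorelSpace (U N) := ⟨rfl⟩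

instance instCompactSpaceU (N : ℕ) : CompactSpace (U N) := by
  apply isCompact_iff_compactSpace.mp
  have hK : IsCompact (Set.univ.pi fun _ : Fin N => Set.univ.pi fun _ : Fin N =>
      Metric.closedBall (0 : ℂ) 1) :=
    isCompact_univ_pi fun _ => isCompact_univ_pi fun _ => isCompact_closedBall _ _
  have hc : IsClosed ((Matrix.unitaryGroup (Fin N) ℂ : Submonoid _) :
      Set (Matrix (Fin N) (Fin N) ℂ)) := by
    have : ((Matrix.unitaryGroup (Fin N) ℂ : Submonoid _) : Set (Matrix (Fin N) (Fin N) ℂ)) =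
        {A | A * star A = 1} := by
      ext A
      exact Matrix.mem_unitaryGroup_iff
    rw [this]
    exact isClosed_eq (by fun_prop) continuous_const
  refine IsCompact.of_isClosed_subset hK hc fun A hA => ?_
  exact fun i _ j _ => mem_closedBall_zero_iff.mpr (entry_norm_bound_of_unitary hA i j)

/-- The diagonal unitary matrix `diag(t_1, …, t_N)`. -/
def diagU (N : ℕ) : (Fin N → Circle) →* U N where
  toFun t := ⟨Matrix.diagonal fun j => (t j : ℂ), by
    rw [Matrix.mem_unitaryGroup_iff, Matrix.star_eq_conjTranspose, Matrix.diagonal_conjTranspose,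
      Matrix.diagonal_mul_diagonal, ← Matrix.diagonal_one]
    congr 1
    ext j
    simp [Complex.mul_conj]⟩
  map_one' := by ext1; simp
  map_mul' s t := by ext1; simp

/-- `U(1)^N` inside `U(N)^m`: the elements `(t, …, t)` with `t` diagonal. -/
def torus (m N : ℕ) : Subgroup (Fin m → U N) :=
  MonoidHom.range (MonoidHom.pi fun _ : Fin m => diagU N)

/-- The homogeneous space `U(N)^m / U(1)^N`. -/
abbrev Flag (m N : ℕ) : Type := (Fin m → U N) ⧸ torus m N

/-- The volume of `U(N)` as a submanifold, of dimension `N²`, of the Euclidean space of complex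
`N × N` matrices. (Explicitly, it is `(2π)^{N(N+1)/2} / ∏_{k<N} k!`.) -/
def volU (N : ℕ) : ℝ≥0∞ :=
  Measure.euclideanHausdorffMeasure (N ^ 2)
    (toSpace '' (Matrix.unitaryGroup (Fin N) ℂ : Set (Matrix (Fin N) (Fin N) ℂ)))

/-- The Haar probability measure of `U(N)`. -/
def haarU (N : ℕ) : Measure (U N) := Measure.haarMeasure ⊤

/-- The invariant measure `dU` on `U(N)^m / U(1)^N` (the image of Haar measure), normalized as the
quotient of the Euclidean volume of `U(N)^m` by the measure `dφ_1 ⋯ dφ_N` of `U(1)^N`: its total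
mass is `vol(U(N))^m / (2π)^N`. For `N = 1` this is the Haar measure of `U(1)^m / U(1)` for which
`dθ_1 ⋯ dθ_m = dθ dU`, where `θ = θ_1 + ⋯ + θ_m`. -/
def flagMeasure (m N : ℕ) : Measure (Flag m N) :=
  (volU N ^ m / ENNReal.ofReal ((2 * Real.pi) ^ N)) •
    Measure.map (QuotientGroup.mk : (Fin m → U N) → Flag m N) (Measure.pi fun _ => haarU N)

/-! ### Eigenvalue coordinates -/

/-- The block matrix with `A_{i,i+1} = X_i` and all other blocks zero. -/
def blockCyclic {m N : ℕ} [NeZero m] (X : Fin m → Matrix (Fin N) (Fin N) ℂ) : BlockMat m N :=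
  fun r c => if c.1 = r.1 + 1 then X r.1 r.2 c.2 else 0

/-- Diagonal blocks `D_k = diag(z^k_1, …, z^k_N)` attached to points `p_j = (z_j, x_j)` of `Σ`:
`|z^k_j|² = x_j + α_k` and `∏_k z^k_j = z_j`; the phase of `z_j` is put in `z^1_j`. -/
def diagBlock {m N : ℕ} [NeZero m] (α : Fin m → ℝ) (p : Fin N → ℂ × ℝ) (k : Fin m) :
    Matrix (Fin N) (Fin N) ℂ :=
  Matrix.diagonal fun j => (Real.sqrt ((p j).2 + α k) : ℂ) *
    (if k = 0 then Complex.exp (Complex.arg (p j).1 * Complex.I) else 1)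

/-- The action of `U(N)^m`: the matrix with blocks `S_k D_k S_{k+1}†`. -/
def orbitPoint {m N : ℕ} [NeZero m] (α : Fin m → ℝ) (p : Fin N → ℂ × ℝ) (S : Fin m → U N) :
    BlockMat m N :=
  blockCyclic fun k => (S k : Matrix (Fin N) (Fin N) ℂ) * diagBlock α p k *
    (S (k + 1) : Matrix (Fin N) (Fin N) ℂ)ᴴ

theorem orbitPoint_mul {m N : ℕ} [NeZero m] (α : Fin m → ℝ) (p : Fin N → ℂ × ℝ)
    (S : Fin m → U N) {T : Fin m → U N} (hT : T ∈ torus m N) :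
    orbitPoint α p (S * T) = orbitPoint α p S := by
  obtain ⟨t, rfl⟩ := hT
  unfold orbitPoint
  congr 1
  funext k
  have key : ((diagU N t : U N) : Matrix (Fin N) (Fin N) ℂ) * diagBlock α p k *
      ((diagU N t : U N) : Matrix (Fin N) (Fin N) ℂ)ᴴ = diagBlock α p k := by
    simp only [diagU, diagBlock, MonoidHom.coe_mk, OneHom.coe_mk, Matrix.diagonal_conjTranspose,
      Matrix.diagonal_mul_diagonal]
    congr 1
    funext j
    have h : (t j : ℂ) * star (t j : ℂ) = 1 := by simp [Complex.mul_conj]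
    simp only [Pi.star_apply]
    linear_combination ((Real.sqrt ((p j).2 + α k) : ℂ) *
      (if k = 0 then Complex.exp (Complex.arg (p j).1 * Complex.I) else 1)) * h
  have hT (l : Fin m) : (MonoidHom.pi fun _ : Fin m => diagU N) t l = diagU N t := rfl
  calc _ = (S k : Matrix (Fin N) (Fin N) ℂ) * (((diagU N t : U N) : Matrix (Fin N) (Fin N) ℂ) *
        diagBlock α p k * ((diagU N t : U N) : Matrix (Fin N) (Fin N) ℂ)ᴴ) *
        (S (k + 1) : Matrix (Fin N) (Fin N) ℂ)ᴴ := by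
          simp [Matrix.mul_assoc, hT]
    _ = _ := by rw [key]

/-- The matrix with coordinates `((z_1, x_1), …, (z_N, x_N)) ∈ Σ^N` and `u ∈ U(N)^m / U(1)^N`. -/
def coord {m N : ℕ} [NeZero m] (α : Fin m → ℝ) (q : (Fin N → ℂ × ℝ) × Flag m N) : BlockMat m N :=
  Quotient.liftOn' q.2 (orbitPoint α q.1) fun S S' h => by
    have := orbitPoint_mul α q.1 S (QuotientGroup.leftRel_apply.mp h)
    simpa using this.symm

end GenNormal

end

/-! In terms of the blocks X_k = A_{k,k+1}, the commutator equation reads X_k X_k† - X_{k-1}†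
X_{k-1} = λ_k. As X_k X_k† and X_k† X_k have the same spectrum, a single family x_1, …, x_N
describes all blocks: the spectrum of X_k X_k† is {x_j + α_k}. Carrying an eigenbasis from block to
block gives X_k = S_k |D_k| S_{k+1}†. One turn around the cycle leaves a unitary holonomy commuting
with diag(x), and diagonalizing it produces the phases of the z_j (`exists_orbitPoint_eq`).
Conversely, the unitary matrices relating two systems of coordinates of one matrix intertwine the
x_j in each block and the z_j around the cycle, so the points of Σ agree up to a permutation
(`exists_perm_of_orbitPoint_eq`).

For the measure, U(N) is charted by a Cayley transform times diagonal phases. Where the x_j are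
ordered, distinct and all x_j + α_k > 0, the torus freedom is used to drop the phases of S_0, and
the slots thus freed hold the angles θ (`param`). Up to unitary factors, which preserve the
Frobenius norm, the variation of block k is dD_k + Y_k D_k - D_k Y_{k+1} with Y_k = S_k† dS_k. Its
norm splits into three parts (`sum_frob_dBlock`). The moduli move with speed √(∑_k 1/(x + α_k))/2.
The phases contribute ∏_k √(x + α_k) to the Jacobian, and with the first factor this is √Q'(x)/2.
For a pair a < b with complex coordinate w_k of Y_k, the entries (a,b) and (b,a) contribute |z_b^k
w_k - z_a^k w_{k+1}|², plus terms that telescope around the cycle because |z_a^k|² - |z_b^k|² = x_a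
- x_b does not depend on k. The cyclic bidiagonal operator appearing here has complex determinant
z_b - z_a, hence real determinant |z_a - z_b|² (`det_jacobianMap`).

The area formula (`AreaData.restrict_image`) turns the Jacobian into an identity of measures for
unitary coordinates near 1. Conjugation by U(N)^m is isometric and preserves both sides, so
countably many translates give the identity globally. The exceptional matrices, with coinciding x_j
or some x_j + α_k = 0, form a null set because they are a locally Lipschitz image of a null set of
full-dimensional coordinates. Passing from ordered to arbitrary x_j produces the factor 1/N!. -/

noncomputable section

set_option linter.unusedSectionVars false

namespace GenNormal

section

/-! ### The area formula for Euclidean Hausdorff measures -/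

section AreaFormula

open Set Filter Topology
open scoped NNReal

variable {E E' F : Type*} [NormedAddCommGroup E] [NormedSpace ℝ E] [FiniteDimensional ℝ E]
  [MeasurableSpace E] [BorelSpace E] {μ : Measure E} [μ.IsAddHaarMeasure]
  [NormedAddCommGroup E'] [InnerProductSpace ℝ E'] [FiniteDimensional ℝ E']
  [MeasurableSpace E'] [BorelSpace E']
  [NormedAddCommGroup F] [NormedSpace ℝ F] [MeasurableSpace F] [BorelSpace F]

theorem euclideanHausdorffMeasure_image_le_of_lipschitzOnWith {X Y : Type*} [EMetricSpace X]
    [MeasurableSpace X] [BorelSpace X] [EMetricSpace Y] [MeasurableSpace Y] [BorelSpace Y]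
    {f : X → Y} {K : ℝ≥0} {s : Set X} (h : LipschitzOnWith K f s) (d : ℕ) :
    Measure.euclideanHausdorffMeasure d (f '' s) ≤
      (K : ℝ≥0∞) ^ d * Measure.euclideanHausdorffMeasure d s := by
  simp only [Measure.euclideanHausdorffMeasure_def, Measure.smul_apply, Measure.nnreal_smul_coe_apply]
  rw [mul_left_comm]
  gcongr
  simpa using h.hausdorffMeasure_image_le (d := (d : ℝ)) (by positivity)

/-- A strictly differentiable map whose differential is injective distorts distances, near a point,
almost as its differential does. -/
theorem exists_nhds_dist_comparison {f : E → F} {f' : E →L[ℝ] F} {x₀ : E}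
    (hf : HasStrictFDerivAt f f' x₀) (L : E ≃L[ℝ] E') (hL : ∀ v, ‖f' v‖ = ‖L v‖)
    {q : ℝ} (hq : 1 < q) :
    ∃ U ∈ 𝓝 x₀, ∀ x ∈ U, ∀ y ∈ U, ‖f x - f y‖ ≤ q * ‖L (x - y)‖ ∧
      ‖L (x - y)‖ ≤ q * ‖f x - f y‖ := by
  have hK0 : 0 ≤ ‖(L.symm : E' →L[ℝ] E)‖ := norm_nonneg _
  have hK (v : E) : ‖v‖ ≤ (‖(L.symm : E' →L[ℝ] E)‖ + 1) * ‖L v‖ := by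
    have h := (L.symm : E' →L[ℝ] E).le_opNorm (L v)
    simp only [ContinuousLinearEquiv.coe_coe, ContinuousLinearEquiv.symm_apply_apply] at h
    nlinarith [norm_nonneg (L v)]
  -- The added 1 keeps `K` positive also when `E` is trivial.
  set K := ‖(L.symm : E' →L[ℝ] E)‖ + 1
  have hKpos : 0 < K := by positivity
  -- For this `ε` one has `1 - ε = 1 / q`, and `q + 1 / q ≥ 2` gives `1 + ε ≤ q`, so a single bound
  -- on the remainder yields both inequalities.
  set ε := 1 - 1 / q with hε
  have hq0 : 0 < q := by linarith
  have hε0 : 0 < ε := by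
    rw [hε, sub_pos, div_lt_one hq0]; exact hq
  have hε1 : 1 + ε ≤ q := by
    have : 1 / q + q ≥ 2 := by
      rw [ge_iff_le, div_add' _ _ _ hq0.ne', le_div_iff₀ hq0]; nlinarith [sq_nonneg (q - 1)]
    linarith
  have h1 := (hf.isLittleO.bound (show 0 < ε / K by positivity))
  rw [nhds_prod_eq] at h1
  obtain ⟨U, hU, hUb⟩ := (mem_prod_self_iff (la := 𝓝 x₀)).mp h1
  refine ⟨U, hU, fun x hx y hy => ?_⟩
  have hb : ‖f x - f y - f' (x - y)‖ ≤ ε / K * ‖x - y‖ := hUb (mk_mem_prod hx hy)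
  have h2 : ‖f x - f y - f' (x - y)‖ ≤ ε * ‖L (x - y)‖ := by
    refine hb.trans ?_
    rw [div_mul_eq_mul_div, div_le_iff₀ hKpos]
    have := hK (x - y)
    nlinarith [norm_nonneg (L (x - y))]
  have h3 := norm_sub_norm_le (f x - f y) (f' (x - y))
  have h4 := norm_sub_norm_le (f' (x - y)) (f x - f y)
  rw [norm_sub_rev (f' (x - y))] at h4
  rw [hL] at h3 h4
  have hn := norm_nonneg (L (x - y))
  constructor
  · nlinarith
  · have h5 : (1 / q) * ‖L (x - y)‖ ≤ ‖f x - f y‖ := by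
      have : (1 - ε) * ‖L (x - y)‖ ≤ ‖f x - f y‖ := by linarith
      simpa [hε] using this
    have := mul_le_mul_of_nonneg_left h5 hq0.le
    rwa [← mul_assoc, mul_one_div_cancel hq0.ne', one_mul] at this

/-- Both `f ∘ L⁻¹` on `L '' t` and its inverse are `q`-Lipschitz, and a `q`-Lipschitz map increases
`d`-dimensional measure at most by the factor `q ^ d`. On `E'` this measure is Lebesgue measure. -/
theorem measure_comparison_of_dist_comparison {f : E → F} (L : E ≃L[ℝ] E') {q : ℝ≥0} {U : Set E}
    (hU : ∀ x ∈ U, ∀ y ∈ U, ‖f x - f y‖ ≤ q * ‖L (x - y)‖ ∧ ‖L (x - y)‖ ≤ q * ‖f x - f y‖)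
    {t : Set E} (ht : t ⊆ U) :
    Measure.euclideanHausdorffMeasure (Module.finrank ℝ E') (f '' t) ≤
        (q : ℝ≥0∞) ^ Module.finrank ℝ E' * volume (L '' t) ∧
      volume (L '' t) ≤ (q : ℝ≥0∞) ^ Module.finrank ℝ E' *
        Measure.euclideanHausdorffMeasure (Module.finrank ℝ E') (f '' t) := by
  rw [← InnerProductSpace.euclideanHausdorffMeasure_eq_volume]
  constructor
  · have h1 : LipschitzOnWith q (f ∘ L.symm) (L '' t) := by
      rw [lipschitzOnWith_iff_dist_le_mul]
      rintro _ ⟨x, hx, rfl⟩ _ ⟨y, hy, rfl⟩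
      simpa [dist_eq_norm] using (hU x (ht hx) y (ht hy)).1
    have h2 := euclideanHausdorffMeasure_image_le_of_lipschitzOnWith h1 (Module.finrank ℝ E')
    rwa [← Set.image_comp, show (f ∘ L.symm) ∘ L = f by ext; simp] at h2
  · have hinj : InjOn f t := by
      intro x hx y hy hxy
      have := (hU x (ht hx) y (ht hy)).2
      rw [hxy, sub_self, norm_zero, mul_zero] at this
      have h0 : L (x - y) = 0 := by simpa using this
      exact sub_eq_zero.mp ((map_eq_zero_iff L L.injective).mp h0)
    have h1 : LipschitzOnWith q (L ∘ Function.invFunOn f t) (f '' t) := by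
      rw [lipschitzOnWith_iff_dist_le_mul]
      rintro _ ⟨x, hx, rfl⟩ _ ⟨y, hy, rfl⟩
      simp only [Function.comp_apply]
      rw [hinj.leftInvOn_invFunOn hx, hinj.leftInvOn_invFunOn hy]
      simpa [dist_eq_norm] using (hU x (ht hx) y (ht hy)).2
    have h2 := euclideanHausdorffMeasure_image_le_of_lipschitzOnWith h1 (Module.finrank ℝ E')
    rw [image_comp, hinj.invFunOn_image Subset.rfl] at h2
    exact h2

/-- The data of the area formula: on `s`, the map `f` is strictly differentiable and injective, and
its differential has the same length distortion as an invertible endomorphism of determinant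
`± D x`. The linear equivalence `e` identifies the source with a Euclidean space. -/
structure AreaData (μ : Measure E) (e : E ≃L[ℝ] E') (f : E → F) (s : Set E) (D : E → ℝ) :
    Prop where
  measurePreserving : MeasurePreserving e μ volume
  measurableSet : MeasurableSet s
  injOn : InjOn f s
  continuousOn : ContinuousOn D s
  exists_deriv : ∀ x ∈ s, ∃ (f' : E →L[ℝ] F) (B : E →ₗ[ℝ] E), HasStrictFDerivAt f f' x ∧
    (∀ v, ‖f' v‖ = ‖e (B v)‖) ∧ |LinearMap.det B| = D x ∧ D x ≠ 0

namespace AreaData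

variable {e : E ≃L[ℝ] E'} {f : E → F} {s : Set E} {D : E → ℝ}

theorem pos (h : AreaData μ e f s D) {x : E} (hx : x ∈ s) : 0 < D x := by
  obtain ⟨f', B, -, -, hB, hD⟩ := h.exists_deriv x hx
  exact lt_of_le_of_ne (hB ▸ abs_nonneg _) hD.symm

theorem continuousOn_map (h : AreaData μ e f s D) : ContinuousOn f s := fun x hx => by
  obtain ⟨f', B, hf, -⟩ := h.exists_deriv x hx
  exact hf.continuousAt.continuousWithinAt

/-- Replacing `f` by its differential at `x₀` costs `q ^ d`, the image of `t` under that
differential has volume `D x₀ * μ t`, and replacing `D` by the constant `D x₀` costs one more factor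
`q`, by continuity. -/
theorem exists_local (h : AreaData μ e f s D) {q : ℝ≥0} (hq : 1 < q) {x₀ : E} (hx₀ : x₀ ∈ s) :
    ∃ U, IsOpen U ∧ x₀ ∈ U ∧ ∀ t ⊆ U ∩ s, MeasurableSet t →
      Measure.euclideanHausdorffMeasure (Module.finrank ℝ E') (f '' t) ≤
        (q : ℝ≥0∞) ^ (Module.finrank ℝ E' + 1) * ∫⁻ x in t, ENNReal.ofReal (D x) ∂μ ∧
      ∫⁻ x in t, ENNReal.ofReal (D x) ∂μ ≤ (q : ℝ≥0∞) ^ (Module.finrank ℝ E' + 1) *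
        Measure.euclideanHausdorffMeasure (Module.finrank ℝ E') (f '' t) := by
  obtain ⟨f', B, hf, hB, hdet, hD0⟩ := h.exists_deriv x₀ hx₀
  have hD := h.pos hx₀
  have hdet0 : LinearMap.det B ≠ 0 := by
    rw [← abs_ne_zero, hdet]; exact hD0
  let L : E ≃L[ℝ] E' := (LinearEquiv.ofIsUnitDet (f := B) (v := Module.finBasis ℝ E)
    (v' := Module.finBasis ℝ E) (by
      rw [LinearMap.det_toMatrix]; exact isUnit_iff_ne_zero.mpr hdet0)).toContinuousLinearEquiv.trans e
  have hLapp (v : E) : L v = e (B v) := rfl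
  obtain ⟨U, hU, hUb⟩ := exists_nhds_dist_comparison hf L hB (q := q) (by exact_mod_cast hq)
  have hvol (t : Set E) : volume (L '' t) = ENNReal.ofReal (D x₀) * μ t := by
    have h1 : (L '' t) = e '' (B '' t) := by rw [← image_comp]; rfl
    have h2 := h.measurePreserving.measure_preimage_emb
      e.toHomeomorph.measurableEmbedding (e '' (B '' t))
    rw [e.injective.preimage_image] at h2
    rw [h1, ← h2, Measure.addHaar_image_linearMap, hdet]
  have hq0 : (0 : ℝ) < q := by
    have : (0 : ℝ≥0) < q := lt_trans zero_lt_one hq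
    exact_mod_cast this
  have hq1 : (1 : ℝ) < q := by exact_mod_cast hq
  have hev : ∀ᶠ x in 𝓝[s] x₀, D x ∈ Ioo (D x₀ / q) (D x₀ * q) :=
    (h.continuousOn x₀ hx₀) (Ioo_mem_nhds (div_lt_self hD hq1) (lt_mul_of_one_lt_right hD hq1))
  obtain ⟨V, hV, hVx, hVs⟩ := mem_nhdsWithin.mp hev
  obtain ⟨U', hU'U, hU', hU'x⟩ := mem_nhds_iff.mp hU
  refine ⟨U' ∩ V, hU'.inter hV, ⟨hU'x, hVx⟩, fun t ht htm => ?_⟩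
  obtain ⟨h1, h2⟩ := measure_comparison_of_dist_comparison L hUb
    (ht.trans (fun x hx => hU'U hx.1.1))
  rw [hvol] at h1 h2
  have hq' : ENNReal.ofReal (q : ℝ) = q := ENNReal.ofReal_coe_nnreal
  have h3 : ENNReal.ofReal (D x₀) * μ t ≤ q * ∫⁻ x in t, ENNReal.ofReal (D x) ∂μ := by
    rw [← lintegral_const_mul' _ _ ENNReal.coe_ne_top, ← setLIntegral_const]
    refine setLIntegral_mono' htm fun x hx => ?_
    rw [← hq', ← ENNReal.ofReal_mul hq0.le]
    refine ENNReal.ofReal_le_ofReal ?_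
    have := (hVs ⟨(ht hx).1.2, (ht hx).2⟩).1
    rw [div_lt_iff₀ hq0] at this
    linarith
  have h4 : ∫⁻ x in t, ENNReal.ofReal (D x) ∂μ ≤ q * (ENNReal.ofReal (D x₀) * μ t) := by
    rw [← mul_assoc, ← setLIntegral_const]
    refine setLIntegral_mono' htm fun x hx => ?_
    rw [← hq', ← ENNReal.ofReal_mul hq0.le]
    refine ENNReal.ofReal_le_ofReal ?_
    have := (hVs ⟨(ht hx).1.2, (ht hx).2⟩).2
    linarith
  constructor
  · refine h1.trans ?_
    rw [pow_succ, mul_assoc]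
    gcongr
  · refine h4.trans ?_
    rw [pow_succ', mul_assoc]
    gcongr

/-- The local estimates are added over a countable partition of `t`, supplied by the Lindelöf
property, and then `q` tends to 1. Additivity on the image side rests on injectivity and on the
measurability of injective continuous images of Borel sets. -/
theorem measure_image (h : AreaData μ e f s D) {t : Set E} (hts : t ⊆ s) (htm : MeasurableSet t) :
    Measure.euclideanHausdorffMeasure (Module.finrank ℝ E') (f '' t) =
      ∫⁻ x in t, ENNReal.ofReal (D x) ∂μ := by
  have himg {u : Set E} (hu : u ⊆ s) (hum : MeasurableSet u) : MeasurableSet (f '' u) :=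
    hum.image_of_continuousOn_injOn (h.continuousOn_map.mono hu) (h.injOn.mono hu)
  have key (q : ℝ≥0) (hq : 1 < q) :
      Measure.euclideanHausdorffMeasure (Module.finrank ℝ E') (f '' t) ≤
        (q : ℝ≥0∞) ^ (Module.finrank ℝ E' + 1) * ∫⁻ x in t, ENNReal.ofReal (D x) ∂μ ∧
      ∫⁻ x in t, ENNReal.ofReal (D x) ∂μ ≤ (q : ℝ≥0∞) ^ (Module.finrank ℝ E' + 1) *
        Measure.euclideanHausdorffMeasure (Module.finrank ℝ E') (f '' t) := by
    rcases t.eq_empty_or_nonempty with rfl | hne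
    · simp
    choose! U hUo hUx hUb using fun x (hx : x ∈ s) => h.exists_local hq hx
    obtain ⟨c, hcs, hcc, hc⟩ := TopologicalSpace.countable_cover_nhdsWithin (s := t) (f := U)
      (fun x hx => mem_nhdsWithin_of_mem_nhds ((hUo x (hts hx)).mem_nhds (hUx x (hts hx))))
    have hcne : c.Nonempty := by
      rw [nonempty_iff_ne_empty]
      rintro rfl
      simp only [mem_empty_iff_false, iUnion_of_empty, iUnion_empty, subset_empty_iff] at hc
      exact hne.ne_empty hc
    obtain ⟨a, rfl⟩ := hcc.exists_eq_range hcne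
    have ha (n : ℕ) : a n ∈ s := hts (hcs (mem_range_self n))
    set p : ℕ → Set E := fun n => t ∩ disjointed (fun n => U (a n)) n with hp
    have hpm (n : ℕ) : MeasurableSet (p n) :=
      htm.inter (MeasurableSet.disjointed (fun n => (hUo _ (ha n)).measurableSet) n)
    have hpd : Pairwise (Function.onFun Disjoint p) := fun i j hij =>
      ((disjoint_disjointed (fun n => U (a n))) hij).mono inter_subset_right inter_subset_right
    have hpt (n : ℕ) : p n ⊆ s := inter_subset_left.trans hts
    have hpu : ⋃ n, p n = t := by
      rw [hp, ← inter_iUnion, iUnion_disjointed, inter_eq_left]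
      intro x hx
      obtain ⟨_, ⟨n, rfl⟩, hn⟩ := mem_iUnion₂.mp (hc hx)
      exact mem_iUnion.mpr ⟨n, hn⟩
    have hint : ∫⁻ x in t, ENNReal.ofReal (D x) ∂μ =
        ∑' n, ∫⁻ x in p n, ENNReal.ofReal (D x) ∂μ := by
      conv_lhs => rw [← hpu]
      exact lintegral_iUnion hpm hpd _
    have hmeas : Measure.euclideanHausdorffMeasure (Module.finrank ℝ E') (f '' t) =
        ∑' n, Measure.euclideanHausdorffMeasure (Module.finrank ℝ E') (f '' p n) := by
      conv_lhs => rw [← hpu, image_iUnion]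
      refine measure_iUnion (fun i j hij => ?_) fun n => himg (hpt n) (hpm n)
      rw [Function.onFun, disjoint_left]
      rintro _ ⟨x, hx, rfl⟩ ⟨y, hy, hxy⟩
      exact disjoint_left.mp (hpd hij) hx (h.injOn (hpt j hy) (hpt i hx) hxy ▸ hy)
    have hloc (n : ℕ) := hUb (a n) (ha n) (p n)
      (fun x hx => ⟨disjointed_subset _ n hx.2, hpt n hx⟩) (hpm n)
    rw [hint, hmeas, ← ENNReal.tsum_mul_left, ← ENNReal.tsum_mul_left]
    exact ⟨ENNReal.tsum_le_tsum fun n => (hloc n).1, ENNReal.tsum_le_tsum fun n => (hloc n).2⟩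
  have hlim (A : ℝ≥0∞) : Tendsto (fun q : ℝ≥0 => (q : ℝ≥0∞) ^ (Module.finrank ℝ E' + 1) * A)
      (𝓝[>] 1) (𝓝 A) := by
    have h1 : Tendsto (fun q : ℝ≥0 => (q : ℝ≥0∞) ^ (Module.finrank ℝ E' + 1)) (𝓝[>] 1)
        (𝓝 (((1 : ℝ≥0) : ℝ≥0∞) ^ (Module.finrank ℝ E' + 1))) :=
      ((ENNReal.continuous_pow _).comp ENNReal.continuous_coe).continuousAt.tendsto.mono_left
        nhdsWithin_le_nhds
    have h2 := ENNReal.Tendsto.mul_const (b := A) h1 (Or.inl (by simp))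
    simpa using h2
  refine le_antisymm ?_ ?_
  · exact ge_of_tendsto (hlim _) (eventually_nhdsWithin_of_forall fun q hq => (key q hq).1)
  · exact ge_of_tendsto (hlim _) (eventually_nhdsWithin_of_forall fun q hq => (key q hq).2)

/-- The **area formula**: the Euclidean Hausdorff measure of the image, in coordinates. -/
theorem restrict_image (h : AreaData μ e f s D) (hf : Measurable f) :
    (Measure.euclideanHausdorffMeasure (Module.finrank ℝ E')).restrict (f '' s) =
      Measure.map f ((μ.restrict s).withDensity fun x => ENNReal.ofReal (D x)) := by
  ext A hA
  rw [Measure.restrict_apply hA, Measure.map_apply hf hA, withDensity_apply _ (hf hA),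
    Measure.restrict_restrict (hf hA), ← h.measure_image inter_subset_right
      ((hf hA).inter h.measurableSet), image_preimage_inter]

end AreaData

/-- The image of a null set under a locally Lipschitz map is null. -/
theorem euclideanHausdorffMeasure_image_eq_zero {f : E → F} {s : Set E}
    (hf : ∀ x ∈ s, ∃ K : ℝ≥0, ∃ U ∈ 𝓝 x, LipschitzOnWith K f U) (hs : μ s = 0) :
    Measure.euclideanHausdorffMeasure (Module.finrank ℝ E) (f '' s) = 0 := by
  -- For the outer measure pulled back along `f`, being null is a local property of `s`, so
  -- Lipschitz bounds near each point suffice.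
  have key : OuterMeasure.comap f
      (Measure.euclideanHausdorffMeasure (Module.finrank ℝ E) : Measure F).toOuterMeasure s = 0 := by
    refine measure_null_of_locally_null _ fun x hx => ?_
    obtain ⟨K, U, hU, hK⟩ := hf x hx
    refine ⟨s ∩ U, inter_mem_nhdsWithin _ hU, ?_⟩
    rw [OuterMeasure.comap_apply]
    refine le_antisymm ?_ bot_le
    refine (euclideanHausdorffMeasure_image_le_of_lipschitzOnWith
      (hK.mono inter_subset_right) _).trans ?_
    have h0 : (Measure.euclideanHausdorffMeasure (Module.finrank ℝ E) : Measure E) (s ∩ U) = 0 := by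
      -- The norm of `E` need not be Euclidean, but the Hausdorff measure is translation invariant,
      -- hence a multiple of `μ`.
      have hac := Measure.isAddLeftInvariant_eq_smul
        (Measure.euclideanHausdorffMeasure (Module.finrank ℝ E) : Measure E) μ
      rw [hac, Measure.smul_apply, measure_mono_null inter_subset_left hs, smul_zero]
    rw [h0, mul_zero]
  simpa [OuterMeasure.comap_apply] using key

end AreaFormula

end

section

/-! ### Determinants -/

section Determinants

variable {R : Type*} [CommRing R]

/-- Expansion along column 0, whose only nonzero entries are `b 0` on the diagonal and `-a` at the
last index in the last row; the two minors are triangular. For `m = 1` these entries share one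
place, so that case is separate. -/
theorem det_cyclic_bidiagonal_matrix {m : ℕ} [NeZero m] (b a : Fin m → R) :
    (Matrix.of fun k l : Fin m => (if l = k then b k else 0) - (if l = k + 1 then a k else 0)).det =
      ∏ k, b k - ∏ k, a k := by
  obtain ⟨n, rfl⟩ : ∃ n, m = n + 1 := Nat.exists_eq_succ_of_ne_zero (NeZero.ne m)
  obtain rfl | ⟨n, rfl⟩ : n = 0 ∨ ∃ l, n = l + 1 := by
    cases n <;> simp
  · simp [Matrix.det_unique]
  have hone : ∀ k : Fin (n + 1 + 1), k ≠ k + 1 := fun k h => by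
    have := left_eq_add.mp h
    exact one_ne_zero this
  have hlast {k : Fin (n + 1 + 1)} : 0 = k + 1 ↔ k = Fin.last (n + 1) := by
    constructor
    · intro h
      by_contra hk
      have := Fin.val_add_one_of_lt (Fin.lt_last_iff_ne_last.mpr hk)
      rw [← h] at this
      simp at this
    · rintro rfl; simp
  have hsucc (r : Fin (n + 1)) : r.castSucc + 1 = r.succ := Fin.coeSucc_eq_succ
  have hsucc2 {r c : Fin (n + 1)} (h : c.succ = r.succ + 1) : r < c := by
    have hr : r.succ ≠ Fin.last (n + 1) := fun h' => by
      rw [← hlast.mpr h'] at h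
      exact Fin.succ_ne_zero _ h
    have := Fin.val_add_one_of_lt (Fin.lt_last_iff_ne_last.mpr hr)
    rw [← h] at this
    simp only [Fin.val_succ] at this
    exact Fin.lt_def.mpr (by omega)
  rw [Matrix.det_succ_column_zero, Fin.sum_univ_succ]
  rw [Finset.sum_eq_single (Fin.last n)]
  · have h1 : ((Matrix.of fun k l : Fin (n + 1 + 1) =>
        (if l = k then b k else 0) - (if l = k + 1 then a k else 0)).submatrix
        (Fin.succAbove 0) Fin.succ).det = ∏ k : Fin (n + 1), b k.succ := by
      rw [Matrix.det_of_isUpperTriangular]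
      · refine Finset.prod_congr rfl fun k _ => ?_
        simp [hone]
      · intro i j hij
        have hij' : j < i := hij
        simp only [Matrix.submatrix_apply, Fin.zero_succAbove, Matrix.of_apply, Fin.succ_inj]
        rw [if_neg hij'.ne, if_neg fun h => (hsucc2 h).not_gt hij', sub_zero]
    have h2 : ((Matrix.of fun k l : Fin (n + 1 + 1) =>
        (if l = k then b k else 0) - (if l = k + 1 then a k else 0)).submatrix
        (Fin.succAbove (Fin.last n).succ) Fin.succ).det = ∏ k : Fin (n + 1), - a k.castSucc := by
      rw [Matrix.det_of_isLowerTriangular]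
      · refine Finset.prod_congr rfl fun k _ => ?_
        have : k.succ ≠ k.castSucc := fun h => by simp [Fin.ext_iff] at h
        simp [hsucc, this]
      · intro i j hij
        have hij' : i < j := hij
        simp only [Matrix.submatrix_apply, Fin.succ_last, Fin.succAbove_last, Matrix.of_apply,
          hsucc, Fin.succ_inj]
        rw [if_neg, if_neg hij'.ne', sub_zero]
        intro h
        simp only [Fin.ext_iff, Fin.val_succ, Fin.val_castSucc] at h
        have := Fin.lt_def.mp hij'
        omega
    rw [h1, h2, Fin.prod_univ_succ b, Fin.prod_univ_castSucc a, Finset.prod_neg]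
    have h3 : (0 : Fin (n + 1 + 1)) ≠ 0 + 1 := hone 0
    have h4 : (0 : Fin (n + 1 + 1)) = (Fin.last n).succ + 1 := hlast.mpr (by simp)
    have h5 : (0 : Fin (n + 1 + 1)) ≠ (Fin.last n).succ := (Fin.succ_ne_zero _).symm
    rw [Matrix.of_apply, Matrix.of_apply, if_pos rfl, if_neg h3, if_neg h5, if_pos h4]
    simp only [Fin.val_zero, Fin.val_last, Finset.card_univ, Fintype.card_fin,
      Fin.succ_last, Nat.succ_eq_add_one]
    -- The cofactor sign of the corner cancels the `n + 1` signs of the entries `-a` in its minor.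
    have h6 : ((-1 : R) ^ (n + 1)) * (-1) ^ (n + 1) = 1 := by
      rw [← mul_pow]; simp
    linear_combination (-a (Fin.last (n + 1)) * ∏ k : Fin (n + 1), a k.castSucc) * h6
  · intro i _ hi
    have : ¬ (0 : Fin (n + 1 + 1)) = i.succ + 1 := fun h => hi (by
      have := hlast.mp h
      rw [← Fin.succ_last] at this
      exact Fin.succ_injective _ this)
    simp [this, (Fin.succ_ne_zero i).symm]
  · simp

/-- The cyclic bidiagonal operator `w ↦ (b_k w_k - a_k w_{k+1})_k`. -/
def cyclicBidiagonal {m : ℕ} [NeZero m] (b a : Fin m → R) : (Fin m → R) →ₗ[R] (Fin m → R) where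
  toFun w k := b k * w k - a k * w (k + 1)
  map_add' v w := by ext k; simp only [Pi.add_apply]; ring
  map_smul' c w := by ext k; simp only [Pi.smul_apply, smul_eq_mul, RingHom.id_apply]; ring

theorem det_cyclicBidiagonal {m : ℕ} [NeZero m] (b a : Fin m → R) :
    LinearMap.det (cyclicBidiagonal b a) = ∏ k, b k - ∏ k, a k := by
  rw [← det_cyclic_bidiagonal_matrix, ← LinearMap.det_toLin']
  congr 1
  ext i k
  simp [cyclicBidiagonal, Matrix.toLin'_apply, Matrix.mulVec, dotProduct, Pi.single_apply,
    eq_comm]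

/-- The determinant of a block triangular endomorphism. -/
theorem det_eq_mul_of_block_triangular {X Y : Type*} [AddCommGroup X] [AddCommGroup Y] [Module R X]
    [Module R Y] [Module.Free R X] [Module.Free R Y] [Module.Finite R X] [Module.Finite R Y]
    (f : X × Y →ₗ[R] X × Y) (T : X →ₗ[R] X) (L : Y →ₗ[R] Y) (hT : ∀ x, f (x, 0) = (T x, 0))
    (hL : ∀ y, (f (0, y)).2 = L y) : LinearMap.det f = LinearMap.det T * LinearMap.det L := by
  classical
  let b := Module.Free.chooseBasis R X
  let b' := Module.Free.chooseBasis R Y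
  have hmat : LinearMap.toMatrix (b.prod b') (b.prod b') f = Matrix.fromBlocks
      (LinearMap.toMatrix b b T)
      (Matrix.of fun i j => b.repr (f (0, b' j)).1 i) 0 (LinearMap.toMatrix b' b' L) := by
    ext (i | i) (j | j) <;> simp [LinearMap.toMatrix_apply, hT, hL]
  rw [← LinearMap.det_toMatrix (b.prod b'), hmat, Matrix.det_fromBlocks_zero₂₁,
    LinearMap.det_toMatrix, LinearMap.det_toMatrix]

end Determinants

/-! ### Real matrices as diagonals and complex numbers above the diagonal -/

/-- The pairs of indices above the diagonal. -/
abbrev Pairs (N : ℕ) : Type := {p : Fin N × Fin N // p.1 < p.2}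

/-- A family of real matrices, as its diagonals and the complex numbers `w_ab + i w_ba`, `a < b`. -/
def splitDiag (m N : ℕ) : (Fin m → Fin N → Fin N → ℝ) ≃ₗ[ℝ]
    (Fin N → Fin m → ℝ) × (Pairs N → Fin m → ℂ) where
  toFun w := (fun j k => w k j j, fun p k => ⟨w k p.1.1 p.1.2, w k p.1.2 p.1.1⟩)
  map_add' v w := rfl
  map_smul' c w := by
    ext : 1
    · rfl
    · funext p k
      apply Complex.ext <;> simp
  invFun d k a b := if h : a < b then (d.2 ⟨(a, b), h⟩ k).re
    else if h' : b < a then (d.2 ⟨(b, a), h'⟩ k).im else d.1 a k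
  left_inv w := by
    funext k a b
    rcases lt_trichotomy a b with h | rfl | h
    · simp [h]
    · simp
    · simp [h, h.not_gt]
  right_inv d := by
    ext : 1
    · funext j k; simp
    · funext p k
      have := p.2
      apply Complex.ext <;> simp [this, this.not_gt]

theorem sum_eq_sum_diag_add_sum_pairs {M : Type*} [AddCommMonoid M] {N : ℕ}
    (f : Fin N → Fin N → M) :
    ∑ a, ∑ b, f a b = ∑ a, f a a + ∑ p : Pairs N, (f p.1.1 p.1.2 + f p.1.2 p.1.1) := by
  have h1 : ∑ p : Pairs N, (f p.1.1 p.1.2 + f p.1.2 p.1.1) =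
      ∑ p ∈ (Finset.univ : Finset (Fin N × Fin N)).filter (fun p => p.1 < p.2),
        (f p.1 p.2 + f p.2 p.1) := by
    rw [Finset.sum_subtype (p := fun p : Fin N × Fin N => p.1 < p.2)]
    simp
  have h2 : ∑ p ∈ (Finset.univ : Finset (Fin N × Fin N)).filter (fun p => p.1 < p.2), f p.2 p.1 =
      ∑ p ∈ (Finset.univ : Finset (Fin N × Fin N)).filter (fun p => p.2 < p.1), f p.1 p.2 := by
    refine Finset.sum_bij' (fun p _ => p.swap) (fun p _ => p.swap) ?_ ?_ ?_ ?_ ?_ <;> simp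
  have h3 : ∑ a, f a a =
      ∑ p ∈ (Finset.univ : Finset (Fin N × Fin N)).filter (fun p => p.1 = p.2), f p.1 p.2 := by
    refine Finset.sum_bij' (fun a _ => (a, a)) (fun p _ => p.1) ?_ ?_ ?_ ?_ ?_ <;> simp
  rw [h1, Finset.sum_add_distrib, h2, h3, ← Fintype.sum_prod_type',
    ← Finset.sum_filter_add_sum_filter_not Finset.univ (fun p : Fin N × Fin N => p.1 = p.2)]
  congr 1
  rw [← Finset.sum_filter_add_sum_filter_not _ (fun p : Fin N × Fin N => p.1 < p.2),
    Finset.filter_filter, Finset.filter_filter]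
  congr 1
  · refine Finset.sum_congr (Finset.filter_congr fun p _ => ?_) fun _ _ => rfl
    exact ⟨fun h => h.2, fun h => ⟨h.ne, h⟩⟩
  · refine Finset.sum_congr (Finset.filter_congr fun p _ => ?_) fun _ _ => rfl
    exact ⟨fun h => lt_of_le_of_ne (not_lt.mp h.2) (Ne.symm h.1), fun h => ⟨h.ne', h.not_gt⟩⟩

/-- The endomorphism of families of real matrices that gives, up to an isometry, the variation
`X_k Z_k - Z_k X_{k+1}` of the blocks, split into its diagonal and off-diagonal parts. -/
def jacobianInner {m N : ℕ} [NeZero m] (r : Fin N → Fin m → ℝ) (z : Fin N → Fin m → ℂ)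
    (η : (Fin N → Fin N → ℝ) →ₗ[ℝ] (Fin N → ℝ)) :
    (Fin m → Fin N → Fin N → ℝ) →ₗ[ℝ] (Fin N → Fin m → ℝ) × (Pairs N → Fin m → ℂ) where
  toFun w := (fun j k => r j k * (w k j j - if k + 1 = 0 then η (w 0) j else w (k + 1) j j),
    fun p => cyclicBidiagonal (z p.1.2) (z p.1.1) ((splitDiag m N w).2 p))
  map_add' v w := by
    ext : 1
    · funext j k
      simp only [Pi.add_apply, Prod.mk_add_mk, map_add]
      split_ifs <;> ring
    · funext p
      simp only [map_add, Prod.snd_add, Pi.add_apply, Prod.mk_add_mk]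
  map_smul' c v := by
    ext : 1
    · funext j k
      simp only [Pi.smul_apply, Prod.smul_mk, smul_eq_mul, map_smul, RingHom.id_apply]
      split_ifs <;> ring
    · funext p
      simp only [map_smul, Prod.smul_snd, Pi.smul_apply, Prod.smul_mk, RingHom.id_apply]
      exact map_smul ((cyclicBidiagonal (z p.1.2) (z p.1.1)).restrictScalars ℝ) c _

/-- The endomorphism of the coordinate space `(dx, w)` whose determinant gives the volume element of
the generalized normal matrices. -/
def jacobianMap {m N : ℕ} [NeZero m] (s : Fin N → ℝ) (r : Fin N → Fin m → ℝ) (z : Fin N → Fin m → ℂ)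
    (η : (Fin N → Fin N → ℝ) →ₗ[ℝ] (Fin N → ℝ)) :
    (Fin N → ℝ) × (Fin m → Fin N → Fin N → ℝ) →ₗ[ℝ]
      (Fin N → ℝ) × (Fin m → Fin N → Fin N → ℝ) :=
  LinearMap.prodMap
    (LinearMap.pi fun j => (s j • LinearMap.id : ℝ →ₗ[ℝ] ℝ).comp (LinearMap.proj j))
    ((splitDiag m N).symm.toLinearMap ∘ₗ jacobianInner r z η)

/-- Since `η` vanishes on diagonal matrices, the diagonal part of the image depends on the
off-diagonal part of the argument through `η`, but diagonal arguments have no off-diagonal image: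
the map is block triangular. For each `j` the diagonal block is a cyclic bidiagonal operator with
one link cut, so its determinant is a single product. Each pair `a < b` carries a ℂ-linear cyclic
bidiagonal operator. -/
theorem det_jacobianMap {m N : ℕ} [NeZero m] (s : Fin N → ℝ) (r : Fin N → Fin m → ℝ)
    (z : Fin N → Fin m → ℂ) (η : (Fin N → Fin N → ℝ) →ₗ[ℝ] (Fin N → ℝ))
    (hη : ∀ w : Fin N → Fin N → ℝ, (∀ a b, a ≠ b → w a b = 0) → η w = 0) :
    LinearMap.det (jacobianMap s r z η) = (∏ j, s j) * ((∏ j, ∏ k, r j k) *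
      ∏ p : Pairs N, ‖∏ k, z p.1.2 k - ∏ k, z p.1.1 k‖ ^ 2) := by
  have hcyc (j : Fin N) : LinearMap.det (cyclicBidiagonal (r j)
      (fun k : Fin m => r j k * if k + 1 = 0 then 0 else 1)) = ∏ k, r j k := by
    rw [det_cyclicBidiagonal, sub_eq_self]
    -- The link is cut at the index `-1`, whose successor is 0.
    exact Finset.prod_eq_zero (Finset.mem_univ (-1 : Fin m)) (by simp)
  have h1 := det_eq_mul_of_block_triangular
    (jacobianInner r z η ∘ₗ (splitDiag m N).symm.toLinearMap)
    (LinearMap.pi fun j => (cyclicBidiagonal (r j)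
      (fun k : Fin m => r j k * if k + 1 = 0 then 0 else 1)).comp (LinearMap.proj j))
    (LinearMap.pi fun p : Pairs N =>
      ((cyclicBidiagonal (z p.1.2) (z p.1.1)).restrictScalars ℝ).comp (LinearMap.proj p)) ?_ ?_
  · have h2 : LinearMap.det ((splitDiag m N).symm.toLinearMap ∘ₗ jacobianInner r z η) =
        LinearMap.det (jacobianInner r z η ∘ₗ (splitDiag m N).symm.toLinearMap) := by
      rw [← LinearMap.det_conj _ (splitDiag m N)]
      congr 1
      exact LinearMap.ext fun x => (splitDiag m N).apply_symm_apply _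
    rw [jacobianMap, LinearMap.det_prodMap, h2, h1, LinearMap.det_pi, LinearMap.det_pi,
      LinearMap.det_pi]
    congr 2
    · simp
    · exact Finset.prod_congr rfl fun j _ => hcyc j
    · refine Finset.prod_congr rfl fun p _ => ?_
      -- The real determinant of a ℂ-linear map is the squared modulus of its complex determinant.
      rw [LinearMap.det_restrictScalars, det_cyclicBidiagonal, Algebra.norm_complex_apply,
        Complex.normSq_eq_norm_sq]
  · intro d
    have hd : η ((splitDiag m N).symm (d, 0) 0) = 0 := by
      refine hη _ fun a b hab => ?_
      rcases lt_or_gt_of_ne hab with h | h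
      · simp [splitDiag, h]
      · simp [splitDiag, h, h.not_gt]
    have hd' (k : Fin m) (j : Fin N) : (splitDiag m N).symm (d, 0) k j j = d j k := by
      simp [splitDiag]
    simp only [jacobianInner, LinearMap.coe_comp, LinearEquiv.coe_coe, Function.comp_apply,
      LinearMap.coe_mk, AddHom.coe_mk, LinearEquiv.apply_symm_apply, hd, hd']
    ext : 1
    · funext j k
      simp only [cyclicBidiagonal, LinearMap.pi_apply, LinearMap.coe_comp, LinearMap.coe_mk,
        AddHom.coe_mk, LinearMap.coe_proj, Function.comp_apply, Function.eval, Pi.zero_apply]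
      split_ifs <;> ring
    · funext p
      simp
  · intro o
    simp only [jacobianInner, LinearMap.coe_comp, LinearEquiv.coe_coe, Function.comp_apply,
      LinearMap.coe_mk, AddHom.coe_mk, LinearEquiv.apply_symm_apply]
    rfl

end

section

/-! ### The Frobenius norm -/

section Frobenius

variable {n : Type} [Fintype n]

/-- The square of the Euclidean norm of a matrix. -/
def frob (M : Matrix n n ℂ) : ℝ := ∑ a, ∑ b, ‖M a b‖ ^ 2

theorem norm_toSpace_sq (M : Matrix n n ℂ) : ‖toSpace M‖ ^ 2 = frob M := by
  rw [EuclideanSpace.norm_sq_eq, Fintype.sum_prod_type]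
  rfl

theorem frob_eq_trace (M : Matrix n n ℂ) : (frob M : ℂ) = (Mᴴ * M).trace := by
  simp only [frob, Matrix.trace, Matrix.diag_apply, Matrix.mul_apply, Matrix.conjTranspose_apply]
  rw [Finset.sum_comm]
  push_cast
  refine Finset.sum_congr rfl fun a _ => Finset.sum_congr rfl fun b _ => ?_
  rw [RCLike.star_def, mul_comm, Complex.mul_conj, Complex.normSq_eq_norm_sq]
  push_cast
  rfl

theorem frob_conjTranspose (M : Matrix n n ℂ) : frob Mᴴ = frob M := by
  simp only [frob, Matrix.conjTranspose_apply, norm_star]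
  rw [Finset.sum_comm]

theorem frob_unitary_mul [DecidableEq n] {V : Matrix n n ℂ} (hV : V ∈ Matrix.unitaryGroup n ℂ)
    (M : Matrix n n ℂ) : frob (V * M) = frob M := by
  have h := Matrix.mem_unitaryGroup_iff'.mp hV
  rw [Matrix.star_eq_conjTranspose] at h
  have : (frob (V * M) : ℂ) = frob M := by
    rw [frob_eq_trace, frob_eq_trace, Matrix.conjTranspose_mul, Matrix.mul_assoc,
      ← Matrix.mul_assoc Vᴴ, h, Matrix.one_mul]
  exact_mod_cast this

theorem frob_mul_unitary [DecidableEq n] {V : Matrix n n ℂ} (hV : V ∈ Matrix.unitaryGroup n ℂ)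
    (M : Matrix n n ℂ) : frob (M * V) = frob M := by
  rw [← frob_conjTranspose, Matrix.conjTranspose_mul, frob_unitary_mul (V := Vᴴ),
    frob_conjTranspose]
  exact Unitary.star_mem hV

theorem isometry_of_frob {f : MatSpace n → MatSpace n} (g : Matrix n n ℂ → Matrix n n ℂ)
    (hf : ∀ M, f (toSpace M) = toSpace (g M)) (hg : ∀ M M', g M - g M' = g (M - M'))
    (hfr : ∀ M, frob (g M) = frob M) : Isometry f := by
  have hsurj : ∀ x : MatSpace n, ∃ M, x = toSpace M :=
    fun x => ⟨Matrix.of fun a b => x (a, b), rfl⟩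
  refine Isometry.of_dist_eq fun x y => ?_
  obtain ⟨M, rfl⟩ := hsurj x
  obtain ⟨M', rfl⟩ := hsurj y
  have hsub (A B : Matrix n n ℂ) : toSpace A - toSpace B = toSpace (A - B) := rfl
  rw [dist_eq_norm, dist_eq_norm, hf, hf, hsub, hsub, hg,
    ← sq_eq_sq₀ (norm_nonneg _) (norm_nonneg _), norm_toSpace_sq, norm_toSpace_sq, hfr]

end Frobenius

/-! ### Real coordinates on skew-Hermitian matrices -/

/-- Real `N × N` matrices. -/
abbrev RMat (N : ℕ) : Type := Fin N → Fin N → ℝ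

variable {N : ℕ}

/-- The skew-Hermitian matrix with real coordinates `h`. -/
def skew (h : RMat N) : Matrix (Fin N) (Fin N) ℂ :=
  Matrix.of fun a b => (1 + Complex.I) / 2 * (h a b + Complex.I * h b a)

/-- The real coordinates of a skew-Hermitian matrix. -/
def unskew (M : Matrix (Fin N) (Fin N) ℂ) : RMat N := fun a b => (M a b).re + (M a b).im

/-- The off-diagonal part of a real matrix. -/
def offDiag (h : RMat N) : RMat N := fun a b => if a = b then 0 else h a b

/-- The diagonal matrix with the diagonal of `h`. -/
def onDiag (h : RMat N) : RMat N := fun a b => if a = b then h a b else 0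

theorem offDiag_offDiag (h : RMat N) : offDiag (offDiag h) = offDiag h := by
  funext a b
  simp only [offDiag]
  split_ifs <;> rfl

theorem offDiag_add_smul (y v : RMat N) (t : ℝ) :
    offDiag (y + t • v) = offDiag y + t • offDiag v := by
  funext a b
  by_cases h : a = b <;> simp [offDiag, h]

theorem skew_conjTranspose (h : RMat N) : (skew h)ᴴ = -skew h := by
  ext a b
  simp only [Matrix.conjTranspose_apply, Matrix.neg_apply]
  apply Complex.ext <;> simp [skew] <;> ring

theorem apply_of_conjTranspose_eq_neg {M : Matrix (Fin N) (Fin N) ℂ} (hM : Mᴴ = -M) (a b : Fin N) :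
    (M b a).re = -(M a b).re ∧ (M b a).im = (M a b).im := by
  have h := congr_fun (congr_fun hM a) b
  simp only [Matrix.conjTranspose_apply, Matrix.neg_apply] at h
  have h1 := congr_arg Complex.re h
  have h2 := congr_arg Complex.im h
  simp at h1 h2
  exact ⟨h1, h2⟩

theorem skew_unskew {M : Matrix (Fin N) (Fin N) ℂ} (hM : Mᴴ = -M) : skew (unskew M) = M := by
  ext a b
  obtain ⟨h1, h2⟩ := apply_of_conjTranspose_eq_neg hM a b
  apply Complex.ext <;> simp [skew, unskew, h1, h2] <;> ring

theorem unskew_skew (h : RMat N) : unskew (skew h) = h := by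
  funext a b
  simp [skew, unskew]
  ring

/-- `(Re + Im)² = |·|² + 2 Re Im`, and for a skew-Hermitian matrix `Re Im` is antisymmetric in the
two indices, so the cross terms cancel. The coordinates `skew` are chosen for this: they are
isometric, with no factor `√2` off the diagonal. -/
theorem frob_eq_sum_unskew {M : Matrix (Fin N) (Fin N) ℂ} (hM : Mᴴ = -M) :
    frob M = ∑ a, ∑ b, unskew M a b ^ 2 := by
  have h1 (a b : Fin N) : unskew M a b ^ 2 =
      ‖M a b‖ ^ 2 + ((M a b).re * (M a b).im - (M b a).re * (M b a).im) := by
    obtain ⟨h1, h2⟩ := apply_of_conjTranspose_eq_neg hM a b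
    rw [h1, h2, ← Complex.normSq_eq_norm_sq, Complex.normSq_apply, unskew]
    ring
  simp only [h1, Finset.sum_add_distrib, Finset.sum_sub_distrib]
  rw [Finset.sum_comm (f := fun a b => (M b a).re * (M b a).im), sub_self, add_zero]
  rfl

/-! ### The Cayley transform -/

/-- The Cayley transform of the skew-Hermitian matrix with off-diagonal coordinates `h`. -/
def cayley (h : RMat N) : Matrix (Fin N) (Fin N) ℂ :=
  (1 + (1 / 2 : ℂ) • skew (offDiag h)) * (1 - (1 / 2 : ℂ) • skew (offDiag h))⁻¹

theorem cayley_offDiag (h : RMat N) : cayley (offDiag h) = cayley h := by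
  rw [cayley, offDiag_offDiag, cayley]

theorem half_skew_conjTranspose (h : RMat N) :
    ((1 / 2 : ℂ) • skew h)ᴴ = -((1 / 2 : ℂ) • skew h) := by
  rw [Matrix.conjTranspose_smul, skew_conjTranspose]
  simp

-- For skew-Hermitian `X`, the product `(1 + X)(1 - X) = 1 + X†X` is positive definite.
open scoped ComplexOrder in
theorem det_one_sub_skew_ne_zero (h : RMat N) : (1 - (1 / 2 : ℂ) • skew h).det ≠ 0 := by
  have hXs := half_skew_conjTranspose h
  generalize (1 / 2 : ℂ) • skew h = X at *
  have h1 : (1 + X) * (1 - X) = 1 + Xᴴ * X := by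
    rw [hXs]
    noncomm_ring
  have h2 : (1 + Xᴴ * X).PosDef :=
    Matrix.PosDef.one.add_posSemidef (Matrix.posSemidef_conjTranspose_mul_self _)
  have h3 := h2.isUnit
  rw [Matrix.isUnit_iff_isUnit_det, ← h1, Matrix.det_mul] at h3
  exact right_ne_zero_of_mul h3.ne_zero

theorem cayley_mul (h : RMat N) :
    cayley h * (1 - (1 / 2 : ℂ) • skew (offDiag h)) = 1 + (1 / 2 : ℂ) • skew (offDiag h) := by
  rw [cayley, Matrix.mul_assoc, Matrix.nonsing_inv_mul _
    (isUnit_iff_ne_zero.mpr (det_one_sub_skew_ne_zero _)), Matrix.mul_one]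

/-- With `A = 1 - X` and `A† = 1 + X`, the Cayley transform `C` satisfies `C A = A†`. Hence
`A†(C†C)A = A A† = A†A`, and the invertible factors cancel. -/
theorem cayley_mem (h : RMat N) : cayley h ∈ Matrix.unitaryGroup (Fin N) ℂ := by
  rw [Matrix.mem_unitaryGroup_iff', Matrix.star_eq_conjTranspose]
  have hd := isUnit_iff_ne_zero.mpr (det_one_sub_skew_ne_zero (offDiag h))
  have h0 := cayley_mul h
  have hXs := half_skew_conjTranspose (offDiag h)
  generalize (1 / 2 : ℂ) • skew (offDiag h) = X at *
  set A := 1 - X with hA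
  have hA' : Aᴴ = 1 + X := by
    rw [hA, Matrix.conjTranspose_sub, hXs]
    simp
  have hB : (1 + X)ᴴ = A := by rw [← hA', Matrix.conjTranspose_conjTranspose]
  have hcomm : A * Aᴴ = Aᴴ * A := by
    rw [hA', hA]; noncomm_ring
  have hu : IsUnit Aᴴ := by
    rw [Matrix.isUnit_iff_isUnit_det, Matrix.det_conjTranspose]
    exact hd.star
  have hu' : IsUnit A := (Matrix.isUnit_iff_isUnit_det A).mpr hd
  have h1 : Aᴴ * ((cayley h)ᴴ * cayley h) * A = Aᴴ * 1 * A := by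
    calc Aᴴ * ((cayley h)ᴴ * cayley h) * A = (cayley h * A)ᴴ * (cayley h * A) := by
          rw [Matrix.conjTranspose_mul]; simp only [Matrix.mul_assoc]
      _ = _ := by rw [h0, hB, ← hA', hcomm, Matrix.mul_one]
  exact hu.mul_left_cancel (hu'.mul_right_cancel h1)

theorem cayley_eq_one_of_offDiag_eq_zero {h : RMat N} (hh : offDiag h = 0) : cayley h = 1 := by
  have h0 : skew (0 : RMat N) = 0 := by ext; simp [skew]
  simp [cayley, hh, h0]

/-! ### Smoothness of determinants, products and inverses of matrices. -/

section Smooth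

variable {E : Type*} [NormedAddCommGroup E] [NormedSpace ℝ E]

theorem contDiff_matrix_det {n : Type*} [Fintype n] [DecidableEq n] {f : E → Matrix n n ℂ}
    (hf : ∀ i j, ContDiff ℝ ⊤ fun x => f x i j) : ContDiff ℝ ⊤ fun x => (f x).det := by
  simp only [Matrix.det_apply]
  refine ContDiff.sum fun σ _ => ?_
  refine ContDiff.const_smul _ ?_
  exact contDiff_prod fun i _ => hf _ _

theorem contDiff_matrix_mul {n : Type*} [Fintype n] {f g : E → Matrix n n ℂ}
    (hf : ∀ i j, ContDiff ℝ ⊤ fun x => f x i j) (hg : ∀ i j, ContDiff ℝ ⊤ fun x => g x i j)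
    (i j : n) : ContDiff ℝ ⊤ fun x => (f x * g x) i j := by
  simp only [Matrix.mul_apply]
  exact ContDiff.sum fun k _ => (hf _ _).mul (hg _ _)

/-- Cramer's rule writes each entry as a quotient of determinants. -/
theorem contDiff_matrix_inv {n : Type*} [Fintype n] [DecidableEq n] {f : E → Matrix n n ℂ}
    (hf : ∀ i j, ContDiff ℝ ⊤ fun x => f x i j) (h0 : ∀ x, (f x).det ≠ 0) (i j : n) :
    ContDiff ℝ ⊤ fun x => (f x)⁻¹ i j := by
  have h1 (x : E) : (f x)⁻¹ i j = ((f x).det)⁻¹ * ((f x).updateRow j (Pi.single i 1)).det := by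
    rw [Matrix.inv_def, Ring.inverse_eq_inv', Matrix.smul_apply, smul_eq_mul, Matrix.adjugate_apply]
  simp only [h1]
  refine ((contDiff_matrix_det hf).inv h0).mul (contDiff_matrix_det fun k l => ?_)
  by_cases hk : k = j
  · subst hk
    simp only [Matrix.updateRow_self]
    exact contDiff_const
  · simp only [Matrix.updateRow_ne hk]
    exact hf k l

end Smooth

theorem contDiff_skew_offDiag (a b : Fin N) :
    ContDiff ℝ ⊤ fun h : RMat N => skew (offDiag h) a b := by
  have h1 (a b : Fin N) : ContDiff ℝ ⊤ fun h : RMat N => ((offDiag h a b : ℝ) : ℂ) := by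
    have h2 : ContDiff ℝ ⊤ fun h : RMat N => offDiag h a b := by
      unfold offDiag
      split_ifs
      · exact contDiff_const
      · fun_prop
    exact Complex.ofRealCLM.contDiff.comp h2
  exact contDiff_const.mul ((h1 a b).add (contDiff_const.mul (h1 b a)))

theorem contDiff_cayley (a b : Fin N) : ContDiff ℝ ⊤ fun h : RMat N => cayley h a b := by
  refine contDiff_matrix_mul (fun i j => ?_) (fun i j => contDiff_matrix_inv (fun k l => ?_)
    (fun h => det_one_sub_skew_ne_zero _) i j) a b
  · simp only [Matrix.add_apply, Matrix.smul_apply]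
    exact contDiff_const.add ((contDiff_skew_offDiag i j).const_smul _)
  · simp only [Matrix.sub_apply, Matrix.smul_apply]
    exact contDiff_const.sub ((contDiff_skew_offDiag k l).const_smul _)

/-- The differential of the Cayley transform at `y`. -/
def dCayley (y v : RMat N) : Matrix (Fin N) (Fin N) ℂ :=
  Matrix.of fun a b => fderiv ℝ (fun h : RMat N => cayley h a b) y v

theorem hasDerivAt_cayley (y v : RMat N) (a b : Fin N) :
    HasDerivAt (fun t : ℝ => cayley (y + t • v) a b) (dCayley y v a b) 0 := by
  have h1 : HasFDerivAt (fun h : RMat N => cayley h a b)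
      (fderiv ℝ (fun h : RMat N => cayley h a b) y) (y + (0 : ℝ) • v) := by
    rw [zero_smul, add_zero]
    exact ((contDiff_cayley a b).differentiable (by simp)).differentiableAt.hasFDerivAt
  have h2 : HasDerivAt (fun t : ℝ => y + t • v) v 0 := by
    simpa using ((hasDerivAt_id (0 : ℝ)).smul_const v).const_add y
  exact h1.comp_hasDerivAt (0 : ℝ) h2

theorem dCayley_offDiag (y v : RMat N) : dCayley (offDiag y) v = dCayley y v := by
  ext a b
  refine (hasDerivAt_cayley (offDiag y) v a b).unique ?_
  have h : (fun t : ℝ => cayley (offDiag y + t • v) a b) = fun t => cayley (y + t • v) a b := by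
    funext t
    rw [← cayley_offDiag (offDiag y + t • v), ← cayley_offDiag (y + t • v), offDiag_add_smul,
      offDiag_add_smul, offDiag_offDiag]
  rw [h]
  exact hasDerivAt_cayley y v a b

theorem dCayley_eq_zero {y v : RMat N} (hv : offDiag v = 0) : dCayley y v = 0 := by
  ext a b
  refine (hasDerivAt_cayley y v a b).unique ?_
  have h : (fun t : ℝ => cayley (y + t • v) a b) = fun _ => cayley y a b := by
    funext t
    rw [← cayley_offDiag, offDiag_add_smul, hv, smul_zero, add_zero, cayley_offDiag]
  rw [h]
  exact hasDerivAt_const _ _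

/-- Differentiating `C(t)(1 - tX/2) = 1 + tX/2` at `t = 0`, where `C = 1`, gives `C' - X/2 = X/2`.
-/
theorem dCayley_zero (v : RMat N) : dCayley 0 v = skew (offDiag v) := by
  ext a b
  have hs (t : ℝ) (c d : Fin N) : skew (offDiag (0 + t • v)) c d = t * skew (offDiag v) c d := by
    by_cases hcd : c = d
    · subst hcd; simp [skew, offDiag]
    · simp [skew, offDiag, hcd, Ne.symm hcd]; ring
  have h1 : (fun t : ℝ => cayley (0 + t • v) a b - (1 / 2 : ℂ) * ∑ c, cayley (0 + t • v) a c *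
      (t * skew (offDiag v) c b)) =
      fun t : ℝ => (1 : Matrix (Fin N) (Fin N) ℂ) a b + (1 / 2 : ℂ) * (t * skew (offDiag v) a b) := by
    funext t
    have := congr_fun (congr_fun (cayley_mul (0 + t • v)) a) b
    rw [Matrix.mul_sub, Matrix.mul_one, Matrix.mul_smul] at this
    simp only [Matrix.sub_apply, Matrix.add_apply, Matrix.smul_apply, smul_eq_mul, hs,
      Matrix.mul_apply] at this
    exact this
  have ht (c d : Fin N) : HasDerivAt (fun t : ℝ => (t : ℂ) * skew (offDiag v) c d)
      (skew (offDiag v) c d) 0 := by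
    simpa using (Complex.ofRealCLM.hasDerivAt (x := (0 : ℝ))).mul_const (skew (offDiag v) c d)
  have h2 := ((hasDerivAt_cayley 0 v a b).fun_sub
    ((HasDerivAt.fun_sum (u := Finset.univ) fun c _ =>
      (hasDerivAt_cayley 0 v a c).fun_mul (ht c b)).const_mul (1 / 2 : ℂ)))
  have h3 := ((ht a b).const_mul (1 / 2 : ℂ)).const_add ((1 : Matrix (Fin N) (Fin N) ℂ) a b)
  rw [h1] at h2
  have h4 := h2.unique h3
  have h5 : cayley ((0 : RMat N) + (0 : ℝ) • v) = 1 :=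
    cayley_eq_one_of_offDiag_eq_zero (by funext; simp [offDiag])
  simp only [h5, Complex.ofReal_zero, zero_mul, mul_zero, zero_add (M := ℂ), Matrix.one_apply, ite_mul,
    one_mul, Finset.sum_ite_eq, Finset.mem_univ, if_true] at h4
  linear_combination h4

/-- The left logarithmic derivative of the Cayley transform. -/
def logDCayley (y v : RMat N) : Matrix (Fin N) (Fin N) ℂ := (cayley y)ᴴ * dCayley y v

theorem cayley_mul_logDCayley (y v : RMat N) : cayley y * logDCayley y v = dCayley y v := by
  have h := Matrix.mem_unitaryGroup_iff.mp (cayley_mem y)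
  rw [Matrix.star_eq_conjTranspose] at h
  rw [logDCayley, ← Matrix.mul_assoc, h, Matrix.one_mul]

/-- This is the derivative of `C†C = 1`. -/
theorem logDCayley_conjTranspose (y v : RMat N) : (logDCayley y v)ᴴ = -logDCayley y v := by
  rw [eq_neg_iff_add_eq_zero, logDCayley, Matrix.conjTranspose_mul, Matrix.conjTranspose_conjTranspose]
  ext a b
  have h1 : (fun t : ℝ => ∑ c, star (cayley (y + t • v) c a) * cayley (y + t • v) c b) =
      fun _ => (1 : Matrix (Fin N) (Fin N) ℂ) a b := by
    funext t
    have := Matrix.mem_unitaryGroup_iff'.mp (cayley_mem (y + t • v))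
    rw [Matrix.star_eq_conjTranspose] at this
    rw [← this]
    rfl
  have h2 := HasDerivAt.fun_sum (u := Finset.univ) fun c _ =>
    (hasDerivAt_cayley y v c a).star.fun_mul (hasDerivAt_cayley y v c b)
  rw [h1] at h2
  have h3 := h2.unique (hasDerivAt_const _ _)
  simp only [zero_smul, add_zero, Finset.sum_add_distrib] at h3
  simpa [Matrix.mul_apply, Matrix.add_apply, Matrix.conjTranspose_apply] using h3

/-- The coordinates of the left logarithmic derivative of `Γ(h) = cayley h * diag(e^{i h_jj})`. -/
def chartDeriv (y : RMat N) : RMat N →ₗ[ℝ] RMat N where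
  toFun v := unskew (logDCayley y v) + onDiag v
  map_add' v w := by
    funext a b
    simp only [unskew, logDCayley, dCayley, Matrix.mul_apply, Matrix.of_apply, map_add, onDiag,
      Pi.add_apply, mul_add, Finset.sum_add_distrib, Complex.add_re, Complex.add_im]
    split_ifs <;> ring
  map_smul' c v := by
    funext a b
    have : ∀ k, (cayley y)ᴴ a k * (c • fderiv ℝ (fun h : RMat N => cayley h k b) y v) =
      c • ((cayley y)ᴴ a k * fderiv ℝ (fun h : RMat N => cayley h k b) y v) :=
        fun k => mul_smul_comm _ _ _
    simp only [unskew, logDCayley, dCayley, Matrix.mul_apply, Matrix.of_apply, map_smul, onDiag,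
      Pi.add_apply, Pi.smul_apply, this, ← Finset.smul_sum, Complex.smul_re, Complex.smul_im,
      smul_eq_mul, RingHom.id_apply]
    split_ifs <;> ring

/-- The volume element of the chart `Γ`. -/
def chartDensity (y : RMat N) : ℝ := |LinearMap.det (chartDeriv y)|

theorem logDCayley_offDiag (y v : RMat N) : logDCayley (offDiag y) v = logDCayley y v := by
  rw [logDCayley, dCayley_offDiag, cayley_offDiag, logDCayley]

theorem chartDeriv_offDiag (y : RMat N) : chartDeriv (offDiag y) = chartDeriv y := by
  refine LinearMap.ext fun v => ?_
  change unskew (logDCayley (offDiag y) v) + onDiag v = unskew (logDCayley y v) + onDiag v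
  rw [logDCayley_offDiag]

theorem chartDensity_offDiag (y : RMat N) : chartDensity (offDiag y) = chartDensity y := by
  rw [chartDensity, chartDeriv_offDiag, chartDensity]

/-- The Cayley factor ignores the diagonal of its argument, so only the phases move. This is the
source of the block triangular form of the Jacobian of `param`. -/
theorem chartDeriv_of_offDiag_eq_zero (y : RMat N) {v : RMat N} (hv : offDiag v = 0) :
    chartDeriv y v = v := by
  funext a b
  have := congr_fun (congr_fun hv a) b
  simp only [offDiag, Pi.zero_apply, ite_eq_left_iff] at this
  simp only [chartDeriv, LinearMap.coe_mk, AddHom.coe_mk, logDCayley, dCayley_eq_zero hv]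
  by_cases hab : a = b
  · simp [unskew, onDiag, hab]
  · simp [unskew, onDiag, hab, this hab]

theorem chartDeriv_zero : chartDeriv (0 : RMat N) = LinearMap.id := by
  refine LinearMap.ext fun v => ?_
  have h1 : logDCayley (0 : RMat N) v = skew (offDiag v) := by
    rw [logDCayley, dCayley_zero, cayley_eq_one_of_offDiag_eq_zero (by funext; simp [offDiag])]
    simp
  funext a b
  simp only [chartDeriv, LinearMap.coe_mk, AddHom.coe_mk, h1, unskew_skew, LinearMap.id_apply,
    Pi.add_apply]
  by_cases hab : a = b <;> simp [onDiag, offDiag, hab]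

theorem chartDensity_zero : chartDensity (0 : RMat N) = 1 := by
  simp [chartDensity, chartDeriv_zero]

theorem continuous_chartDensity : Continuous (chartDensity (N := N)) := by
  refine Continuous.abs ?_
  have h1 : ∀ y : RMat N, LinearMap.det (chartDeriv y) = ContinuousLinearMap.det
      (LinearMap.toContinuousLinearMap (chartDeriv y)) := fun y => rfl
  simp only [h1]
  refine ContinuousLinearMap.continuous_det.comp ?_
  rw [continuous_clm_apply]
  intro v
  refine continuous_pi fun a => continuous_pi fun b => ?_
  have h2 : Continuous fun y : RMat N => logDCayley y v a b := by
    simp only [logDCayley, Matrix.mul_apply, Matrix.conjTranspose_apply, dCayley, Matrix.of_apply]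
    refine continuous_finsetSum _ fun k _ => ?_
    exact (contDiff_cayley k a).continuous.star.mul
      (((contDiff_cayley k b).continuous_fderiv (by simp)).clm_apply continuous_const)
  change Continuous fun y : RMat N => (logDCayley y v a b).re + (logDCayley y v a b).im + onDiag v a b
  exact ((Complex.continuous_re.comp h2).add (Complex.continuous_im.comp h2)).add continuous_const

end

section

/-! ### Smooth families of matrices and Euclidean coordinates -/

theorem measurable_toSpace_of_entries {X : Type*} {n : Type} [Fintype n] [MeasurableSpace X]
    {f : X → Matrix n n ℂ} (hf : ∀ i j, Measurable fun x => f x i j) :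
    Measurable fun x => toSpace (f x) :=
  (WithLp.measurable_toLp 2 (n × n → ℂ)).comp (measurable_pi_lambda _ fun p => hf p.1 p.2)

/-- A family of matrices with smooth entries, as a map to the Euclidean space of matrices: its
differential is computed entrywise along lines. -/
theorem exists_hasStrictFDerivAt_toSpace {E : Type*} [NormedAddCommGroup E] [NormedSpace ℝ E]
    {n : Type} [Fintype n] {f : E → Matrix n n ℂ} {x : E} {M : E → Matrix n n ℂ}
    (hf : ∀ i j, ContDiffAt ℝ 1 (fun y => f y i j) x)
    (hM : ∀ v i j, HasDerivAt (fun t : ℝ => f (x + t • v) i j) (M v i j) 0) :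
    ∃ f' : E →L[ℝ] MatSpace n, HasStrictFDerivAt (fun y => toSpace (f y)) f' x ∧
      ∀ v, ‖f' v‖ ^ 2 = frob (M v) := by
  have h1 : ContDiffAt ℝ 1 (fun y => toSpace (f y)) x :=
    contDiffAt_piLp' 2 fun p => hf p.1 p.2
  have h2 := h1.hasStrictFDerivAt (by simp)
  refine ⟨_, h2, fun v => ?_⟩
  rw [← norm_toSpace_sq]
  congr 2
  ext p
  have h3 := (hasStrictFDerivAt_piLp 2).mp h2 p
  have h4 : HasDerivAt (fun t : ℝ => x + t • v) v 0 := by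
    simpa using ((hasDerivAt_id (0 : ℝ)).smul_const v).const_add x
  have h5 := h3.hasFDerivAt
  rw [show x = x + (0 : ℝ) • v by simp] at h5
  have h6 := h5.comp_hasDerivAt (0 : ℝ) h4
  have h7 := h6.unique (hM v p.1 p.2)
  simpa [toSpace] using h7

/-- A linear equivalence which preserves the volume of one bounded set with interior is volume
preserving. -/
theorem measurePreserving_of_measure_eq {E E' : Type*} [NormedAddCommGroup E] [NormedSpace ℝ E]
    [MeasurableSpace E] [BorelSpace E] [FiniteDimensional ℝ E] [NormedAddCommGroup E']
    [NormedSpace ℝ E'] [MeasurableSpace E'] [BorelSpace E'] [FiniteDimensional ℝ E']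
    (μ : Measure E) (ν : Measure E') [μ.IsAddHaarMeasure] [ν.IsAddHaarMeasure] (e : E ≃L[ℝ] E')
    (K : Set E') (hK : MeasurableSet K) (h0 : ν K ≠ 0) (htop : ν K ≠ ⊤) (h : μ (e ⁻¹' K) = ν K) :
    MeasurePreserving e μ ν := by
  refine ⟨e.continuous.measurable, ?_⟩
  have h1 := Measure.isAddLeftInvariant_eq_smul (Measure.map e μ) ν
  have h2 : (Measure.map e μ) K = ν K := by rw [Measure.map_apply e.continuous.measurable hK, h]
  rw [h1, Measure.smul_apply, ENNReal.smul_def, smul_eq_mul] at h2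
  have h3 : ((Measure.map e μ).addHaarScalarFactor ν : ℝ≥0∞) = 1 :=
    (ENNReal.mul_eq_right h0 htop).mp h2
  rw [h1, show (Measure.map e μ).addHaarScalarFactor ν = 1 by exact_mod_cast h3, one_smul]

/-- The real matrices as a Euclidean space. -/
def rmatEquiv (N : ℕ) : RMat N ≃L[ℝ] EuclideanSpace ℝ (Fin N × Fin N) :=
  ((LinearEquiv.curry ℝ ℝ (Fin N) (Fin N)).symm.toContinuousLinearEquiv).trans
    (PiLp.continuousLinearEquiv 2 ℝ (fun _ : Fin N × Fin N => ℝ)).symm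

theorem norm_rmatEquiv_sq {N : ℕ} (w : RMat N) : ‖rmatEquiv N w‖ ^ 2 = ∑ a, ∑ b, w a b ^ 2 := by
  rw [EuclideanSpace.norm_sq_eq, Fintype.sum_prod_type]
  simp [rmatEquiv]

theorem measurePreserving_rmatEquiv (N : ℕ) : MeasurePreserving (rmatEquiv N) := by
  have h1 : MeasurePreserving ((LinearEquiv.curry ℝ ℝ (Fin N) (Fin N)).symm.toContinuousLinearEquiv)
      (volume : Measure (RMat N)) (volume : Measure (Fin N × Fin N → ℝ)) := by
    refine measurePreserving_of_measure_eq _ _ _ (Set.univ.pi fun _ => Set.Icc (0 : ℝ) 1)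
      (MeasurableSet.univ_pi fun _ => measurableSet_Icc)
      (by simp only [volume_pi_pi, Real.volume_Icc]; simp)
      (by simp only [volume_pi_pi, Real.volume_Icc]; simp) ?_
    have : (((LinearEquiv.curry ℝ ℝ (Fin N) (Fin N)).symm.toContinuousLinearEquiv) ⁻¹'
        (Set.univ.pi fun _ => Set.Icc (0 : ℝ) 1)) =
        Set.univ.pi fun _ => Set.univ.pi fun _ => Set.Icc (0 : ℝ) 1 := by
      ext h
      simp only [Set.mem_preimage, Set.mem_univ_pi, Prod.forall]
      rfl
    rw [this]
    simp only [volume_pi_pi, Real.volume_Icc]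
    simp
  exact (PiLp.volume_preserving_toLp (Fin N × Fin N)).comp h1

/-! ### A chart of the unitary group -/

variable {N : ℕ}

/-- The Cayley transform, in the unitary group. -/
def cayleyU (h : RMat N) : U N := ⟨cayley h, cayley_mem h⟩

/-- The phases `e^{i h_jj}`. -/
def phase (h : RMat N) : Fin N → Circle := fun j => Circle.exp (h j j)

/-- The chart `Γ(h) = cayley(h) diag(e^{i h_jj})` of the unitary group. -/
def chartU (h : RMat N) : U N := cayleyU h * diagU N (phase h)

theorem chartU_apply (h : RMat N) (a b : Fin N) :
    (chartU h : Matrix (Fin N) (Fin N) ℂ) a b = cayley h a b * Complex.exp (h b b * Complex.I) := by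
  change (cayley h * Matrix.diagonal fun j => (phase h j : ℂ)) a b = _
  rw [Matrix.mul_diagonal]
  rfl

theorem contDiff_chartU (a b : Fin N) :
    ContDiff ℝ ⊤ fun h : RMat N => (chartU h : Matrix (Fin N) (Fin N) ℂ) a b := by
  simp only [chartU_apply]
  have h1 : ContDiff ℝ ⊤ fun h : RMat N => ((h b b : ℝ) : ℂ) :=
    Complex.ofRealCLM.contDiff.comp (by fun_prop)
  exact (contDiff_cayley a b).mul ((h1.mul contDiff_const).cexp)

theorem skew_onDiag (v : RMat N) : skew (onDiag v) = Matrix.diagonal fun j => Complex.I * v j j := by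
  ext a b
  by_cases hab : a = b
  · subst hab
    apply Complex.ext <;> simp [skew, onDiag]
    ring
  · simp [skew, onDiag, hab, Ne.symm hab]

theorem hasDerivAt_phase (y v : RMat N) (b : Fin N) :
    HasDerivAt (fun t : ℝ => Complex.exp (((y + t • v) b b : ℝ) * Complex.I))
      (Complex.I * v b b * Complex.exp (y b b * Complex.I)) 0 := by
  have h1 : HasDerivAt (fun t : ℝ => (((y + t • v) b b : ℝ) : ℂ) * Complex.I)
      (v b b * Complex.I) 0 := by
    have h2 : HasDerivAt (fun t : ℝ => (y + t • v) b b) (v b b) 0 := by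
      simpa using ((hasDerivAt_id (0 : ℝ)).mul_const (v b b)).const_add (y b b)
    exact h2.ofReal_comp.mul_const _
  convert! h1.cexp using 1
  simp
  ring

/-- The logarithmic derivative is inserted between the two factors, as `C (C† dC + i diag v) P` with
`P` the diagonal phases. The outer factors are unitary and do not affect the Frobenius norm. -/
theorem hasDerivAt_chartU (y v : RMat N) (a b : Fin N) :
    HasDerivAt (fun t : ℝ => (chartU (y + t • v) : Matrix (Fin N) (Fin N) ℂ) a b)
      ((cayley y * (logDCayley y v + skew (onDiag v)) *
        (diagU N (phase y) : Matrix (Fin N) (Fin N) ℂ)) a b) 0 := by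
  simp only [chartU_apply]
  convert! (hasDerivAt_cayley y v a b).fun_mul (hasDerivAt_phase y v b) using 1
  change ((cayley y * (logDCayley y v + skew (onDiag v)) *
    Matrix.diagonal fun j => (phase y j : ℂ)) a b) = _
  rw [Matrix.mul_diagonal, Matrix.mul_add, cayley_mul_logDCayley, Matrix.add_apply, skew_onDiag,
    Matrix.mul_diagonal]
  simp only [zero_smul, add_zero, phase, Circle.coe_exp]
  ring

theorem unskew_add (A B : Matrix (Fin N) (Fin N) ℂ) : unskew (A + B) = unskew A + unskew B := by
  funext a b
  simp [unskew]
  ring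

theorem chartDeriv_eq_unskew (y v : RMat N) :
    chartDeriv y v = unskew (logDCayley y v + skew (onDiag v)) := by
  rw [unskew_add, unskew_skew]
  rfl

theorem logDCayley_add_conjTranspose (y v : RMat N) :
    (logDCayley y v + skew (onDiag v))ᴴ = -(logDCayley y v + skew (onDiag v)) := by
  rw [Matrix.conjTranspose_add, logDCayley_conjTranspose, skew_conjTranspose, neg_add]

theorem exists_deriv_chartU (y : RMat N) : ∃ f' : RMat N →L[ℝ] MatSpace (Fin N),
    HasStrictFDerivAt (fun h : RMat N => toSpace (chartU h : Matrix (Fin N) (Fin N) ℂ)) f' y ∧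
      ∀ v, ‖f' v‖ = ‖rmatEquiv N (chartDeriv y v)‖ := by
  obtain ⟨f', hf', hv⟩ := exists_hasStrictFDerivAt_toSpace
    (f := fun h : RMat N => (chartU h : Matrix (Fin N) (Fin N) ℂ)) (x := y)
    (fun i j => ((contDiff_chartU i j).of_le le_top).contDiffAt) (hasDerivAt_chartU y)
  refine ⟨f', hf', fun v => ?_⟩
  rw [← sq_eq_sq₀ (norm_nonneg _) (norm_nonneg _), hv, frob_mul_unitary (diagU N (phase y)).2,
    frob_unitary_mul (cayley_mem y), norm_rmatEquiv_sq,
    frob_eq_sum_unskew (logDCayley_add_conjTranspose y v), chartDeriv_eq_unskew]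

theorem chartU_zero_eq : chartU (0 : RMat N) = 1 := by
  ext a b
  rw [chartU_apply, cayley_eq_one_of_offDiag_eq_zero (by funext; simp [offDiag])]
  simp

/-- The chart `Γ`, extended to all matrices near the identity. -/
def polarChart (p : RMat N × RMat N) : Matrix (Fin N) (Fin N) ℂ :=
  (chartU p.1 : Matrix (Fin N) (Fin N) ℂ) * (1 + Complex.I • skew p.2)

/-- `polarChart` with values in a normed space. -/
def polarFun (p : RMat N × RMat N) : Fin N → Fin N → ℂ := polarChart p

theorem exists_matrix_split (M : Matrix (Fin N) (Fin N) ℂ) :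
    ∃ v u : RMat N, M = skew v + Complex.I • skew u := by
  -- The skew-Hermitian part of `M`, and its Hermitian part divided by `i`.
  refine ⟨unskew ((1 / 2 : ℂ) • (M - Mᴴ)), unskew ((-Complex.I / 2) • (M + Mᴴ)), ?_⟩
  rw [skew_unskew, skew_unskew]
  · ext a b
    simp only [Matrix.add_apply, Matrix.smul_apply, Matrix.sub_apply, smul_eq_mul]
    linear_combination (1 / 2 * (M a b + Mᴴ a b)) * Complex.I_mul_I
  · rw [Matrix.conjTranspose_smul, Matrix.conjTranspose_add, Matrix.conjTranspose_conjTranspose,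
      add_comm, ← neg_smul]
    congr 1
    simp
    ring
  · rw [Matrix.conjTranspose_smul, Matrix.conjTranspose_sub, Matrix.conjTranspose_conjTranspose,
      ← neg_sub, smul_neg]
    simp

theorem eq_zero_of_split_eq_zero {v u : RMat N} (h : skew v + Complex.I • skew u = 0) :
    v = 0 ∧ u = 0 := by
  have h1 := congr_arg Matrix.conjTranspose h
  rw [Matrix.conjTranspose_add, Matrix.conjTranspose_smul, skew_conjTranspose, skew_conjTranspose,
    Matrix.conjTranspose_zero] at h1
  have h0 : unskew (0 : Matrix (Fin N) (Fin N) ℂ) = 0 := by funext; simp [unskew]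
  have hv : skew v = 0 := by
    ext a b
    have e1 := congr_fun (congr_fun h a) b
    have e2 := congr_fun (congr_fun h1 a) b
    simp at e1 e2 ⊢
    linear_combination (e1 - e2) / 2
  have hu : skew u = 0 := by
    ext a b
    have e1 := congr_fun (congr_fun h a) b
    simp [hv] at e1
    simpa using e1
  exact ⟨by rw [← unskew_skew v, hv, h0], by rw [← unskew_skew u, hu, h0]⟩

/-- At the origin the differential is `(v, u) ↦ skew v + i skew u`, the bijective splitting of a
matrix into skew-Hermitian and Hermitian parts. The inverse function theorem for this extension to
all matrices yields local injectivity and openness of `Γ` itself. -/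
theorem polarChart_hasStrictFDerivAt : ∃ L : (RMat N × RMat N) ≃L[ℝ] (Fin N → Fin N → ℂ),
    HasStrictFDerivAt (polarFun (N := N))
      (L : (RMat N × RMat N) →L[ℝ] (Fin N → Fin N → ℂ)) 0 := by
  have hs (a b : Fin N) : ContDiff ℝ ⊤ fun h : RMat N => skew h a b := by
    have h1 (a b : Fin N) : ContDiff ℝ ⊤ fun h : RMat N => ((h a b : ℝ) : ℂ) :=
      Complex.ofRealCLM.contDiff.comp (by fun_prop)
    exact contDiff_const.mul ((h1 a b).add (contDiff_const.mul (h1 b a)))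
  have hc (a b : Fin N) : ContDiff ℝ ⊤ fun p : RMat N × RMat N => polarChart p a b := by
    refine contDiff_matrix_mul (fun i j => (contDiff_chartU i j).comp contDiff_fst)
      (fun i j => ?_) a b
    simp only [Matrix.add_apply, Matrix.smul_apply]
    exact contDiff_const.add (((hs i j).comp contDiff_snd).const_smul _)
  have hc' : ContDiff ℝ ⊤ (polarFun (N := N)) :=
    contDiff_pi.mpr fun a => contDiff_pi.mpr fun b => hc a b
  have hst := hc'.contDiffAt.hasStrictFDerivAt (x := 0) (by simp)
  set f' := fderiv ℝ (polarFun (N := N)) 0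
  have hf' (v u : RMat N) (a b : Fin N) : f' (v, u) a b = (skew v + Complex.I • skew u) a b := by
    have h5 := hst.hasFDerivAt
    rw [show (0 : RMat N × RMat N) = 0 + (0 : ℝ) • (v, u) by simp] at h5
    have h4 : HasDerivAt (fun t : ℝ => (0 : RMat N × RMat N) + t • (v, u)) (v, u) 0 := by
      simpa using ((hasDerivAt_id (0 : ℝ)).smul_const (v, u)).const_add (0 : RMat N × RMat N)
    have h6 := hasDerivAt_pi.mp (hasDerivAt_pi.mp (h5.comp_hasDerivAt (0 : ℝ) h4) a) b
    refine h6.unique ?_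
    have hk (c d : Fin N) : HasDerivAt
        (fun t : ℝ => (1 + Complex.I • skew (0 + t • u)) c d) (Complex.I * skew u c d) 0 := by
      have e1 : (fun t : ℝ => (1 + Complex.I • skew (0 + t • u)) c d) = fun t : ℝ =>
          (1 : Matrix (Fin N) (Fin N) ℂ) c d + t * (Complex.I * skew u c d) := by
        funext t
        simp [skew]
        ring
      rw [e1]
      simpa using ((Complex.ofRealCLM.hasDerivAt (x := (0 : ℝ))).mul_const _).const_add
        ((1 : Matrix (Fin N) (Fin N) ℂ) c d)
    have h7 := HasDerivAt.fun_sum (u := Finset.univ) fun c _ =>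
      (hasDerivAt_chartU 0 v a c).fun_mul (hk c b)
    have h8 : skew v = skew (offDiag v) + skew (onDiag v) := by
      ext c d
      by_cases hcd : c = d
      · subst hcd; simp [skew, offDiag, onDiag]
      · simp [skew, offDiag, onDiag, hcd, Ne.symm hcd]
    have hph : (diagU N (phase (0 : RMat N)) : Matrix (Fin N) (Fin N) ℂ) = 1 := by
      change Matrix.diagonal (fun j => (phase (0 : RMat N) j : ℂ)) = 1
      simp [phase]
    have hs0 : skew (0 : RMat N) = 0 := by ext; simp [skew]
    have hch : (chartU (0 + (0 : ℝ) • v) : Matrix (Fin N) (Fin N) ℂ) = 1 := by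
      rw [zero_smul, add_zero, chartU_zero_eq]; rfl
    have hch' : (1 + Complex.I • skew (0 + (0 : ℝ) • u) : Matrix (Fin N) (Fin N) ℂ) = 1 := by
      rw [zero_smul, add_zero, hs0, smul_zero, add_zero]
    have hlog : cayley (0 : RMat N) * (logDCayley 0 v + skew (onDiag v)) *
        (diagU N (phase (0 : RMat N)) : Matrix (Fin N) (Fin N) ℂ) = skew v := by
      rw [Matrix.mul_add, cayley_mul_logDCayley, dCayley_zero, hph, Matrix.mul_one,
        cayley_eq_one_of_offDiag_eq_zero (by funext; simp [offDiag]), Matrix.one_mul, ← h8]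
    rw [hlog, hch, hch', Finset.sum_add_distrib] at h7
    convert! h7 using 1
    simp [Matrix.one_apply]
  have hbij : Function.Bijective f' := by
    constructor
    · rw [injective_iff_map_eq_zero]
      rintro ⟨v, u⟩ h
      have := eq_zero_of_split_eq_zero (v := v) (u := u) (by
        ext a b
        rw [← hf', h]; rfl)
      exact Prod.ext this.1 this.2
    · intro M
      obtain ⟨v, u, h⟩ := exists_matrix_split (Matrix.of M)
      refine ⟨(v, u), ?_⟩
      funext a b
      rw [hf', ← h]
      rfl
  exact ⟨(LinearEquiv.ofBijective f'.toLinearMap hbij).toContinuousLinearEquiv, hst⟩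

open Topology Filter in
/-- The chart `Γ` is injective near the origin. -/
theorem exists_injOn_chartU : ∃ V ∈ 𝓝 (0 : RMat N), Set.InjOn (chartU (N := N)) V := by
  obtain ⟨L, hL⟩ := polarChart_hasStrictFDerivAt (N := N)
  have hinj := (hL.toOpenPartialHomeomorph _).injOn
  have hsrc := (hL.toOpenPartialHomeomorph _).open_source.mem_nhds
    hL.mem_toOpenPartialHomeomorph_source
  have hc : Continuous fun h : RMat N => (h, (0 : RMat N)) := by fun_prop
  refine ⟨_, hc.continuousAt.preimage_mem_nhds hsrc, fun h hh h' hh' heq => ?_⟩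
  have h0 : ∀ h : RMat N, polarChart (h, 0) = (chartU h : Matrix (Fin N) (Fin N) ℂ) := fun h => by
    have hs0 : skew (0 : RMat N) = 0 := by ext; simp [skew]
    simp [polarChart, hs0]
  have := hinj hh hh' (by
    change polarChart (h, 0) = polarChart (h', 0)
    rw [h0, h0, heq])
  exact congr_arg Prod.fst this

open Topology Filter in
/-- The chart `Γ` is open at the origin. -/
theorem image_chartU_mem_nhds {V : Set (RMat N)} (hV : V ∈ 𝓝 (0 : RMat N)) :
    chartU '' V ∈ 𝓝 (1 : U N) := by
  obtain ⟨L, hL⟩ := polarChart_hasStrictFDerivAt (N := N)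
  have hs0 : skew (0 : RMat N) = 0 := by ext; simp [skew]
  have hone : polarFun (0 : RMat N × RMat N) = ((1 : U N) : Matrix (Fin N) (Fin N) ℂ) := by
    simp [polarFun, polarChart, hs0, chartU_zero_eq]
    rfl
  have hmap := hL.map_nhds_eq_of_equiv
  -- If `Γ(h) H` is unitary with `H` Hermitian, then `H² = 1`. Invertibility of `1 + H`, an open
  -- condition at `H = 1`, leaves only `H = 1`.
  have hW : {k : RMat N | (1 + (1 + Complex.I • skew k)).det ≠ 0} ∈ 𝓝 (0 : RMat N) := by
    have hcont : Continuous fun k : RMat N => (1 + (1 + Complex.I • skew k)).det := by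
      refine Continuous.matrix_det (continuous_matrix fun a b => ?_)
      simp only [skew, Matrix.add_apply, Matrix.smul_apply, Matrix.of_apply]
      fun_prop
    refine hcont.continuousAt.preimage_mem_nhds (isOpen_ne.mem_nhds ?_)
    rw [hs0, smul_zero, add_zero, one_add_one_eq_two]
    have : (2 : Matrix (Fin N) (Fin N) ℂ) = (2 : ℂ) • 1 := by
      rw [← one_add_one_eq_two, ← one_add_one_eq_two, add_smul, one_smul]
    rw [this, Matrix.det_smul]
    simp
  have hVW : (V ×ˢ {k : RMat N | (1 + (1 + Complex.I • skew k)).det ≠ 0}) ∈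
      𝓝 (0 : RMat N × RMat N) := prod_mem_nhds hV hW
  have himg := image_mem_map (m := polarFun) hVW
  rw [hmap, hone] at himg
  have hsub : Continuous fun g : U N => ((g : Matrix (Fin N) (Fin N) ℂ) : Fin N → Fin N → ℂ) :=
    continuous_subtype_val
  refine mem_of_superset (hsub.continuousAt.preimage_mem_nhds himg) ?_
  rintro g ⟨⟨h, k⟩, ⟨hh, hk⟩, hg⟩
  refine ⟨h, hh, ?_⟩
  have hg' : (chartU h : Matrix (Fin N) (Fin N) ℂ) * (1 + Complex.I • skew k) = g := hg
  set H := (1 + Complex.I • skew k) with hH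
  have hHH : Hᴴ = H := by
    rw [hH, Matrix.conjTranspose_add, Matrix.conjTranspose_smul, skew_conjTranspose]
    simp
  have hHU : H ∈ Matrix.unitaryGroup (Fin N) ℂ := by
    have : H = ((chartU h)⁻¹ * g : U N) := by
      change H = ((chartU h)⁻¹ : U N).1 * g.1
      rw [← hg', ← Matrix.mul_assoc]
      have : ((chartU h)⁻¹ : U N).1 * (chartU h).1 = 1 := congr_arg Subtype.val (inv_mul_cancel (chartU h))
      rw [this, Matrix.one_mul]
    rw [this]
    exact Subtype.prop _
  have hsq : H * H = 1 := by
    have := Matrix.mem_unitaryGroup_iff.mp hHU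
    rwa [Matrix.star_eq_conjTranspose, hHH] at this
  have hone' : H = 1 := by
    have hu : IsUnit (1 + H) := (Matrix.isUnit_iff_isUnit_det _).mpr (isUnit_iff_ne_zero.mpr hk)
    have : (1 + H) * H = (1 + H) * 1 := by
      rw [Matrix.add_mul, hsq, Matrix.mul_one, Matrix.one_mul, add_comm]
    exact hu.mul_left_cancel this
  ext1
  rw [← hg', hone', Matrix.mul_one]

end

section

/-! ### Haar measure of the unitary group in the chart -/

variable {N : ℕ}

theorem continuous_cayleyU : Continuous (cayleyU (N := N)) :=
  Continuous.subtype_mk (continuous_matrix fun a b => (contDiff_cayley a b).continuous) _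

theorem cayleyU_offDiag (h : RMat N) : cayleyU (offDiag h) = cayleyU h :=
  Subtype.ext (cayley_offDiag h)

theorem continuous_diagU : Continuous (diagU N) := by
  refine Continuous.subtype_mk (continuous_matrix fun a b => ?_) _
  by_cases hab : a = b
  · subst hab
    simp only [Matrix.diagonal_apply_eq]
    exact continuous_induced_dom.comp (continuous_apply a)
  · simp only [Matrix.diagonal_apply_ne _ hab]
    exact continuous_const

theorem continuous_phase : Continuous (phase (N := N)) :=
  continuous_pi fun j => Circle.exp.continuous.comp (by fun_prop)

theorem continuous_chartU : Continuous (chartU (N := N)) :=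
  continuous_cayleyU.mul (continuous_diagU.comp continuous_phase)

theorem diagU_apply (t : Fin N → Circle) (a b : Fin N) :
    (diagU N t : Matrix (Fin N) (Fin N) ℂ) a b = if a = b then (t a : ℂ) else 0 := by
  change Matrix.diagonal (fun j => (t j : ℂ)) a b = _
  rw [Matrix.diagonal_apply]

theorem diagU_injective : Function.Injective (diagU N) := fun s t h => by
  funext j
  have := congr_arg (fun g : U N => (g : Matrix (Fin N) (Fin N) ℂ) j j) h
  simp only [diagU_apply, if_true] at this
  exact Circle.ext this

theorem norm_offDiag_le (h : RMat N) : ‖offDiag h‖ ≤ ‖h‖ := by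
  refine (pi_norm_le_iff_of_nonneg (norm_nonneg _)).mpr fun a =>
    (pi_norm_le_iff_of_nonneg (norm_nonneg _)).mpr fun b => ?_
  by_cases hab : a = b
  · simp [offDiag, hab]
  · simp only [offDiag, hab, if_false]
    exact (norm_le_pi_norm (h a) b).trans (norm_le_pi_norm h a)

-- If `C(y) = C(y') t`, then `t` is close to 1, so `C(y') t = Γ(h')` where `h'` has the small
-- arguments of `t` on its diagonal. Local injectivity of `Γ` then applies although `t` is an
-- arbitrary element of the torus. The upper bound 2 on the density serves only to show that the
-- chart has finite volume.
open Topology Filter in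
theorem exists_chartRadius (N : ℕ) : ∃ δ > 0,
    (∀ y : RMat N, ‖offDiag y‖ < δ → 0 < chartDensity y ∧ chartDensity y < 2) ∧
    ∀ y y' : RMat N, ‖offDiag y‖ < δ → ‖offDiag y'‖ < δ → ∀ t : Fin N → Circle,
      cayleyU y = cayleyU y' * diagU N t → offDiag y = offDiag y' := by
  obtain ⟨V, hV, hinj⟩ := exists_injOn_chartU (N := N)
  obtain ⟨r, hr, hrV⟩ := Metric.mem_nhds_iff.mp hV
  have h1 : ∀ᶠ y in 𝓝 (0 : RMat N), chartDensity y ∈ Set.Ioo (0 : ℝ) 2 :=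
    continuous_chartDensity.continuousAt.eventually_mem
      (Ioo_mem_nhds (by rw [chartDensity_zero]; norm_num) (by rw [chartDensity_zero]; norm_num))
  obtain ⟨δ₁, hδ₁, hδ₁'⟩ := Metric.eventually_nhds_iff.mp h1
  have hone : cayleyU (0 : RMat N) = 1 :=
    Subtype.ext (cayley_eq_one_of_offDiag_eq_zero (by funext; simp [offDiag]))
  have h2 : ∀ᶠ p in 𝓝 (0 : RMat N × RMat N), ∀ j,
      |Complex.arg (((cayleyU p.2)⁻¹ * cayleyU p.1 : U N).1 j j)| < r := by
    refine eventually_all.mpr fun j => ?_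
    have hc1 : Continuous fun p : RMat N × RMat N => ((cayleyU p.2)⁻¹ * cayleyU p.1 : U N).1 j j := by
      have : Continuous fun p : RMat N × RMat N => ((cayleyU p.2)⁻¹ * cayleyU p.1 : U N) :=
        (continuous_cayleyU.comp continuous_snd).inv.mul (continuous_cayleyU.comp continuous_fst)
      exact (continuous_subtype_val.comp this).matrix_elem j j
    have hv : ((cayleyU (0 : RMat N × RMat N).2)⁻¹ * cayleyU (0 : RMat N × RMat N).1 : U N).1 j j
        = 1 := by
      simp [hone]
    have hc2 : ContinuousAt (fun p : RMat N × RMat N =>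
        |Complex.arg (((cayleyU p.2)⁻¹ * cayleyU p.1 : U N).1 j j)|) 0 := by
      refine ContinuousAt.abs (ContinuousAt.comp (g := Complex.arg) ?_ hc1.continuousAt)
      rw [hv]
      exact Complex.continuousAt_arg (by simp)
    refine hc2.eventually_lt continuousAt_const ?_
    rw [hv]
    simpa using hr
  obtain ⟨δ₂, hδ₂, hδ₂'⟩ := Metric.eventually_nhds_iff.mp h2
  refine ⟨min r (min δ₁ δ₂), by positivity, fun y hy => ?_, fun y y' hy hy' t ht => ?_⟩
  · have := hδ₁' (y := offDiag y) (by
      rw [dist_zero_right]; exact hy.trans_le ((min_le_right _ _).trans (min_le_left _ _)))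
    rwa [chartDensity_offDiag] at this
  · have harg := hδ₂' (y := (offDiag y, offDiag y')) (by
      rw [dist_zero_right, Prod.norm_def]
      exact max_lt (hy.trans_le ((min_le_right _ _).trans (min_le_right _ _)))
        (hy'.trans_le ((min_le_right _ _).trans (min_le_right _ _))))
    have ht' : (cayleyU (offDiag y'))⁻¹ * cayleyU (offDiag y) = diagU N t := by
      rw [cayleyU_offDiag, cayleyU_offDiag, ht, inv_mul_cancel_left]
    simp only [ht', diagU_apply, if_true] at harg
    set h' : RMat N := fun a b => if a = b then Complex.arg (t a) else y' a b with hh'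
    have hoff' : offDiag h' = offDiag y' := by
      funext a b
      by_cases hab : a = b <;> simp [offDiag, hh', hab]
    have heq : chartU (offDiag y) = chartU h' := by
      have e1 : phase (offDiag y) = 1 := by
        funext j; simp [phase, offDiag]
      have e2 : phase h' = t := by
        funext j; simp [phase, hh', Circle.exp_arg]
      rw [chartU, chartU, e1, e2, map_one, mul_one, cayleyU_offDiag, ht, ← cayleyU_offDiag y',
        ← hoff', cayleyU_offDiag]
    have hmem : h' ∈ V := by
      refine hrV ?_
      rw [mem_ball_zero_iff]
      refine (pi_norm_lt_iff hr).mpr fun a => (pi_norm_lt_iff hr).mpr fun b => ?_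
      by_cases hab : a = b
      · simp only [hh', hab, if_true, Real.norm_eq_abs]
        exact harg b
      · have e3 : h' a b = offDiag y' a b := by simp [hh', offDiag, hab]
        rw [e3]
        exact ((norm_le_pi_norm (offDiag y' a) b).trans (norm_le_pi_norm (offDiag y') a)).trans_lt
          (hy'.trans_le (min_le_left _ _))
    have hmem' : offDiag y ∈ V := hrV (by
      rw [mem_ball_zero_iff]; exact hy.trans_le (min_le_left _ _))
    rw [← hoff', ← hinj hmem' hmem heq, offDiag_offDiag]

/-- The radius of the domain of the chart `Γ`. -/
def chartRadius (N : ℕ) : ℝ := (exists_chartRadius N).choose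

theorem chartRadius_pos (N : ℕ) : 0 < chartRadius N := (exists_chartRadius N).choose_spec.1

theorem chartDensity_mem {y : RMat N} (hy : ‖offDiag y‖ < chartRadius N) :
    0 < chartDensity y ∧ chartDensity y < 2 :=
  (exists_chartRadius N).choose_spec.2.1 y hy

theorem offDiag_eq_of_cayleyU_eq {y y' : RMat N} (hy : ‖offDiag y‖ < chartRadius N)
    (hy' : ‖offDiag y'‖ < chartRadius N) {t : Fin N → Circle}
    (h : cayleyU y = cayleyU y' * diagU N t) : offDiag y = offDiag y' :=
  (exists_chartRadius N).choose_spec.2.2 y y' hy hy' t h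

/-- The domain of the chart `Γ`. -/
def chartDomain (N : ℕ) : Set (RMat N) :=
  {h | ‖offDiag h‖ < chartRadius N ∧ ∀ j, h j j ∈ Set.Ico 0 (2 * Real.pi)}

/-- The image of the chart `Γ`. -/
def chartImage (N : ℕ) : Set (U N) :=
  {g | ∃ (y : RMat N) (t : Fin N → Circle), ‖offDiag y‖ < chartRadius N ∧ g = cayleyU y * diagU N t}

theorem continuous_offDiag : Continuous (offDiag (N := N)) := by
  refine continuous_pi fun a => continuous_pi fun b => ?_
  unfold offDiag
  split_ifs
  · exact continuous_const
  · fun_prop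

theorem measurableSet_chartDomain (N : ℕ) : MeasurableSet (chartDomain N) := by
  have h1 : MeasurableSet {h : RMat N | ‖offDiag h‖ < chartRadius N} :=
    (isOpen_lt continuous_offDiag.norm continuous_const).measurableSet
  have h2 (j : Fin N) : MeasurableSet {h : RMat N | h j j ∈ Set.Ico 0 (2 * Real.pi)} :=
    (show Measurable fun h : RMat N => h j j by fun_prop) measurableSet_Ico
  have : chartDomain N = {h : RMat N | ‖offDiag h‖ < chartRadius N} ∩
      ⋂ j, {h : RMat N | h j j ∈ Set.Ico 0 (2 * Real.pi)} := by
    ext h; simp [chartDomain]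
  rw [this]
  exact h1.inter (MeasurableSet.iInter h2)

theorem circle_exp_injOn : Set.InjOn Circle.exp (Set.Ico 0 (2 * Real.pi)) :=
  Circle.exp_injOn_Ico (by simp)

theorem exists_circle_exp_eq (z : Circle) : ∃ ϑ ∈ Set.Ico 0 (2 * Real.pi), Circle.exp ϑ = z := by
  obtain ⟨ϑ, rfl⟩ := Circle.exp_surjective z
  refine ⟨toIcoMod Real.two_pi_pos 0 ϑ, by simpa using toIcoMod_mem_Ico Real.two_pi_pos 0 ϑ, ?_⟩
  rw [Circle.exp_eq_exp]
  refine ⟨-toIcoDiv Real.two_pi_pos 0 ϑ, ?_⟩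
  have := toIcoMod_add_toIcoDiv_zsmul Real.two_pi_pos 0 ϑ
  rw [zsmul_eq_mul] at this
  push_cast
  linarith

theorem phase_injOn {h h' : RMat N} (hh : ∀ j, h j j ∈ Set.Ico 0 (2 * Real.pi))
    (hh' : ∀ j, h' j j ∈ Set.Ico 0 (2 * Real.pi)) (heq : phase h = phase h') (j : Fin N) :
    h j j = h' j j :=
  circle_exp_injOn (hh j) (hh' j) (congr_fun heq j)

theorem eq_of_offDiag_eq {h h' : RMat N} (h1 : offDiag h = offDiag h') (h2 : ∀ j, h j j = h' j j) :
    h = h' := by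
  funext a b
  by_cases hab : a = b
  · subst hab; exact h2 a
  · simpa [offDiag, hab] using congr_fun (congr_fun h1 a) b

theorem chartU_injOn (N : ℕ) : Set.InjOn (chartU (N := N)) (chartDomain N) := by
  rintro h ⟨h1, h2⟩ h' ⟨h1', h2'⟩ heq
  have e1 : cayleyU h = cayleyU h' * diagU N (phase h' * (phase h)⁻¹) := by
    rw [map_mul, map_inv, ← mul_assoc, eq_mul_inv_iff_mul_eq]
    exact heq
  have hoff := offDiag_eq_of_cayleyU_eq h1 h1' e1
  refine eq_of_offDiag_eq hoff (phase_injOn h2 h2' ?_)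
  have e2 : cayleyU h = cayleyU h' := by rw [← cayleyU_offDiag, hoff, cayleyU_offDiag]
  rw [chartU, chartU, e2] at heq
  exact diagU_injective (mul_left_cancel heq)

theorem chartImage_eq (N : ℕ) : chartU '' chartDomain N = chartImage N := by
  ext g
  constructor
  · rintro ⟨h, hh, rfl⟩
    exact ⟨h, phase h, hh.1, rfl⟩
  · rintro ⟨y, t, hy, rfl⟩
    choose ϑ hϑ hϑt using fun j => exists_circle_exp_eq (t j)
    have hoff : offDiag (fun a b => if a = b then ϑ a else y a b) = offDiag y := by
      funext a b
      by_cases hab : a = b <;> simp [offDiag, hab]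
    refine ⟨fun a b => if a = b then ϑ a else y a b, ⟨by rwa [hoff], fun j => by simpa using hϑ j⟩, ?_⟩
    rw [chartU, ← cayleyU_offDiag, hoff, cayleyU_offDiag]
    congr 2
    funext j
    simp [phase, hϑt]

/-- Only the off-diagonal coordinates are small in the chart; the angles run over full periods. Its
image is therefore a union of whole torus cosets, and torus invariance survives restriction to it.
-/
theorem mul_diagU_mem_chartImage_iff {g : U N} (t : Fin N → Circle) :
    g * diagU N t ∈ chartImage N ↔ g ∈ chartImage N := by
  have key : ∀ (g : U N) (t : Fin N → Circle), g ∈ chartImage N → g * diagU N t ∈ chartImage N := by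
    rintro _ t ⟨y, s, hy, rfl⟩
    exact ⟨y, s * t, hy, by rw [map_mul, mul_assoc]⟩
  refine ⟨fun h => ?_, key g t⟩
  have := key _ t⁻¹ h
  rwa [mul_assoc, ← map_mul, mul_inv_cancel, map_one, mul_one] at this

/-! ### The Euclidean volume of the unitary group and its comparison with Haar measure. -/

instance : PolishSpace (Matrix (Fin N) (Fin N) ℂ) :=
  inferInstanceAs (PolishSpace (Fin N → Fin N → ℂ))

theorem isClosedEmbedding_coe_unitary :
    Topology.IsClosedEmbedding fun g : U N => (g : Matrix (Fin N) (Fin N) ℂ) := by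
  refine ⟨Topology.IsEmbedding.subtypeVal, ?_⟩
  have : IsCompact (Set.range fun g : U N => (g : Matrix (Fin N) (Fin N) ℂ)) :=
    isCompact_range continuous_subtype_val
  exact this.isClosed

instance : PolishSpace (U N) := isClosedEmbedding_coe_unitary.polishSpace

theorem continuous_toSpace {X : Type*} [TopologicalSpace X] {n : Type} [Fintype n]
    {f : X → Matrix n n ℂ} (hf : ∀ i j, Continuous fun x => f x i j) :
    Continuous fun x => toSpace (f x) :=
  (PiLp.continuous_toLp 2 _).comp (continuous_pi fun p => hf p.1 p.2)

theorem toSpace_injective {n : Type} [Fintype n] :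
    Function.Injective (toSpace : Matrix n n ℂ → MatSpace n) := fun A B h => by
  ext a b
  exact congr_arg (fun x : MatSpace n => x (a, b)) h

/-- The inclusion of the unitary group in the Euclidean space of matrices. -/
def unitaryToSpace (g : U N) : MatSpace (Fin N) := toSpace (g : Matrix (Fin N) (Fin N) ℂ)

theorem measurableEmbedding_unitaryToSpace :
    MeasurableEmbedding (unitaryToSpace (N := N)) := by
  refine Topology.IsClosedEmbedding.measurableEmbedding (Continuous.isClosedEmbedding ?_ ?_)
  · exact continuous_toSpace fun i j => continuous_subtype_val.matrix_elem i j
  · exact fun g g' h => Subtype.ext (toSpace_injective h)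

/-- The Euclidean volume of the unitary group, as a measure on it. -/
def volumeU (N : ℕ) : Measure (U N) :=
  (Measure.euclideanHausdorffMeasure (N ^ 2)).comap unitaryToSpace

theorem volumeU_apply (s : Set (U N)) :
    volumeU N s = Measure.euclideanHausdorffMeasure (N ^ 2) (unitaryToSpace '' s) :=
  measurableEmbedding_unitaryToSpace.comap_apply _ _

theorem volumeU_univ : volumeU N Set.univ = volU N := by
  rw [volumeU_apply, volU]
  congr 1
  ext x
  constructor
  · rintro ⟨g, -, rfl⟩
    exact ⟨g.1, g.2, rfl⟩
  · rintro ⟨g, hg, rfl⟩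
    exact ⟨⟨g, hg⟩, trivial, rfl⟩

theorem volumeU_image_mul (g : U N) (s : Set (U N)) :
    volumeU N ((fun h => g * h) '' s) = volumeU N s := by
  rw [volumeU_apply, volumeU_apply]
  set τ : MatSpace (Fin N) → MatSpace (Fin N) := fun x =>
    toSpace ((g : Matrix (Fin N) (Fin N) ℂ) * Matrix.of fun a b => x (a, b)) with hτ
  have hiso : Isometry τ := isometry_of_frob (fun M => (g : Matrix (Fin N) (Fin N) ℂ) * M)
    (fun M => rfl) (fun M M' => (Matrix.mul_sub _ _ _).symm) (fun M => frob_unitary_mul g.2 M)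
  rw [← hiso.euclideanHausdorffMeasure_image (unitaryToSpace '' s), Set.image_image, Set.image_image]
  rfl

instance : (volumeU N).IsMulLeftInvariant := by
  refine ⟨fun g => ?_⟩
  ext s hs
  rw [Measure.map_apply (measurable_const_mul g) hs, ← volumeU_image_mul g,
    Set.image_preimage_eq _ (Group.mulLeft_bijective g).surjective]

theorem areaData_chartU (N : ℕ) : AreaData volume (rmatEquiv N)
    (fun h : RMat N => toSpace (chartU h : Matrix (Fin N) (Fin N) ℂ)) (chartDomain N)
    chartDensity where
  measurePreserving := measurePreserving_rmatEquiv N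
  measurableSet := measurableSet_chartDomain N
  injOn := fun h hh h' hh' heq => chartU_injOn N hh hh' (Subtype.ext (toSpace_injective heq))
  continuousOn := continuous_chartDensity.continuousOn
  exists_deriv := fun y hy => by
    obtain ⟨f', hf', hv⟩ := exists_deriv_chartU y
    exact ⟨f', chartDeriv y, hf', hv, rfl, (chartDensity_mem hy.1).1.ne'⟩

theorem finrank_rmat (N : ℕ) : Module.finrank ℝ (EuclideanSpace ℝ (Fin N × Fin N)) = N ^ 2 := by
  simp [sq]

/-- The area formula for `Γ` holds in the space of matrices; it is brought back to the group along
the measurable embedding `unitaryToSpace`. -/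
theorem map_chartU_eq_restrict (N : ℕ) :
    Measure.map chartU ((volume.restrict (chartDomain N)).withDensity
      fun h => ENNReal.ofReal (chartDensity h)) = (volumeU N).restrict (chartImage N) := by
  have h1 := (areaData_chartU N).restrict_image
    (continuous_toSpace fun i j => (contDiff_chartU i j).continuous).measurable
  rw [finrank_rmat] at h1
  have hι := measurableEmbedding_unitaryToSpace (N := N)
  have h2 : Measure.map unitaryToSpace (Measure.map chartU
      ((volume.restrict (chartDomain N)).withDensity fun h => ENNReal.ofReal (chartDensity h))) =
      Measure.map unitaryToSpace ((volumeU N).restrict (chartImage N)) := by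
    rw [Measure.map_map hι.measurable continuous_chartU.measurable, ← chartImage_eq]
    refine h1.symm.trans ?_
    have e1 : (fun h : RMat N => toSpace (chartU h : Matrix (Fin N) (Fin N) ℂ)) '' chartDomain N =
        unitaryToSpace '' (chartU '' chartDomain N) := by
      rw [Set.image_image]; rfl
    rw [e1]
    ext s hs
    rw [Measure.restrict_apply hs, Measure.map_apply hι.measurable hs,
      Measure.restrict_apply (hι.measurable hs), volumeU_apply]
    congr 1
    rw [Set.image_preimage_inter]
  have h3 := congr_arg (fun μ => Measure.comap unitaryToSpace μ) h2
  simpa only [hι.comap_map] using h3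

open Topology Filter in
theorem chartImage_mem_nhds (N : ℕ) : chartImage N ∈ 𝓝 (1 : U N) := by
  refine mem_of_superset (image_chartU_mem_nhds (Metric.ball_mem_nhds 0 (chartRadius_pos N))) ?_
  rintro _ ⟨h, hh, rfl⟩
  rw [mem_ball_zero_iff] at hh
  exact ⟨h, phase h, (norm_offDiag_le h).trans_lt hh, rfl⟩

theorem measurableSet_chartImage (N : ℕ) : MeasurableSet (chartImage N) := by
  rw [← chartImage_eq]
  exact (measurableSet_chartDomain N).image_of_continuousOn_injOn continuous_chartU.continuousOn
    (chartU_injOn N)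

theorem volume_chartDomain_lt_top (N : ℕ) : volume (chartDomain N) < ⊤ := by
  have : Bornology.IsBounded (chartDomain N) := by
    refine (Metric.isBounded_closedBall (x := (0 : RMat N))
      (r := max (chartRadius N) (2 * Real.pi))).subset fun h hh => ?_
    have hpos := chartRadius_pos N
    rw [mem_closedBall_zero_iff]
    refine (pi_norm_le_iff_of_nonneg (by positivity)).mpr fun a =>
      (pi_norm_le_iff_of_nonneg (by positivity)).mpr fun b => ?_
    by_cases hab : a = b
    · subst hab
      refine le_max_of_le_right ?_
      rw [Real.norm_of_nonneg (hh.2 a).1]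
      exact (hh.2 a).2.le
    · have e3 : h a b = offDiag h a b := by simp [offDiag, hab]
      rw [e3]
      exact le_max_of_le_left (((norm_le_pi_norm (offDiag h a) b).trans
        (norm_le_pi_norm (offDiag h) a)).trans hh.1.le)
  exact this.measure_lt_top

theorem volumeU_chartImage_lt_top (N : ℕ) : volumeU N (chartImage N) < ⊤ := by
  have h := congr_arg (fun μ => μ Set.univ) (map_chartU_eq_restrict N)
  simp only [Measure.restrict_apply_univ] at h
  rw [← h, Measure.map_apply continuous_chartU.measurable MeasurableSet.univ, Set.preimage_univ,
    withDensity_apply _ MeasurableSet.univ, setLIntegral_univ]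
  calc ∫⁻ h in chartDomain N, ENNReal.ofReal (chartDensity h)
      ≤ ∫⁻ _ in chartDomain N, ENNReal.ofReal 2 :=
        setLIntegral_mono' (measurableSet_chartDomain N) fun h hh =>
          ENNReal.ofReal_le_ofReal (chartDensity_mem hh.1).2.le
    _ = ENNReal.ofReal 2 * volume (chartDomain N) := setLIntegral_const _ _
    _ < ⊤ := ENNReal.mul_lt_top ENNReal.ofReal_lt_top (volume_chartDomain_lt_top N)

-- Translates of the chart image are neighbourhoods of all points and have the same finite volume;
-- compactness of the group then bounds the total volume.
open Topology Filter in
instance : IsFiniteMeasure (volumeU N) := by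
  have : IsLocallyFiniteMeasure (volumeU N) := by
    refine ⟨fun g => ⟨(fun h => g * h) '' chartImage N, ?_, ?_⟩⟩
    · have := (Homeomorph.mulLeft g).isOpenMap.image_mem_nhds (chartImage_mem_nhds N)
      simpa using this
    · rw [volumeU_image_mul]
      exact volumeU_chartImage_lt_top N
  infer_instance

instance : (haarU N).IsHaarMeasure := by
  unfold haarU; infer_instance

instance : IsProbabilityMeasure (haarU N) := ⟨by
  unfold haarU
  exact Measure.haarMeasure_self⟩

theorem volumeU_eq_smul_haarU (N : ℕ) : volumeU N = volU N • haarU N := by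
  have h := Measure.isMulInvariant_eq_smul_of_compactSpace (volumeU N) (haarU N)
  generalize Measure.haarScalarFactor (volumeU N) (haarU N) = c at h
  have h1 := congr_arg (fun μ => μ Set.univ) h
  simp only [volumeU_univ, Measure.smul_apply, measure_univ, ENNReal.smul_def, smul_eq_mul,
    mul_one] at h1
  rw [h1]
  exact h

end

section

/-! ### The volume element of the generalized normal matrices -/

variable {m N : ℕ}

/-- The space of the coordinates `(x, h)`, where `h` is a family of coordinates of elements of
`U(N)`, the diagonal of `h 0` being the angles `θ`. -/
abbrev Coords (m N : ℕ) : Type := (Fin N → ℝ) × (Fin m → RMat N)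

/-- The coordinates as a family of real numbers. -/
def coordsPi (m N : ℕ) : Coords m N ≃ₗ[ℝ] (Fin N ⊕ Fin m × Fin N × Fin N → ℝ) where
  toFun q := Sum.elim q.1 fun p => q.2 p.1 p.2.1 p.2.2
  map_add' q q' := by ext (i | i) <;> rfl
  map_smul' c q := by ext (i | i) <;> rfl
  invFun f := (fun j => f (Sum.inl j), fun k a b => f (Sum.inr (k, a, b)))
  left_inv q := rfl
  right_inv f := by ext (i | i) <;> rfl

/-- The coordinates as a Euclidean space. -/
def coordsEquiv (m N : ℕ) :
    Coords m N ≃L[ℝ] EuclideanSpace ℝ (Fin N ⊕ Fin m × Fin N × Fin N) :=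
  (coordsPi m N).toContinuousLinearEquiv.trans
    (PiLp.continuousLinearEquiv 2 ℝ (fun _ : Fin N ⊕ Fin m × Fin N × Fin N => ℝ)).symm

theorem norm_coordsEquiv_sq (q : Coords m N) :
    ‖coordsEquiv m N q‖ ^ 2 = ∑ j, q.1 j ^ 2 + ∑ k, ∑ a, ∑ b, q.2 k a b ^ 2 := by
  rw [EuclideanSpace.norm_sq_eq, Fintype.sum_sum_type, Fintype.sum_prod_type]
  simp only [Fintype.sum_prod_type]
  simp [coordsEquiv, coordsPi]
  rfl

theorem finrank_coords (m N : ℕ) :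
    Module.finrank ℝ (EuclideanSpace ℝ (Fin N ⊕ Fin m × Fin N × Fin N)) = m * N ^ 2 + N := by
  simp [sq]
  ring

theorem isAddHaarMeasure_volume_prod {A B : Type*} [NormedAddCommGroup A] [NormedSpace ℝ A]
    [FiniteDimensional ℝ A] [MeasureSpace A] [BorelSpace A] [NormedAddCommGroup B] [NormedSpace ℝ B]
    [FiniteDimensional ℝ B] [MeasureSpace B] [BorelSpace B]
    [(volume : Measure A).IsAddHaarMeasure] [(volume : Measure B).IsAddHaarMeasure] :
    (volume : Measure (A × B)).IsAddHaarMeasure := by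
  have : ProperSpace A := FiniteDimensional.proper ℝ A
  have : ProperSpace B := FiniteDimensional.proper ℝ B
  rw [Measure.volume_eq_prod]; infer_instance

theorem isAddHaarMeasure_volume_pi {ι A : Type*} [Fintype ι] [NormedAddCommGroup A] [NormedSpace ℝ A]
    [FiniteDimensional ℝ A] [MeasureSpace A] [BorelSpace A]
    [(volume : Measure A).IsAddHaarMeasure] : (volume : Measure (ι → A)).IsAddHaarMeasure := by
  have : ProperSpace A := FiniteDimensional.proper ℝ A
  exact Measure.pi.isAddHaarMeasure _

instance (m N : ℕ) : (volume : Measure (Coords m N)).IsAddHaarMeasure := by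
  have := isAddHaarMeasure_volume_pi (ι := Fin N) (A := Fin N → ℝ)
  have := isAddHaarMeasure_volume_pi (ι := Fin m) (A := RMat N)
  exact isAddHaarMeasure_volume_prod

theorem measurePreserving_coordsEquiv (m N : ℕ) : MeasurePreserving (coordsEquiv m N) := by
  have h1 : MeasurePreserving ((coordsPi m N).toContinuousLinearEquiv)
      (volume : Measure (Coords m N))
      (volume : Measure (Fin N ⊕ Fin m × Fin N × Fin N → ℝ)) := by
    refine measurePreserving_of_measure_eq _ _ _ (Set.univ.pi fun _ => Set.Icc (0 : ℝ) 1)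
      (MeasurableSet.univ_pi fun _ => measurableSet_Icc)
      (by simp only [volume_pi_pi, Real.volume_Icc]; simp)
      (by simp only [volume_pi_pi, Real.volume_Icc]; simp) ?_
    have : (((coordsPi m N).toContinuousLinearEquiv) ⁻¹'
        (Set.univ.pi fun _ => Set.Icc (0 : ℝ) 1)) =
        (Set.univ.pi fun _ => Set.Icc (0 : ℝ) 1) ×ˢ
        (Set.univ.pi fun _ => Set.univ.pi fun _ => Set.univ.pi fun _ => Set.Icc (0 : ℝ) 1) := by
      ext h
      simp only [Set.mem_preimage, Set.mem_univ_pi, Sum.forall, Prod.forall, Set.mem_prod]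
      rfl
    rw [this, Measure.volume_eq_prod, Measure.prod_prod]
    simp only [volume_pi_pi, Real.volume_Icc]
    simp
  exact (PiLp.volume_preserving_toLp _).comp h1

variable [NeZero m]

/-- The arguments of the diagonal blocks of `param`. -/
def blockAngle (h : Fin m → RMat N) (k : Fin m) (j : Fin N) : ℝ :=
  h k j j - if k + 1 = 0 then 0 else h (k + 1) j j

/-- The diagonal blocks of `param`. -/
def blockEntry (α : Fin m → ℝ) (q : Coords m N) (k : Fin m) (j : Fin N) : ℂ :=
  (Real.sqrt (q.1 j + α k) : ℂ) * Complex.exp (blockAngle q.2 k j * Complex.I)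

/-- The generalized normal matrix with coordinates `(x, h)`. -/
def param (α : Fin m → ℝ) (q : Coords m N) : BlockMat m N :=
  blockCyclic fun k => cayley (q.2 k) * Matrix.diagonal (blockEntry α q k) * (cayley (q.2 (k + 1)))ᴴ

/-- The points of `Σ` attached to the coordinates. -/
def surfacePoint (α : Fin m → ℝ) (q : Coords m N) : Fin N → ℂ × ℝ :=
  fun j => chart α (q.1 j, q.2 0 j j)

/-- The coordinates at which `param` is smooth. -/
def Regular (α : Fin m → ℝ) (x : Fin N → ℝ) : Prop := ∀ j k, 0 < x j + α k

theorem blockAngle_add_smul (h v : Fin m → RMat N) (t : ℝ) (k : Fin m) (j : Fin N) :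
    blockAngle (h + t • v) k j = blockAngle h k j + t * blockAngle v k j := by
  simp only [blockAngle, Pi.add_apply, Pi.smul_apply, smul_eq_mul]
  split_ifs <;> ring

/-- The derivative of `blockEntry`. -/
def dBlockEntry (α : Fin m → ℝ) (q v : Coords m N) (k : Fin m) (j : Fin N) : ℂ :=
  ((v.1 j / (2 * Real.sqrt (q.1 j + α k)) : ℝ) +
    (Real.sqrt (q.1 j + α k) * blockAngle v.2 k j : ℝ) * Complex.I) *
    Complex.exp (blockAngle q.2 k j * Complex.I)

theorem hasDerivAt_blockEntry {α : Fin m → ℝ} {q : Coords m N} (hq : Regular α q.1)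
    (v : Coords m N) (k : Fin m) (j : Fin N) :
    HasDerivAt (fun t : ℝ => blockEntry α (q + t • v) k j) (dBlockEntry α q v k j) 0 := by
  have h1 : HasDerivAt (fun t : ℝ => q.1 j + t * v.1 j + α k) (v.1 j) 0 := by
    simpa using (((hasDerivAt_id (0 : ℝ)).mul_const (v.1 j)).const_add (q.1 j)).add_const (α k)
  have h2 := h1.sqrt (by simpa using (hq j k).ne')
  have h3 : HasDerivAt (fun t : ℝ => blockAngle q.2 k j + t * blockAngle v.2 k j)
      (blockAngle v.2 k j) 0 := by
    simpa using ((hasDerivAt_id (0 : ℝ)).mul_const (blockAngle v.2 k j)).const_add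
      (blockAngle q.2 k j)
  have h4 := h2.ofReal_comp.fun_mul ((h3.ofReal_comp.mul_const Complex.I).cexp)
  have h5 : (fun t : ℝ => blockEntry α (q + t • v) k j) = fun t : ℝ =>
      ((Real.sqrt (q.1 j + t * v.1 j + α k) : ℝ) : ℂ) *
        Complex.exp (((blockAngle q.2 k j + t * blockAngle v.2 k j : ℝ) : ℂ) * Complex.I) := by
    funext t
    rw [blockEntry, show (q + t • v).2 = q.2 + t • v.2 from rfl, blockAngle_add_smul]
    rfl
  rw [h5]
  convert! h4 using 1
  simp only [dBlockEntry, zero_mul, add_zero]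
  push_cast
  ring

theorem contDiffAt_blockEntry {α : Fin m → ℝ} {q : Coords m N} (hq : Regular α q.1)
    (k : Fin m) (j : Fin N) : ContDiffAt ℝ ⊤ (fun q => blockEntry α q k j) q := by
  have h1 : ContDiffAt ℝ ⊤ (fun q : Coords m N => Real.sqrt (q.1 j + α k)) q :=
    ContDiffAt.sqrt (by fun_prop) (hq j k).ne'
  have h2 : ContDiff ℝ ⊤ (fun q : Coords m N => blockAngle q.2 k j) := by
    unfold blockAngle
    split_ifs <;> fun_prop
  exact (Complex.ofRealCLM.contDiff.contDiffAt.comp q h1).mul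
    (((Complex.ofRealCLM.contDiff.comp h2).mul contDiff_const).cexp.contDiffAt)

theorem hasDerivAt_matrix_mul {n : Type*} [Fintype n] {A B : ℝ → Matrix n n ℂ} {A' B' : Matrix n n ℂ}
    {t : ℝ} (hA : ∀ i j, HasDerivAt (fun t => A t i j) (A' i j) t)
    (hB : ∀ i j, HasDerivAt (fun t => B t i j) (B' i j) t) (i j : n) :
    HasDerivAt (fun t => (A t * B t) i j) ((A' * B t + A t * B') i j) t := by
  simp only [Matrix.mul_apply, Matrix.add_apply]
  rw [← Finset.sum_add_distrib]
  exact HasDerivAt.fun_sum fun c _ => (hA i c).fun_mul (hB c j)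

/-- The derivative of the block `k` of `param`, up to multiplication by unitary matrices. -/
def dBlock (α : Fin m → ℝ) (q v : Coords m N) (k : Fin m) : Matrix (Fin N) (Fin N) ℂ :=
  logDCayley (q.2 k) (v.2 k) * Matrix.diagonal (blockEntry α q k) +
    Matrix.diagonal (dBlockEntry α q v k) -
    Matrix.diagonal (blockEntry α q k) * logDCayley (q.2 (k + 1)) (v.2 (k + 1))

theorem hasDerivAt_param {α : Fin m → ℝ} {q : Coords m N} (hq : Regular α q.1) (v : Coords m N)
    (i j : Fin m × Fin N) :
    HasDerivAt (fun t : ℝ => param α (q + t • v) i j)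
      (blockCyclic (fun k => cayley (q.2 k) * dBlock α q v k * (cayley (q.2 (k + 1)))ᴴ) i j) 0 := by
  simp only [param, blockCyclic]
  split_ifs
  · have hc (k : Fin m) (a b : Fin N) : HasDerivAt (fun t : ℝ => cayley ((q + t • v).2 k) a b)
        (dCayley (q.2 k) (v.2 k) a b) 0 := hasDerivAt_cayley _ _ _ _
    have hd (k : Fin m) (a b : Fin N) :
        HasDerivAt (fun t : ℝ => Matrix.diagonal (blockEntry α (q + t • v) k) a b)
        (Matrix.diagonal (dBlockEntry α q v k) a b) 0 := by
      by_cases hab : a = b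
      · subst hab
        simpa only [Matrix.diagonal_apply_eq] using hasDerivAt_blockEntry hq v k a
      · simpa only [Matrix.diagonal_apply_ne _ hab] using hasDerivAt_const (0 : ℝ) (0 : ℂ)
    have hs (k : Fin m) (a b : Fin N) : HasDerivAt (fun t : ℝ => (cayley ((q + t • v).2 k))ᴴ a b)
        ((dCayley (q.2 k) (v.2 k))ᴴ a b) 0 := (hc k b a).star
    have h := hasDerivAt_matrix_mul (hasDerivAt_matrix_mul (hc i.1) (hd i.1)) (hs (i.1 + 1))
      i.2 j.2
    convert! h using 1
    have e0 : q + (0 : ℝ) • v = q := by simp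
    rw [e0, ← cayley_mul_logDCayley (q.2 i.1), ← cayley_mul_logDCayley (q.2 (i.1 + 1)),
      Matrix.conjTranspose_mul, logDCayley_conjTranspose]
    simp only [dBlock, Matrix.mul_add, Matrix.add_mul, Matrix.mul_assoc, Matrix.neg_mul,
      Matrix.mul_neg, sub_eq_add_neg]
  · exact hasDerivAt_const _ _

theorem frob_blockCyclic (X : Fin m → Matrix (Fin N) (Fin N) ℂ) :
    frob (blockCyclic X) = ∑ k, frob (X k) := by
  simp only [frob, Fintype.sum_prod_type, blockCyclic]
  refine Finset.sum_congr rfl fun k _ => Finset.sum_congr rfl fun a _ => ?_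
  rw [Finset.sum_eq_single (k + 1)]
  · simp
  · intro l _ hl
    simp [hl]
  · simp

theorem contDiffAt_param {α : Fin m → ℝ} {q : Coords m N} (hq : Regular α q.1)
    (i j : Fin m × Fin N) : ContDiffAt ℝ 1 (fun q => param α q i j) q := by
  simp only [param, blockCyclic]
  split_ifs
  · have hc (k : Fin m) (a b : Fin N) : ContDiffAt ℝ 1 (fun q : Coords m N => cayley (q.2 k) a b) q :=
      (((contDiff_cayley a b).comp (show ContDiff ℝ ⊤ fun q : Coords m N => q.2 k by fun_prop)).of_le
        le_top).contDiffAt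
    have he (q : Coords m N) : (cayley (q.2 i.1) * Matrix.diagonal (blockEntry α q i.1) *
        (cayley (q.2 (i.1 + 1)))ᴴ) i.2 j.2 = ∑ c, cayley (q.2 i.1) i.2 c * blockEntry α q i.1 c *
          star (cayley (q.2 (i.1 + 1)) j.2 c) := by
      rw [Matrix.mul_apply]
      simp only [Matrix.mul_diagonal, Matrix.conjTranspose_apply]
    simp only [he]
    refine ContDiffAt.sum fun c _ => ((hc _ _ _).mul
      ((contDiffAt_blockEntry hq _ _).of_le le_top)).mul ?_
    exact (Complex.conjCLE.contDiff.of_le le_top).contDiffAt.comp q (hc (i.1 + 1) j.2 c)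
  · exact contDiffAt_const

omit [NeZero m] in
theorem logDCayley_apply (y v : RMat N) (a b : Fin N) : logDCayley y v a b =
    (1 + Complex.I) / 2 * (unskew (logDCayley y v) a b + Complex.I * unskew (logDCayley y v) b a) := by
  conv_lhs => rw [← skew_unskew (logDCayley_conjTranspose y v)]
  rfl

/-- Once the common phase `e` is factored out, the radial variation is the real part and the angular
variation the imaginary part. -/
theorem norm_diag_sq (X X' R dx dθ : ℝ) (e : ℂ) (he : ‖e‖ = 1) :
    ‖Complex.I * X * (R * e) + ((dx : ℝ) + (R * dθ : ℝ) * Complex.I) * e - R * e * (Complex.I * X')‖ ^ 2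
      = dx ^ 2 + (R * (X + dθ - X')) ^ 2 := by
  have : Complex.I * X * (R * e) + ((dx : ℝ) + (R * dθ : ℝ) * Complex.I) * e - R * e * (Complex.I * X')
      = ((dx : ℝ) + (R * (X + dθ - X') : ℝ) * Complex.I) * e := by
    push_cast; ring
  rw [this, norm_mul, he, mul_one, ← Complex.normSq_eq_norm_sq, Complex.normSq_add_mul_I]

/-- The entries `(a, b)` and `(b, a)` of the variation of one block, in terms of the single complex
numbers `w` and `w'` encoding those entries of the two logarithmic derivatives. Neither entry alone
gives the ℂ-linear expression `z' w - z w'`; their sum does so up to a product whose first factor is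
the same for all blocks, and which will cancel around the cycle. -/
theorem norm_offDiag_sq (z z' w w' : ℂ) :
    ‖(1 + Complex.I) / 2 * w * z' - z * ((1 + Complex.I) / 2 * w')‖ ^ 2 +
      ‖(1 + Complex.I) / 2 * (Complex.I * starRingEnd ℂ w) * z -
        z' * ((1 + Complex.I) / 2 * (Complex.I * starRingEnd ℂ w'))‖ ^ 2 =
    ‖z' * w - z * w'‖ ^ 2 + 1 / 2 * ((‖z‖ ^ 2 - ‖z'‖ ^ 2) * (‖w‖ ^ 2 - ‖w'‖ ^ 2)) := by
  simp only [← Complex.normSq_eq_norm_sq, Complex.normSq_apply]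
  simp
  ring

theorem sum_cyclic_shift (f : Fin m → ℝ) : ∑ k, f (k + 1) = ∑ k, f k :=
  Equiv.sum_comp (Equiv.addRight (1 : Fin m)) f

/-- The speed of the moduli of the diagonal blocks. -/
def radialSpeed (α : Fin m → ℝ) (x : ℝ) : ℝ := Real.sqrt (∑ k, 1 / (x + α k)) / 2

/-- The linear map that recovers the derivative of the Cayley transform on the diagonal. -/
def diagCorrection (y : RMat N) : RMat N →ₗ[ℝ] (Fin N → ℝ) where
  toFun w j := w j j - Ring.inverse (chartDeriv y) w j j
  map_add' v w := by funext j; simp only [Pi.add_apply, map_add]; ring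
  map_smul' c w := by funext j; simp only [Pi.smul_apply, map_smul, RingHom.id_apply, smul_eq_mul]; ring

omit [NeZero m] in
theorem inverse_chartDeriv_apply {y : RMat N} (hy : chartDensity y ≠ 0) (v : RMat N) :
    Ring.inverse (chartDeriv y) (chartDeriv y v) = v := by
  have hu : IsUnit (chartDeriv y) := by
    rw [LinearMap.isUnit_iff_isUnit_det]
    exact isUnit_iff_ne_zero.mpr (abs_ne_zero.mp hy)
  have := Ring.inverse_mul_cancel _ hu
  exact LinearMap.congr_fun this v

/-- The Euclidean metric in the coordinates. On the diagonal, the radial parts of all blocks combine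
into `radialSpeed`, and the angular part of block `k` is `W k - W (k + 1)`. The exception is the
block preceding index 0: the right factor there is the bare Cayley transform, whose diagonal `L 0`
is recovered from `W 0` by `diagCorrection`. Off the diagonal, `norm_offDiag_sq` applies. -/
theorem sum_frob_dBlock {α : Fin m → ℝ} {q : Coords m N} (hq : Regular α q.1)
    (hd : chartDensity (q.2 0) ≠ 0) (v : Coords m N) :
    ∑ k, frob (dBlock α q v k) = ‖coordsEquiv m N
      (jacobianMap (fun j => radialSpeed α (q.1 j)) (fun j k => Real.sqrt (q.1 j + α k))
        (fun j k => blockEntry α q k j) (diagCorrection (q.2 0))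
        (v.1, fun k => chartDeriv (q.2 k) (v.2 k)))‖ ^ 2 := by
  set W : Fin m → RMat N := fun k => chartDeriv (q.2 k) (v.2 k) with hW
  set L : Fin m → RMat N := fun k => unskew (logDCayley (q.2 k) (v.2 k)) with hL
  have hWL (k : Fin m) (a b : Fin N) : W k a b = L k a b + if a = b then v.2 k a b else 0 := rfl
  have hlog (k : Fin m) (a b : Fin N) : logDCayley (q.2 k) (v.2 k) a b =
    (1 + Complex.I) / 2 * (L k a b + Complex.I * L k b a) := logDCayley_apply _ _ _ _
  -- the right hand side
  rw [norm_coordsEquiv_sq]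
  have hsplit (d : (Fin N → Fin m → ℝ) × (Pairs N → Fin m → ℂ)) :
      ∑ k, ∑ a, ∑ b, (splitDiag m N).symm d k a b ^ 2 =
        ∑ j, ∑ k, d.1 j k ^ 2 + ∑ p, ∑ k, ‖d.2 p k‖ ^ 2 := by
    rw [Finset.sum_comm (γ := Fin N), Finset.sum_comm (γ := Pairs N), ← Finset.sum_add_distrib]
    refine Finset.sum_congr rfl fun k _ => ?_
    rw [sum_eq_sum_diag_add_sum_pairs]
    congr 1
    · simp [splitDiag]
    · refine Finset.sum_congr rfl fun p _ => ?_
      have := p.2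
      rw [← Complex.normSq_eq_norm_sq, Complex.normSq_apply]
      simp [splitDiag, this, this.not_gt]
      ring
  have hrhs : (jacobianMap (fun j => radialSpeed α (q.1 j)) (fun j k => Real.sqrt (q.1 j + α k))
        (fun j k => blockEntry α q k j) (diagCorrection (q.2 0)) (v.1, W)) =
      (fun j => radialSpeed α (q.1 j) * v.1 j, (splitDiag m N).symm
        (jacobianInner (fun j k => Real.sqrt (q.1 j + α k))
        (fun j k => blockEntry α q k j) (diagCorrection (q.2 0)) W)) := rfl
  rw [hrhs, hsplit]
  have hη (j : Fin N) : diagCorrection (q.2 0) (W 0) j = L 0 j j := by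
    change W 0 j j - Ring.inverse (chartDeriv (q.2 0)) (W 0) j j = _
    rw [hW, inverse_chartDeriv_apply hd]
    change W 0 j j - _ = _
    rw [hWL]
    simp
  -- the left hand side
  have hnorm (k : Fin m) (j : Fin N) : ‖blockEntry α q k j‖ ^ 2 = q.1 j + α k := by
    rw [blockEntry, norm_mul, Complex.norm_exp_ofReal_mul_I, mul_one, Complex.norm_real,
      Real.norm_of_nonneg (Real.sqrt_nonneg _), Real.sq_sqrt (hq j k).le]
  have hdiag (k : Fin m) (j : Fin N) : ‖dBlock α q v k j j‖ ^ 2 =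
      (v.1 j / (2 * Real.sqrt (q.1 j + α k))) ^ 2 +
        (Real.sqrt (q.1 j + α k) * (W k j j - if k + 1 = 0 then L 0 j j else W (k + 1) j j)) ^ 2 := by
    have h1 := norm_diag_sq (L k j j) (L (k + 1) j j) (Real.sqrt (q.1 j + α k))
      (v.1 j / (2 * Real.sqrt (q.1 j + α k))) (blockAngle v.2 k j)
      (Complex.exp (blockAngle q.2 k j * Complex.I)) (Complex.norm_exp_ofReal_mul_I _)
    have h2 (k : Fin m) : logDCayley (q.2 k) (v.2 k) j j = Complex.I * L k j j := by
      rw [hlog]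
      linear_combination ((L k j j : ℂ) / 2) * Complex.I_mul_I
    rw [dBlock, Matrix.sub_apply, Matrix.add_apply, Matrix.mul_diagonal, Matrix.diagonal_mul,
      Matrix.diagonal_apply_eq, h2, h2, blockEntry, dBlockEntry]
    refine h1.trans ?_
    congr 3
    rw [blockAngle, hWL, hWL]
    by_cases hk : k + 1 = 0
    · simp [hk]
    · simp only [hk, if_true, if_false]; ring
  have hoff (k : Fin m) (p : Pairs N) : ‖dBlock α q v k p.1.1 p.1.2‖ ^ 2 +
      ‖dBlock α q v k p.1.2 p.1.1‖ ^ 2 =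
      ‖blockEntry α q k p.1.2 * ((splitDiag m N W).2 p k) -
        blockEntry α q k p.1.1 * ((splitDiag m N W).2 p (k + 1))‖ ^ 2 +
      1 / 2 * ((q.1 p.1.1 - q.1 p.1.2) * (‖(splitDiag m N W).2 p k‖ ^ 2 -
        ‖(splitDiag m N W).2 p (k + 1)‖ ^ 2)) := by
    have hne := p.2.ne
    have hζ (k : Fin m) : (splitDiag m N W).2 p k =
        L k p.1.1 p.1.2 + Complex.I * L k p.1.2 p.1.1 := by
      change (⟨W k p.1.1 p.1.2, W k p.1.2 p.1.1⟩ : ℂ) = _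
      rw [hWL, hWL, if_neg hne, if_neg hne.symm]
      apply Complex.ext <;> simp
    have hζ' (k : Fin m) : ((L k p.1.2 p.1.1 : ℂ) + Complex.I * L k p.1.1 p.1.2) =
        Complex.I * starRingEnd ℂ ((splitDiag m N W).2 p k) := by
      rw [hζ]
      apply Complex.ext <;> simp
    have h3 (a b : Fin N) (hab : a ≠ b) : dBlock α q v k a b =
        logDCayley (q.2 k) (v.2 k) a b * blockEntry α q k b -
          blockEntry α q k a * logDCayley (q.2 (k + 1)) (v.2 (k + 1)) a b := by
      rw [dBlock, Matrix.sub_apply, Matrix.add_apply, Matrix.mul_diagonal, Matrix.diagonal_mul,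
        Matrix.diagonal_apply_ne _ hab, add_zero]
    rw [h3 _ _ hne, h3 _ _ hne.symm, hlog, hlog, hlog, hlog, hζ', hζ', ← hζ, ← hζ,
      norm_offDiag_sq, hnorm, hnorm]
    ring
  have hfrob (k : Fin m) : frob (dBlock α q v k) = ∑ j, ‖dBlock α q v k j j‖ ^ 2 +
      ∑ p : Pairs N, (‖dBlock α q v k p.1.1 p.1.2‖ ^ 2 + ‖dBlock α q v k p.1.2 p.1.1‖ ^ 2) :=
    sum_eq_sum_diag_add_sum_pairs _
  simp only [hfrob, hdiag, hoff, Finset.sum_add_distrib]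
  -- The difference of squared moduli is `x_a - x_b`, whatever `k` is, so the extra terms cancel
  -- around the cycle.
  have htel : ∑ k, ∑ p : Pairs N, 1 / 2 * ((q.1 p.1.1 - q.1 p.1.2) *
      (‖(splitDiag m N W).2 p k‖ ^ 2 - ‖(splitDiag m N W).2 p (k + 1)‖ ^ 2)) = 0 := by
    rw [Finset.sum_comm]
    refine Finset.sum_eq_zero fun p _ => ?_
    rw [← Finset.mul_sum, ← Finset.mul_sum, Finset.sum_sub_distrib,
      sum_cyclic_shift (fun k => ‖(splitDiag m N W).2 p k‖ ^ 2), sub_self, mul_zero, mul_zero]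
  rw [htel, add_zero]
  have hrad : ∑ k, ∑ j, (v.1 j / (2 * Real.sqrt (q.1 j + α k))) ^ 2 =
      ∑ j, (radialSpeed α (q.1 j) * v.1 j) ^ 2 := by
    rw [Finset.sum_comm]
    refine Finset.sum_congr rfl fun j _ => ?_
    rw [mul_pow, radialSpeed, div_pow, Real.sq_sqrt (Finset.sum_nonneg fun k _ =>
      (one_div_pos.mpr (hq j k)).le), Finset.sum_div, Finset.sum_mul]
    refine Finset.sum_congr rfl fun k _ => ?_
    rw [div_pow, mul_pow, Real.sq_sqrt (hq j k).le]
    field_simp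
  rw [hrad, add_assoc]
  congr 2
  · rw [Finset.sum_comm]
    refine Finset.sum_congr rfl fun j _ => Finset.sum_congr rfl fun k _ => ?_
    simp only [jacobianInner, LinearMap.coe_mk, AddHom.coe_mk, hη]
  · rw [Finset.sum_comm]
    rfl

/-- The differences telescope except that `h 0` is never subtracted. This makes the diagonal of `h
0` the argument of `z_j`. -/
theorem sum_blockAngle (h : Fin m → RMat N) (j : Fin N) : ∑ k, blockAngle h k j = h 0 j j := by
  simp only [blockAngle, Finset.sum_sub_distrib]
  rw [sum_cyclic_shift (fun k => if k = 0 then 0 else h k j j)]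
  rw [← Finset.sum_sub_distrib, Finset.sum_eq_single 0]
  · simp
  · intro k _ hk; simp [hk]
  · simp

omit [NeZero m] in
theorem eval_Q (α : Fin m → ℝ) (x : ℝ) : (Q α).eval x = ∏ k, (x + α k) := by
  simp [Q, Polynomial.eval_prod]

theorem prod_blockEntry {α : Fin m → ℝ} {q : Coords m N} (hq : Regular α q.1) (j : Fin N) :
    ∏ k, blockEntry α q k j = (surfacePoint α q j).1 := by
  simp only [blockEntry, surfacePoint, chart, Finset.prod_mul_distrib]
  rw [← Complex.exp_sum, ← Finset.sum_mul, ← Complex.ofReal_sum, sum_blockAngle, eval_Q,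
    ← Complex.ofReal_prod, ← Real.sqrt_prod Finset.univ fun k _ => (hq j k).le]

-- The logarithmic derivative `Q' / Q = ∑ 1 / (x + α_k)`, under a square root.
omit [NeZero m] in
theorem radialSpeed_mul_prod {α : Fin m → ℝ} {x : ℝ} (hx : ∀ k, 0 < x + α k) :
    radialSpeed α x * ∏ k, Real.sqrt (x + α k) = 1 / 2 * Real.sqrt ((Q α).derivative.eval x) := by
  rw [radialSpeed, ← Real.sqrt_prod Finset.univ fun k _ => (hx k).le, div_mul_eq_mul_div,
    ← Real.sqrt_mul (Finset.sum_nonneg fun k _ => (one_div_pos.mpr (hx k)).le), Finset.sum_mul]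
  rw [Q, Polynomial.derivative_prod_finset]
  simp only [Polynomial.eval_finsetSum, Polynomial.eval_prod, Polynomial.eval_add,
    Polynomial.eval_X, Polynomial.eval_C, Polynomial.derivative_add, Polynomial.derivative_X,
    Polynomial.derivative_C, add_zero, mul_one]
  rw [one_div_mul_eq_div]
  congr 2
  refine Finset.sum_congr rfl fun k _ => ?_
  rw [← Finset.mul_prod_erase _ _ (Finset.mem_univ k)]
  field_simp [(hx k).ne']

theorem prod_pairs_eq {M : Type*} [CommMonoid M] (f : Fin N → Fin N → M) :
    ∏ p : Pairs N, f p.1.1 p.1.2 = ∏ i, ∏ j ∈ Finset.Ioi i, f i j := by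
  rw [Finset.prod_sigma']
  refine Finset.prod_bij' (fun p _ => ⟨p.1.1, p.1.2⟩)
    (fun p hp => ⟨(p.1, p.2), by simpa using hp⟩) ?_ ?_ ?_ ?_ ?_
  · intro p _; simpa using p.2
  · simp
  · simp
  · simp
  · simp

/-- The volume element in the coordinates `(x, h)`. -/
def paramDensity (α : Fin m → ℝ) (q : Coords m N) : ℝ :=
  density α (surfacePoint α q) * ∏ k, chartDensity (q.2 k)

theorem exists_deriv_param {α : Fin m → ℝ} {q : Coords m N} (hq : Regular α q.1)
    (hd : chartDensity (q.2 0) ≠ 0) :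
    ∃ (f' : Coords m N →L[ℝ] MatSpace (Fin m × Fin N)) (B : Coords m N →ₗ[ℝ] Coords m N),
      HasStrictFDerivAt (fun q => toSpace (param α q)) f' q ∧
      (∀ v, ‖f' v‖ = ‖coordsEquiv m N (B v)‖) ∧ |LinearMap.det B| = paramDensity α q := by
  obtain ⟨f', hf', hv⟩ := exists_hasStrictFDerivAt_toSpace (f := param α) (x := q)
    (contDiffAt_param hq) (hasDerivAt_param hq)
  -- Coordinate variations are turned into logarithmic derivatives in each unitary factor, which
  -- accounts for `∏ chartDensity`; `jacobianMap` does the rest.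
  refine ⟨f', jacobianMap (fun j => radialSpeed α (q.1 j)) (fun j k => Real.sqrt (q.1 j + α k))
        (fun j k => blockEntry α q k j) (diagCorrection (q.2 0)) ∘ₗ
      LinearMap.prodMap LinearMap.id
        (LinearMap.pi fun k => (chartDeriv (q.2 k)).comp (LinearMap.proj k)), hf',
      fun v => ?_, ?_⟩
  · rw [← sq_eq_sq₀ (norm_nonneg _) (norm_nonneg _), hv, frob_blockCyclic]
    refine Eq.trans (Finset.sum_congr rfl fun k _ => ?_) (sum_frob_dBlock hq hd v)
    rw [frob_mul_unitary (V := (cayley (q.2 (k + 1)))ᴴ) (Unitary.star_mem (cayley_mem _)),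
      frob_unitary_mul (cayley_mem _)]
  · have hη (w : Fin N → Fin N → ℝ) (hw : ∀ a b, a ≠ b → w a b = 0) :
        diagCorrection (q.2 0) w = 0 := by
      have h1 : chartDeriv (q.2 0) w = w := chartDeriv_of_offDiag_eq_zero _ (by
        funext a b
        by_cases hab : a = b <;> simp [offDiag, hab, hw])
      funext j
      change w j j - Ring.inverse (chartDeriv (q.2 0)) w j j = 0
      nth_rewrite 2 [← h1]
      rw [inverse_chartDeriv_apply hd, sub_self]
    rw [LinearMap.det_comp, LinearMap.det_prodMap, LinearMap.det_pi, LinearMap.det_id, one_mul,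
      det_jacobianMap _ _ _ _ hη, abs_mul, Finset.abs_prod, paramDensity]
    congr 1
    simp only [prod_blockEntry hq]
    rw [← mul_assoc, ← Finset.prod_mul_distrib]
    simp only [radialSpeed_mul_prod (hq _)]
    rw [prod_pairs_eq (fun a b => ‖(surfacePoint α q b).1 - (surfacePoint α q a).1‖ ^ 2),
      Finset.prod_mul_distrib, abs_of_nonneg (by positivity), density]
    congr 1
    · simp [surfacePoint, chart]
    · refine Finset.prod_congr rfl fun i _ => Finset.prod_congr rfl fun j _ => ?_
      rw [norm_sub_rev]

end

section

/-! ### Orbits of generalized normal matrices -/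

variable {m N : ℕ} [NeZero m]

theorem blockCyclic_mul_conjTranspose (X : Fin m → Matrix (Fin N) (Fin N) ℂ) (k l : Fin m)
    (a b : Fin N) : (blockCyclic X * (blockCyclic X)ᴴ) (k, a) (l, b) =
      if k = l then (X k * (X k)ᴴ) a b else 0 := by
  simp only [Matrix.mul_apply, Fintype.sum_prod_type, blockCyclic, Matrix.conjTranspose_apply]
  rw [Finset.sum_eq_single (k + 1)]
  · by_cases hkl : k = l
    · subst hkl; simp
    · simp [hkl]
  · intro j _ hj; simp [hj]
  · simp

theorem conjTranspose_mul_blockCyclic (X : Fin m → Matrix (Fin N) (Fin N) ℂ) (k l : Fin m)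
    (a b : Fin N) : ((blockCyclic X)ᴴ * blockCyclic X) (k, a) (l, b) =
      if k = l then ((X (k - 1))ᴴ * X (k - 1)) a b else 0 := by
  simp only [Matrix.mul_apply, Fintype.sum_prod_type, blockCyclic, Matrix.conjTranspose_apply]
  rw [Finset.sum_eq_single (k - 1)]
  · by_cases hkl : k = l
    · subst hkl; simp
    · simp [hkl, Ne.symm hkl]
  · intro j _ hj
    have : k ≠ j + 1 := fun h => hj (by rw [h]; simp)
    simp [this]
  · simp

theorem blockCyclic_mem_genNormal_iff {lam : Fin m → ℝ} (X : Fin m → Matrix (Fin N) (Fin N) ℂ) :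
    blockCyclic X ∈ genNormal m N lam ↔ ∀ k, X k * (X k)ᴴ - (X (k - 1))ᴴ * X (k - 1) =
      Matrix.diagonal fun _ => (lam k : ℂ) := by
  constructor
  · rintro ⟨-, h⟩ k
    ext a b
    have h1 := congr_fun (congr_fun h (k, a)) (k, b)
    rw [Matrix.sub_apply, blockCyclic_mul_conjTranspose, conjTranspose_mul_blockCyclic, if_pos rfl,
      if_pos rfl] at h1
    rw [Matrix.sub_apply, h1]
    simp [Matrix.diagonal_apply]
  · intro h
    refine ⟨fun i j hij a b => by simp [blockCyclic, hij], ?_⟩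
    ext ⟨k, a⟩ ⟨l, b⟩
    rw [Matrix.sub_apply, blockCyclic_mul_conjTranspose, conjTranspose_mul_blockCyclic]
    by_cases hkl : k = l
    · subst hkl
      rw [if_pos rfl, if_pos rfl, ← Matrix.sub_apply, h]
      simp [Matrix.diagonal_apply]
    · simp [hkl]

theorem exists_eq_blockCyclic {lam : Fin m → ℝ} {A : BlockMat m N} (hA : A ∈ genNormal m N lam) :
    ∃ X : Fin m → Matrix (Fin N) (Fin N) ℂ, A = blockCyclic X := by
  refine ⟨fun k => Matrix.of fun a b => A (k, a) (k + 1, b), ?_⟩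
  ext ⟨k, a⟩ ⟨l, b⟩
  by_cases h : l = k + 1
  · subst h; simp [blockCyclic]
  · simp [blockCyclic, h, hA.1 k l h]

theorem blockCyclic_injective :
    Function.Injective (blockCyclic : (Fin m → Matrix (Fin N) (Fin N) ℂ) → BlockMat m N) := by
  intro X Y h
  funext k
  ext a b
  have := congr_fun (congr_fun h (k, a)) (k + 1, b)
  simpa [blockCyclic] using this

theorem unitary_conjTranspose_mul (S : U N) :
    (S : Matrix (Fin N) (Fin N) ℂ)ᴴ * (S : Matrix (Fin N) (Fin N) ℂ) = 1 :=
  Matrix.mem_unitaryGroup_iff'.mp S.2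

theorem unitary_mul_conjTranspose (S : U N) :
    (S : Matrix (Fin N) (Fin N) ℂ) * (S : Matrix (Fin N) (Fin N) ℂ)ᴴ = 1 :=
  Matrix.mem_unitaryGroup_iff.mp S.2

theorem unitary_conjTranspose_mul_cancel (S : U N) (M : Matrix (Fin N) (Fin N) ℂ) :
    (S : Matrix (Fin N) (Fin N) ℂ)ᴴ * ((S : Matrix (Fin N) (Fin N) ℂ) * M) = M := by
  rw [← Matrix.mul_assoc, unitary_conjTranspose_mul, Matrix.one_mul]

theorem unitary_mul_conjTranspose_cancel (S : U N) (M : Matrix (Fin N) (Fin N) ℂ) :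
    (S : Matrix (Fin N) (Fin N) ℂ) * ((S : Matrix (Fin N) (Fin N) ℂ)ᴴ * M) = M := by
  rw [← Matrix.mul_assoc, unitary_mul_conjTranspose, Matrix.one_mul]

/-- The diagonal entries of `diagBlock`. -/
def diagEntry (α : Fin m → ℝ) (p : ℂ × ℝ) (k : Fin m) : ℂ :=
  (Real.sqrt (p.2 + α k) : ℂ) * (if k = 0 then Complex.exp (Complex.arg p.1 * Complex.I) else 1)

theorem diagBlock_eq (α : Fin m → ℝ) (p : Fin N → ℂ × ℝ) (k : Fin m) :
    diagBlock α p k = Matrix.diagonal fun j => diagEntry α (p j) k := rfl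

theorem diagEntry_mul_star {α : Fin m → ℝ} {p : ℂ × ℝ} (hp : p ∈ surface α) (k : Fin m) :
    diagEntry α p k * star (diagEntry α p k) = (p.2 + α k : ℝ) := by
  have h1 : ‖diagEntry α p k‖ = Real.sqrt (p.2 + α k) := by
    rw [diagEntry, norm_mul, Complex.norm_real, Real.norm_of_nonneg (Real.sqrt_nonneg _)]
    split_ifs
    · rw [Complex.norm_exp_ofReal_mul_I, mul_one]
    · simp
  rw [Complex.star_def, Complex.mul_conj, Complex.normSq_eq_norm_sq, h1, Real.sq_sqrt (hp.1 k)]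

theorem prod_diagEntry {α : Fin m → ℝ} {p : ℂ × ℝ} (hp : p ∈ surface α) :
    ∏ k, diagEntry α p k = p.1 := by
  simp only [diagEntry, Finset.prod_mul_distrib]
  rw [Finset.prod_ite_eq' Finset.univ (0 : Fin m), if_pos (Finset.mem_univ _),
    ← Complex.ofReal_prod, ← Real.sqrt_prod Finset.univ fun k _ => hp.1 k, ← eval_Q, ← hp.2,
    Real.sqrt_sq (norm_nonneg _), Complex.norm_mul_exp_arg_mul_I]

theorem diagBlock_mul_conjTranspose {α : Fin m → ℝ} {p : Fin N → ℂ × ℝ}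
    (hp : ∀ j, p j ∈ surface α) (k : Fin m) : diagBlock α p k * (diagBlock α p k)ᴴ =
      Matrix.diagonal fun j => (((p j).2 : ℝ) : ℂ) + (α k : ℂ) := by
  rw [diagBlock_eq, Matrix.diagonal_conjTranspose, Matrix.diagonal_mul_diagonal]
  congr 1
  funext j
  rw [Pi.star_apply, diagEntry_mul_star (hp j)]
  simp

theorem conjTranspose_mul_diagBlock {α : Fin m → ℝ} {p : Fin N → ℂ × ℝ}
    (hp : ∀ j, p j ∈ surface α) (k : Fin m) : (diagBlock α p k)ᴴ * diagBlock α p k =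
      Matrix.diagonal fun j => (((p j).2 : ℝ) : ℂ) + (α k : ℂ) := by
  rw [← diagBlock_mul_conjTranspose hp, diagBlock_eq, Matrix.diagonal_conjTranspose,
    Matrix.diagonal_mul_diagonal, Matrix.diagonal_mul_diagonal]
  congr 1
  funext j
  exact mul_comm _ _

theorem orbitPoint_mem_genNormal {lam α : Fin m → ℝ} (hα : ∀ i, lam i = α i - α (i - 1))
    {p : Fin N → ℂ × ℝ} (hp : ∀ j, p j ∈ surface α) (S : Fin m → U N) :
    orbitPoint α p S ∈ genNormal m N lam := by
  rw [orbitPoint, blockCyclic_mem_genNormal_iff]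
  intro k
  have h1 : (S k : Matrix (Fin N) (Fin N) ℂ) * diagBlock α p k * (S (k + 1) : Matrix _ _ ℂ)ᴴ *
      ((S k : Matrix (Fin N) (Fin N) ℂ) * diagBlock α p k * (S (k + 1) : Matrix _ _ ℂ)ᴴ)ᴴ =
      (S k : Matrix (Fin N) (Fin N) ℂ) * (diagBlock α p k * (diagBlock α p k)ᴴ) *
        (S k : Matrix (Fin N) (Fin N) ℂ)ᴴ := by
    simp only [Matrix.conjTranspose_mul, Matrix.conjTranspose_conjTranspose, Matrix.mul_assoc]
    rw [unitary_conjTranspose_mul_cancel]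
  have h2 (l : Fin m) : ((S l : Matrix (Fin N) (Fin N) ℂ) * diagBlock α p l *
      (S (l + 1) : Matrix _ _ ℂ)ᴴ)ᴴ *
      ((S l : Matrix (Fin N) (Fin N) ℂ) * diagBlock α p l * (S (l + 1) : Matrix _ _ ℂ)ᴴ) =
      (S (l + 1) : Matrix (Fin N) (Fin N) ℂ) * ((diagBlock α p l)ᴴ * diagBlock α p l) *
        (S (l + 1) : Matrix (Fin N) (Fin N) ℂ)ᴴ := by
    simp only [Matrix.conjTranspose_mul, Matrix.conjTranspose_conjTranspose, Matrix.mul_assoc]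
    rw [unitary_conjTranspose_mul_cancel]
  rw [h1, h2, sub_add_cancel, diagBlock_mul_conjTranspose hp, conjTranspose_mul_diagBlock hp,
    ← Matrix.sub_mul, ← Matrix.mul_sub, Matrix.diagonal_sub]
  have h3 : (fun j => (((p j).2 : ℝ) : ℂ) + (α k : ℂ) - ((((p j).2 : ℝ) : ℂ) + (α (k - 1) : ℂ))) =
      fun _ : Fin N => (lam k : ℂ) := by
    funext j
    rw [hα]; push_cast; ring
  rw [h3]
  have h4 : (Matrix.diagonal fun _ : Fin N => (lam k : ℂ)) = (lam k : ℂ) • 1 := by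
    rw [Matrix.smul_one_eq_diagonal]
  rw [h4, Matrix.mul_smul, Matrix.smul_mul, Matrix.mul_one, unitary_mul_conjTranspose]

/-- The unitary matrices intertwining two families of coordinates of the same matrix. -/
theorem intertwine_of_orbitPoint_eq {α : Fin m → ℝ} {p p' : Fin N → ℂ × ℝ} {S S' : Fin m → U N}
    (h : orbitPoint α p S = orbitPoint α p' S') (k : Fin m) (i j : Fin N) :
    ((S' k)⁻¹ * S k : U N).1 i j * diagEntry α (p j) k =
      diagEntry α (p' i) k * ((S' (k + 1))⁻¹ * S (k + 1) : U N).1 i j := by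
  have h1 : (S k : Matrix (Fin N) (Fin N) ℂ) * diagBlock α p k * (S (k + 1) : Matrix _ _ ℂ)ᴴ =
      (S' k : Matrix (Fin N) (Fin N) ℂ) * diagBlock α p' k * (S' (k + 1) : Matrix _ _ ℂ)ᴴ :=
    congr_fun (blockCyclic_injective h) k
  have h2 : ((S' k)⁻¹ * S k : U N).1 * diagBlock α p k =
      diagBlock α p' k * ((S' (k + 1))⁻¹ * S (k + 1) : U N).1 := by
    change (S' k : Matrix (Fin N) (Fin N) ℂ)ᴴ * (S k : Matrix (Fin N) (Fin N) ℂ) * _ =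
      _ * ((S' (k + 1) : Matrix (Fin N) (Fin N) ℂ)ᴴ * (S (k + 1) : Matrix (Fin N) (Fin N) ℂ))
    calc _ = (S' k : Matrix (Fin N) (Fin N) ℂ)ᴴ * ((S k : Matrix (Fin N) (Fin N) ℂ) *
          diagBlock α p k * (S (k + 1) : Matrix _ _ ℂ)ᴴ) * (S (k + 1) : Matrix _ _ ℂ) := by
            simp only [Matrix.mul_assoc, unitary_conjTranspose_mul, Matrix.mul_one]
      _ = _ := by
        rw [h1]
        simp only [← Matrix.mul_assoc, unitary_conjTranspose_mul, Matrix.one_mul]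
  have h3 := congr_fun (congr_fun h2 i) j
  rwa [diagBlock_eq, diagBlock_eq, Matrix.mul_diagonal, Matrix.diagonal_mul] at h3

/-- The intertwining matrices intertwine the eigenvalues. -/
theorem intertwine_snd {α : Fin m → ℝ} {p p' : Fin N → ℂ × ℝ} {S S' : Fin m → U N}
    (hp : ∀ j, p j ∈ surface α) (hp' : ∀ j, p' j ∈ surface α)
    (h : orbitPoint α p S = orbitPoint α p' S') (k : Fin m) (i j : Fin N)
    (hV : ((S' k)⁻¹ * S k : U N).1 i j ≠ 0) : (p j).2 = (p' i).2 := by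
  set V := ((S' k)⁻¹ * S k : U N) with hVdef
  set W := ((S' (k + 1))⁻¹ * S (k + 1) : U N) with hW
  have h1 : V.1 * diagBlock α p k = diagBlock α p' k * W.1 := by
    ext i j
    rw [diagBlock_eq, diagBlock_eq, Matrix.mul_diagonal, Matrix.diagonal_mul]
    exact intertwine_of_orbitPoint_eq h k i j
  -- Combining `V D = D' W` with its adjoint eliminates `W`: `V` intertwines `D D†` and `D' D'†`,
  -- which see only the `x_j`.
  have h2 : V.1 * (diagBlock α p k * (diagBlock α p k)ᴴ) =
      (diagBlock α p' k * (diagBlock α p' k)ᴴ) * V.1 := by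
    have h3 : (diagBlock α p k)ᴴ = W.1ᴴ * (diagBlock α p' k)ᴴ * V.1 := by
      rw [← Matrix.conjTranspose_mul, ← h1, Matrix.conjTranspose_mul, Matrix.mul_assoc,
        unitary_conjTranspose_mul, Matrix.mul_one]
    rw [← Matrix.mul_assoc, h1, h3]
    simp only [Matrix.mul_assoc, unitary_mul_conjTranspose_cancel]
  rw [diagBlock_mul_conjTranspose hp, diagBlock_mul_conjTranspose hp'] at h2
  have h3 := congr_fun (congr_fun h2 i) j
  rw [Matrix.mul_diagonal, Matrix.diagonal_mul, mul_comm] at h3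
  have h4 := mul_right_cancel₀ hV h3
  exact_mod_cast add_right_cancel h4

/-- The relations `V_k D_k = D'_k V_{k+1}` multiply around the cycle to `V_0 ∏ D_k = ∏ D'_k V_0`,
and the products of diagonal entries are the `z_j`. -/
theorem intertwine_fst {α : Fin m → ℝ} {p p' : Fin N → ℂ × ℝ} {S S' : Fin m → U N}
    (hp : ∀ j, p j ∈ surface α) (hp' : ∀ j, p' j ∈ surface α)
    (h : orbitPoint α p S = orbitPoint α p' S') (i j : Fin N)
    (hV : ((S' 0)⁻¹ * S 0 : U N).1 i j ≠ 0) : (p j).1 = (p' i).1 := by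
  have key (n : ℕ) : ((S' 0)⁻¹ * S 0 : U N).1 i j *
      ∏ l ∈ Finset.range n, diagEntry α (p j) (Fin.ofNat m l) =
      (∏ l ∈ Finset.range n, diagEntry α (p' i) (Fin.ofNat m l)) *
        ((S' (Fin.ofNat m n))⁻¹ * S (Fin.ofNat m n) : U N).1 i j := by
    induction n with
    | zero => simp
    | succ n ih =>
      have hn : Fin.ofNat m (n + 1) = Fin.ofNat m n + 1 := by
        apply Fin.ext
        simp [Fin.val_add]
      rw [Finset.prod_range_succ, Finset.prod_range_succ, ← mul_assoc, ih, mul_assoc, mul_assoc, hn,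
        intertwine_of_orbitPoint_eq h]
  have h1 := key m
  have hm : Fin.ofNat m m = 0 := by apply Fin.ext; simp
  have hprod (f : Fin m → ℂ) : ∏ l ∈ Finset.range m, f (Fin.ofNat m l) = ∏ k, f k := by
    rw [← Fin.prod_univ_eq_prod_range (fun l => f (Fin.ofNat m l))]
    refine Finset.prod_congr rfl fun k _ => ?_
    congr 1
    apply Fin.ext
    simp
  rw [hm, hprod, hprod, prod_diagEntry (hp j), prod_diagEntry (hp' i), mul_comm] at h1
  exact mul_right_cancel₀ hV h1

-- A nonzero determinant has a nonzero term in its Leibniz expansion.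
omit [NeZero m] in
theorem exists_perm_apply_ne_zero (V : U N) :
    ∃ σ : Equiv.Perm (Fin N), ∀ j, V.1 (σ j) j ≠ 0 := by
  have hdet : V.1.det ≠ 0 := by
    intro h0
    have := congr_arg Matrix.det (unitary_mul_conjTranspose V)
    rw [Matrix.det_mul, h0, zero_mul, Matrix.det_one] at this
    exact zero_ne_one this
  rw [Matrix.det_apply] at hdet
  obtain ⟨σ, -, hσ⟩ := Finset.exists_ne_zero_of_sum_ne_zero hdet
  refine ⟨σ, fun j hj => hσ ?_⟩
  have h0 : ∏ i, V.1 (σ i) i = 0 :=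
    Finset.prod_eq_zero (f := fun i => V.1 (σ i) i) (Finset.mem_univ j) hj
  exact (congr_arg (fun x => Equiv.Perm.sign σ • x) h0).trans (smul_zero _)

/-- A nonzero entry of the intertwining matrix matches two equal points of Σ, and a permutation
along nonzero entries matches them all. No assumption on multiplicities is needed. -/
theorem exists_perm_of_orbitPoint_eq {α : Fin m → ℝ} {p p' : Fin N → ℂ × ℝ} {S S' : Fin m → U N}
    (hp : ∀ j, p j ∈ surface α) (hp' : ∀ j, p' j ∈ surface α)
    (h : orbitPoint α p S = orbitPoint α p' S') : ∃ σ : Equiv.Perm (Fin N), p' = p ∘ σ := by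
  obtain ⟨σ, hσ⟩ := exists_perm_apply_ne_zero ((S' 0)⁻¹ * S 0)
  refine ⟨σ.symm, funext fun i => ?_⟩
  have h1 := hσ (σ.symm i)
  rw [Equiv.apply_symm_apply] at h1
  exact (Prod.ext (intertwine_fst hp hp' h _ _ h1) (intertwine_snd hp hp' h _ _ _ h1)).symm

/-- The permutation matrices, as unitary matrices. -/
def permU (σ : Equiv.Perm (Fin N)) : U N := ⟨Matrix.of fun i j => if i = σ j then 1 else 0, by
  rw [Matrix.mem_unitaryGroup_iff']
  ext i j
  simp [Matrix.mul_apply, Matrix.star_apply, Matrix.one_apply, eq_comm]⟩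

theorem orbitPoint_comp_perm (α : Fin m → ℝ) (p : Fin N → ℂ × ℝ) (σ : Equiv.Perm (Fin N))
    (S : Fin m → U N) : orbitPoint α (p ∘ σ) (S * fun _ => permU σ) = orbitPoint α p S := by
  unfold orbitPoint
  congr 1
  funext k
  have h1 : (permU σ : Matrix (Fin N) (Fin N) ℂ) * diagBlock α (p ∘ σ) k =
      diagBlock α p k * (permU σ : Matrix (Fin N) (Fin N) ℂ) := by
    ext i j
    rw [diagBlock_eq, diagBlock_eq, Matrix.mul_diagonal, Matrix.diagonal_mul]
    by_cases h : i = σ j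
    · simp [permU, h]
    · simp [permU, h]
  calc _ = (S k : Matrix (Fin N) (Fin N) ℂ) * ((permU σ : Matrix (Fin N) (Fin N) ℂ) *
        diagBlock α (p ∘ σ) k) * (permU σ : Matrix (Fin N) (Fin N) ℂ)ᴴ *
        (S (k + 1) : Matrix (Fin N) (Fin N) ℂ)ᴴ := by
          simp [Matrix.mul_assoc]
    _ = _ := by
      rw [h1, ← Matrix.mul_assoc, Matrix.mul_assoc _ _ (permU σ : Matrix (Fin N) (Fin N) ℂ)ᴴ,
        unitary_mul_conjTranspose, Matrix.mul_one]

/-- Matrices with regular coordinates determine the unitary coordinates up to the torus. -/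
theorem exists_diagU_of_orbitPoint_eq {α : Fin m → ℝ} {p : Fin N → ℂ × ℝ} {S S' : Fin m → U N}
    (hp : ∀ j, p j ∈ surface α) (hinj : Function.Injective fun j => (p j).2)
    (hreg : ∀ j k, 0 < (p j).2 + α k) (h : orbitPoint α p S = orbitPoint α p S') :
    ∃ t : Fin N → Circle, ∀ k, S k = S' k * diagU N t := by
  -- Distinct `x_j` force the intertwining matrices to be diagonal; nonvanishing of the entries of
  -- `D_k` then forces them to be the same for all `k`.
  have hoff (k : Fin m) (i j : Fin N) (hij : i ≠ j) : ((S' k)⁻¹ * S k : U N).1 i j = 0 := by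
    by_contra hV
    exact hij (hinj (intertwine_snd hp hp h k i j hV)).symm
  have hdiag (k : Fin m) (j : Fin N) :
      ((S' (k + 1))⁻¹ * S (k + 1) : U N).1 j j = ((S' k)⁻¹ * S k : U N).1 j j := by
    have h1 := intertwine_of_orbitPoint_eq h k j j
    rw [mul_comm] at h1
    refine (mul_left_cancel₀ ?_ h1).symm
    intro h0
    have h2 := diagEntry_mul_star (hp j) k
    rw [h0, zero_mul] at h2
    exact (hreg j k).ne (by exact_mod_cast h2)
  have hconst (k : Fin m) (j : Fin N) :
      ((S' k)⁻¹ * S k : U N).1 j j = ((S' 0)⁻¹ * S 0 : U N).1 j j := by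
    have key (n : ℕ) : ((S' (Fin.ofNat m n))⁻¹ * S (Fin.ofNat m n) : U N).1 j j =
        ((S' 0)⁻¹ * S 0 : U N).1 j j := by
      induction n with
      | zero => simp
      | succ n ih =>
        have hn : Fin.ofNat m (n + 1) = Fin.ofNat m n + 1 := by
          apply Fin.ext
          simp [Fin.val_add]
        rw [hn, hdiag, ih]
    have hk : Fin.ofNat m k.1 = k := by
      apply Fin.ext
      simp
    rw [← hk, key]
  have hnorm (j : Fin N) : ‖((S' 0)⁻¹ * S 0 : U N).1 j j‖ = 1 := by
    have h1 := congr_fun (congr_fun (unitary_mul_conjTranspose ((S' 0)⁻¹ * S 0)) j) j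
    rw [Matrix.mul_apply, Finset.sum_eq_single j, Matrix.one_apply_eq, Matrix.conjTranspose_apply,
      Complex.star_def, Complex.mul_conj, Complex.normSq_eq_norm_sq] at h1
    · have h2 : ‖((S' 0)⁻¹ * S 0 : U N).1 j j‖ ^ 2 = 1 := by exact_mod_cast h1
      exact (pow_eq_one_iff_of_nonneg (norm_nonneg _) two_ne_zero).mp h2
    · intro i _ hi
      rw [hoff 0 j i hi.symm, zero_mul]
    · simp
  refine ⟨fun j => ⟨((S' 0)⁻¹ * S 0 : U N).1 j j, by simpa [Submonoid.unitSphere] using hnorm j⟩,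
    fun k => ?_⟩
  rw [← inv_mul_eq_iff_eq_mul]
  ext i j
  refine Eq.trans ?_ (diagU_apply _ i j).symm
  split_ifs with hij
  · subst hij
    exact hconst k i
  · exact hoff k i j hij

/-- The coordinates `(x, h)` with distinct ordered eigenvalues. -/
def paramDomain (α : Fin m → ℝ) (N : ℕ) : Set (Coords m N) :=
  {q | Regular α q.1 ∧ StrictMono q.1 ∧ ∀ k, q.2 k ∈ chartDomain N}

/-- The unitary matrices attached to the coordinates `h`. -/
def paramU (h : Fin m → RMat N) (k : Fin m) : U N := if k = 0 then cayleyU (h 0) else chartU (h k)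

theorem chart_mem_surface {α : Fin m → ℝ} {x : ℝ} (hx : ∀ k, 0 ≤ x + α k) (θ : ℝ) :
    chart α (x, θ) ∈ surface α := by
  refine ⟨hx, ?_⟩
  simp only [chart]
  rw [norm_mul, Complex.norm_exp_ofReal_mul_I, mul_one, Complex.norm_real,
    Real.norm_of_nonneg (Real.sqrt_nonneg _), Real.sq_sqrt]
  rw [eval_Q]
  exact Finset.prod_nonneg fun k _ => hx k

theorem exp_arg_chart {α : Fin m → ℝ} {x : ℝ} (hx : ∀ k, 0 < x + α k) (θ : ℝ) :
    Complex.exp (Complex.arg (chart α (x, θ)).1 * Complex.I) = Complex.exp (θ * Complex.I) := by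
  have hQ : 0 < Real.sqrt ((Q α).eval x) := by
    rw [eval_Q]; exact Real.sqrt_pos.mpr (Finset.prod_pos fun k _ => hx k)
  have h1 := Complex.norm_mul_exp_arg_mul_I (chart α (x, θ)).1
  have h2 : ‖(chart α (x, θ)).1‖ = Real.sqrt ((Q α).eval x) := by
    simp only [chart]
    rw [norm_mul, Complex.norm_exp_ofReal_mul_I, mul_one, Complex.norm_real,
      Real.norm_of_nonneg (Real.sqrt_nonneg _)]
  rw [h2] at h1
  exact mul_left_cancel₀ (Complex.ofReal_ne_zero.mpr hQ.ne') h1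

/-- The phases of `S_k = Γ(h_k)` are absorbed in the diagonal blocks, while `S_0` is the bare Cayley
transform and the diagonal of `h 0` represents `θ`. Only the phase `e^{i arg z_j}` is constrained,
so the identity also covers `z_j = 0`. -/
theorem param_eq_orbitPoint_of {α : Fin m → ℝ} {q : Coords m N} {p : Fin N → ℂ × ℝ}
    (hx : ∀ j, (p j).2 = q.1 j)
    (hθ : ∀ j, Complex.exp (Complex.arg (p j).1 * Complex.I) = Complex.exp (q.2 0 j j * Complex.I)) :
    param α q = orbitPoint α p (paramU q.2) := by
  unfold param orbitPoint
  congr 1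
  funext k
  have hS (l : Fin m) : (paramU q.2 l : Matrix (Fin N) (Fin N) ℂ) = cayley (q.2 l) *
      Matrix.diagonal fun j => if l = 0 then 1 else Complex.exp (q.2 l j j * Complex.I) := by
    by_cases hl : l = 0
    · subst hl
      simp only [paramU, if_true, Matrix.diagonal_one, Matrix.mul_one]
      rfl
    · ext a b
      rw [Matrix.mul_diagonal]
      simp only [paramU, hl, if_false, chartU_apply]
  rw [hS, hS, Matrix.conjTranspose_mul, Matrix.diagonal_conjTranspose, diagBlock_eq]
  have : cayley (q.2 k) * (Matrix.diagonal fun j => if k = 0 then 1 else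
      Complex.exp (q.2 k j j * Complex.I)) * (Matrix.diagonal fun j =>
      diagEntry α (p j) k) * (Matrix.diagonal (star fun j =>
        if k + 1 = 0 then 1 else Complex.exp (q.2 (k + 1) j j * Complex.I)) *
      (cayley (q.2 (k + 1)))ᴴ) = cayley (q.2 k) * ((Matrix.diagonal fun j => if k = 0 then 1 else
      Complex.exp (q.2 k j j * Complex.I)) * (Matrix.diagonal fun j =>
      diagEntry α (p j) k) * Matrix.diagonal (star fun j =>
        if k + 1 = 0 then 1 else Complex.exp (q.2 (k + 1) j j * Complex.I))) *
      (cayley (q.2 (k + 1)))ᴴ := by simp only [Matrix.mul_assoc]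
  rw [this, Matrix.diagonal_mul_diagonal, Matrix.diagonal_mul_diagonal]
  congr 3
  funext j
  have hstar : star (if k + 1 = 0 then 1 else Complex.exp (q.2 (k + 1) j j * Complex.I)) =
      Complex.exp (-(if k + 1 = 0 then 0 else q.2 (k + 1) j j : ℝ) * Complex.I) := by
    split_ifs
    · simp
    · rw [Complex.star_def, ← Complex.exp_conj]
      simp
  rw [Pi.star_apply, hstar]
  simp only [diagEntry, hθ, hx]
  have h1 : Complex.exp (blockAngle q.2 k j * Complex.I) = Complex.exp (q.2 k j j * Complex.I) *
      Complex.exp (-(if k + 1 = 0 then 0 else q.2 (k + 1) j j : ℝ) * Complex.I) := by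
    rw [← Complex.exp_add, blockAngle]
    push_cast
    ring_nf
  rw [blockEntry, h1]
  by_cases hk : k = 0
  · subst hk
    simp only [if_true, one_mul]
    ring
  · simp only [hk, if_false, mul_one]
    ring

theorem param_eq_orbitPoint {α : Fin m → ℝ} {q : Coords m N} (hq : Regular α q.1) :
    param α q = orbitPoint α (surfacePoint α q) (paramU q.2) :=
  param_eq_orbitPoint_of (fun _ => rfl) fun j => exp_arg_chart (hq j) _

theorem surfacePoint_mem {α : Fin m → ℝ} {q : Coords m N} (hq : Regular α q.1) (j : Fin N) :
    surfacePoint α q j ∈ surface α := chart_mem_surface (fun k => (hq j k).le) _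

/-- The only order automorphism of `Fin N` is the identity. -/
theorem eq_of_strictMono_of_perm {f g : Fin N → ℝ} (hf : StrictMono f) (hg : StrictMono g)
    {σ : Equiv.Perm (Fin N)} (h : g = f ∘ σ) : σ = 1 := by
  have h1 : StrictMono σ := fun i j hij => hf.lt_iff_lt.mp (by
    have := hg hij
    rwa [h] at this)
  ext i
  have : (OrderIso.refl (Fin N) : Fin N ≃o Fin N) = h1.orderIsoOfSurjective σ σ.surjective :=
    Subsingleton.elim _ _
  have h2 := congr_arg (fun e : Fin N ≃o Fin N => e i) this
  exact (congr_arg Fin.val h2).symm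

theorem chart_injOn {α : Fin m → ℝ} {x θ θ' : ℝ} (hx : ∀ k, 0 < x + α k)
    (hθ : θ ∈ Set.Ico 0 (2 * Real.pi)) (hθ' : θ' ∈ Set.Ico 0 (2 * Real.pi))
    (h : chart α (x, θ) = chart α (x, θ')) : θ = θ' := by
  have h1 := exp_arg_chart hx θ
  rw [h, exp_arg_chart hx θ'] at h1
  exact circle_exp_injOn hθ hθ' (Circle.ext h1.symm)

theorem orbitPoint_injective_of_strictMono {α : Fin m → ℝ} {p p' : Fin N → ℂ × ℝ}
    {S S' : Fin m → U N} (hp : ∀ j, p j ∈ surface α) (hp' : ∀ j, p' j ∈ surface α)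
    (hmono : StrictMono fun j => (p j).2) (hmono' : StrictMono fun j => (p' j).2)
    (hreg : ∀ j k, 0 < (p j).2 + α k) (h : orbitPoint α p S = orbitPoint α p' S') :
    p = p' ∧ ∃ t : Fin N → Circle, ∀ k, S k = S' k * diagU N t := by
  obtain ⟨σ, hσ⟩ := exists_perm_of_orbitPoint_eq hp hp' h
  have h1 : σ = 1 := eq_of_strictMono_of_perm hmono hmono' (by
    funext j; exact congr_arg Prod.snd (congr_fun hσ j))
  rw [h1] at hσ
  have h2 : p' = p := hσ
  subst h2
  exact ⟨rfl, exists_diagU_of_orbitPoint_eq hp hmono.injective hreg h⟩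

/-- The ordering of the `x_j` excludes permutations, leaving a torus ambiguity `t`. At index 0 two
Cayley transforms differ by `t`, so the choice of the chart radius makes them equal and `t = 1`. -/
theorem param_injOn (α : Fin m → ℝ) (N : ℕ) : Set.InjOn (param α) (paramDomain α N) := by
  rintro q ⟨hq1, hq2, hq3⟩ q' ⟨hq1', hq2', hq3'⟩ heq
  rw [param_eq_orbitPoint hq1, param_eq_orbitPoint hq1'] at heq
  obtain ⟨hp, t, ht⟩ := orbitPoint_injective_of_strictMono (surfacePoint_mem hq1)
    (surfacePoint_mem hq1') hq2 hq2' hq1 heq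
  have hx : q.1 = q'.1 := funext fun j => congr_arg Prod.snd (congr_fun hp j)
  have hθ (j : Fin N) : q.2 0 j j = q'.2 0 j j := by
    have h1 : chart α (q.1 j, q.2 0 j j) = chart α (q'.1 j, q'.2 0 j j) := congr_fun hp j
    rw [← hx] at h1
    exact chart_injOn (hq1 j) ((hq3 0).2 j) ((hq3' 0).2 j) h1
  have h0 := ht 0
  simp only [paramU, if_true] at h0
  have hoff := offDiag_eq_of_cayleyU_eq (hq3 0).1 (hq3' 0).1 h0
  have ht1 : diagU N t = 1 := by
    rw [← cayleyU_offDiag, hoff, cayleyU_offDiag] at h0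
    exact (mul_eq_left.mp h0.symm)
  refine Prod.ext hx (funext fun k => ?_)
  by_cases hk : k = 0
  · subst hk
    exact eq_of_offDiag_eq hoff hθ
  · have hk' := ht k
    simp only [paramU, hk, if_false, ht1, mul_one] at hk'
    exact chartU_injOn N (hq3 k) (hq3' k) hk'

end

section

/-! ### Every generalized normal matrix has coordinates -/

/-! ### Joint unitary diagonalization and factorization of matrices with orthogonal rows. -/

section LinearAlgebra

variable {N : ℕ}

/-- The unitary matrix with the vectors of an orthonormal basis as rows. -/
theorem exists_unitary_rows (b : OrthonormalBasis (Fin N) ℂ (EuclideanSpace ℂ (Fin N))) :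
    ∃ V : U N, ∀ i j, V.1 i j = b i j := by
  refine ⟨⟨Matrix.of fun i j => b i j, ?_⟩, fun i j => rfl⟩
  rw [Matrix.mem_unitaryGroup_iff]
  ext i j
  have h := orthonormal_iff_ite.mp b.orthonormal j i
  rw [EuclideanSpace.inner_eq_star_dotProduct] at h
  rw [Matrix.one_apply, Matrix.mul_apply]
  simp only [eq_comm (a := i)]
  rw [← h]
  rfl

/-- The unitary matrix with the vectors of an orthonormal basis as columns. -/
theorem exists_unitary_columns (b : OrthonormalBasis (Fin N) ℂ (EuclideanSpace ℂ (Fin N))) :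
    ∃ V : U N, ∀ i j, V.1 i j = b j i := by
  refine ⟨⟨Matrix.of fun i j => b j i, ?_⟩, fun i j => rfl⟩
  rw [Matrix.mem_unitaryGroup_iff']
  ext i j
  have h := orthonormal_iff_ite.mp b.orthonormal i j
  rw [EuclideanSpace.inner_eq_star_dotProduct] at h
  rw [Matrix.one_apply, Matrix.mul_apply, ← h, dotProduct]
  exact Finset.sum_congr rfl fun k _ => mul_comm _ _

/-- Commuting Hermitian matrices have a common unitary diagonalization. -/
theorem exists_unitary_joint_diagonalization {ι : Type*} (T : ι → Matrix (Fin N) (Fin N) ℂ)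
    (hT : ∀ i, (T i).IsHermitian) (hC : ∀ i j, T i * T j = T j * T i) :
    ∃ (W : U N) (d : ι → Fin N → ℂ), ∀ i, T i * W.1 = W.1 * Matrix.diagonal (d i) := by
  classical
  have hT' (i : ι) : (Matrix.toEuclideanLin (T i)).IsSymmetric :=
    Matrix.isSymmetric_toEuclideanLin_iff.mpr (hT i)
  have hC' : Pairwise (Function.onFun Commute fun i => Matrix.toEuclideanLin (T i)) := by
    intro i j _
    change Matrix.toEuclideanLin (T i) * Matrix.toEuclideanLin (T j) =
      Matrix.toEuclideanLin (T j) * Matrix.toEuclideanLin (T i)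
    refine LinearMap.ext fun v => ?_
    have := congr_arg (fun M => WithLp.toLp 2 (M *ᵥ v.ofLp)) (hC i j)
    simpa [Matrix.toLpLin_apply] using this
  have hint := LinearMap.IsSymmetric.directSum_isInternal_of_pairwise_commute hT' hC'
  have horth := LinearMap.IsSymmetric.orthogonalFamily_iInf_eigenspaces hT'
  set V : (ι → ℂ) → Submodule ℂ (EuclideanSpace ℂ (Fin N)) :=
    fun γ => ⨅ j, Module.End.eigenspace (Matrix.toEuclideanLin (T j)) (γ j) with hV
  -- Discarding the zero joint eigenspaces leaves a finite index set, as required for a basis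
  -- subordinate to the decomposition.
  have hint' := (DirectSum.isInternal_ne_bot_iff (A := V)).mpr hint
  have : Fintype {γ // V γ ≠ ⊥} := horth.independent.fintypeNeBotOfFiniteDimensional
  have horth' : OrthogonalFamily ℂ (fun γ : {γ // V γ ≠ ⊥} => V γ)
      fun γ => (V γ).subtypeₗᵢ := horth.comp Subtype.val_injective
  have hn : Module.finrank ℂ (EuclideanSpace ℂ (Fin N)) = N := by simp
  obtain ⟨W, hW⟩ := exists_unitary_columns (hint'.subordinateOrthonormalBasis hn horth')
  refine ⟨W, fun i a => (hint'.subordinateOrthonormalBasisIndex hn a horth').1 i, fun i => ?_⟩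
  ext a b
  have h1 := hint'.subordinateOrthonormalBasis_subordinate hn b horth'
  have h2 := Module.End.mem_eigenspace_iff.mp (Submodule.mem_iInf _ |>.mp h1 i)
  have h3 := congr_arg (fun v : EuclideanSpace ℂ (Fin N) => v a) h2
  rw [Matrix.mul_diagonal, Matrix.mul_apply]
  simp only [hW]
  rw [mul_comm]
  simpa [Matrix.toLpLin_apply, Matrix.mulVec, dotProduct] using h3

/-- A matrix with orthogonal rows is a diagonal matrix times a unitary one. -/
theorem exists_eq_diagonal_mul_unitary {Y : Matrix (Fin N) (Fin N) ℂ} {d : Fin N → ℝ}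
    (h : Y * Yᴴ = Matrix.diagonal fun j => ((d j : ℝ) : ℂ) ^ 2) :
    ∃ V : U N, Y = (Matrix.diagonal fun j => (d j : ℂ)) * V.1 := by
  have hrow (i j : Fin N) : ∑ l, Y i l * star (Y j l) = if i = j then (d i : ℂ) ^ 2 else 0 := by
    have := congr_fun (congr_fun h i) j
    rwa [Matrix.mul_apply, Matrix.diagonal_apply] at this
  -- The rows with `d i ≠ 0` become orthonormal after rescaling and extend to an orthonormal basis.
  -- The other rows of `Y` vanish, so any extension serves.
  set v : Fin N → EuclideanSpace ℂ (Fin N) := fun i => WithLp.toLp 2 fun l => (d i : ℂ)⁻¹ * Y i l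
  have hv : Orthonormal ℂ (Set.domRestrict {i | d i ≠ 0} v) := by
    rw [orthonormal_iff_ite]
    rintro ⟨i, hi⟩ ⟨j, hj⟩
    have hi' : (d i : ℂ) ≠ 0 := Complex.ofReal_ne_zero.mpr hi
    have h1 : inner ℂ (v i) (v j) = (d i : ℂ)⁻¹ * (d j : ℂ)⁻¹ * ∑ l, Y j l * star (Y i l) := by
      rw [EuclideanSpace.inner_eq_star_dotProduct, dotProduct, Finset.mul_sum]
      refine Finset.sum_congr rfl fun l _ => ?_
      simp [v]
      ring
    change inner ℂ (v i) (v j) = _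
    rw [h1, hrow]
    by_cases hij : i = j
    · subst hij
      simp only [if_true]
      field_simp
    · have hji : ¬ j = i := fun h => hij h.symm
      simp [hij, hji]
  obtain ⟨b, hb⟩ := hv.exists_orthonormalBasis_extension_of_card_eq (by simp)
  obtain ⟨V, hV⟩ := exists_unitary_rows b
  refine ⟨V, ?_⟩
  ext i l
  rw [Matrix.diagonal_mul, hV]
  by_cases hi : d i = 0
  · have h1 := hrow i i
    simp only [if_true, hi] at h1
    have h2 : ∑ l, ‖Y i l‖ ^ 2 = 0 := by
      have h3 : ((∑ l, ‖Y i l‖ ^ 2 : ℝ) : ℂ) = 0 := by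
        push_cast
        simp only [Complex.star_def, Complex.mul_conj'] at h1
        rw [h1]; simp
      exact_mod_cast h3
    have h4 := (Finset.sum_eq_zero_iff_of_nonneg fun l _ => by positivity).mp h2 l (Finset.mem_univ l)
    have h5 : Y i l = 0 := by simpa using h4
    simp [h5, hi]
  · have hi' : (d i : ℂ) ≠ 0 := Complex.ofReal_ne_zero.mpr hi
    rw [hb i hi]
    change _ = (d i : ℂ) * ((d i : ℂ)⁻¹ * Y i l)
    field_simp

end LinearAlgebra

variable {m N : ℕ} [NeZero m]

/-- The moduli of the diagonal blocks. -/
def modulus (α : Fin m → ℝ) (x : Fin N → ℝ) (k : Fin m) : Matrix (Fin N) (Fin N) ℂ :=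
  Matrix.diagonal fun j => (Real.sqrt (x j + α k) : ℂ)

/-- The unitary matrix `S` diagonalizes `X_k X_k†`. -/
def Diagonalizes (α : Fin m → ℝ) (X : Fin m → Matrix (Fin N) (Fin N) ℂ) (x : Fin N → ℝ) (k : Fin m)
    (S : U N) : Prop :=
  X k * (X k)ᴴ = S.1 * (Matrix.diagonal fun j => ((x j + α k : ℝ) : ℂ)) * S.1ᴴ

omit [NeZero m] in
theorem Diagonalizes.nonneg {α : Fin m → ℝ} {X : Fin m → Matrix (Fin N) (Fin N) ℂ} {x : Fin N → ℝ}
    {k : Fin m} {S : U N} (h : Diagonalizes α X x k S) (j : Fin N) : 0 ≤ x j + α k := by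
  have h1 : (S.1ᴴ * X k) * (S.1ᴴ * X k)ᴴ = Matrix.diagonal fun j => ((x j + α k : ℝ) : ℂ) := by
    rw [Matrix.conjTranspose_mul, Matrix.conjTranspose_conjTranspose, Matrix.mul_assoc,
      ← Matrix.mul_assoc (X k), h]
    simp only [Matrix.mul_assoc]
    rw [unitary_conjTranspose_mul, Matrix.mul_one, unitary_conjTranspose_mul_cancel]
  have h2 := congr_fun (congr_fun h1 j) j
  rw [Matrix.diagonal_apply_eq, Matrix.mul_apply] at h2
  simp only [Matrix.conjTranspose_apply, Complex.star_def, Complex.mul_conj'] at h2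
  have h3 : ∑ l, ‖(S.1ᴴ * X k) j l‖ ^ 2 = x j + α k := by exact_mod_cast h2
  rw [← h3]
  positivity

/-- `S† X_k` has orthogonal rows of squared lengths `x_j + α_k`, so it is the diagonal of moduli
times a unitary `V`, and `S' = V†` diagonalizes `X_k† X_k`. The commutator equation adds the scalar
`λ_{k+1} = α_{k+1} - α_k`, so the same `S'` diagonalizes `X_{k+1} X_{k+1}†` with the same `x_j`. -/
theorem Diagonalizes.exists_next {lam α : Fin m → ℝ} (hα : ∀ i, lam i = α i - α (i - 1))
    {X : Fin m → Matrix (Fin N) (Fin N) ℂ} (hX : blockCyclic X ∈ genNormal m N lam)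
    {x : Fin N → ℝ} {k : Fin m} {S : U N} (h : Diagonalizes α X x k S) :
    ∃ S' : U N, X k = S.1 * modulus α x k * S'.1ᴴ ∧ Diagonalizes α X x (k + 1) S' := by
  have h1 : (S.1ᴴ * X k) * (S.1ᴴ * X k)ᴴ =
      Matrix.diagonal fun j => ((Real.sqrt (x j + α k) : ℝ) : ℂ) ^ 2 := by
    rw [Matrix.conjTranspose_mul, Matrix.conjTranspose_conjTranspose, Matrix.mul_assoc,
      ← Matrix.mul_assoc (X k), h]
    simp only [Matrix.mul_assoc]
    rw [unitary_conjTranspose_mul, Matrix.mul_one, unitary_conjTranspose_mul_cancel]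
    congr 1
    funext j
    rw [← Complex.ofReal_pow, Real.sq_sqrt (h.nonneg j)]
  obtain ⟨V, hV⟩ := exists_eq_diagonal_mul_unitary h1
  have h2 : X k = S.1 * (modulus α x k * V.1) := by
    rw [modulus, ← hV, unitary_mul_conjTranspose_cancel]
  have hVinv : ((V⁻¹ : U N) : Matrix (Fin N) (Fin N) ℂ) = V.1ᴴ := rfl
  refine ⟨V⁻¹, by rw [hVinv, Matrix.conjTranspose_conjTranspose, h2, Matrix.mul_assoc], ?_⟩
  have h3 := (blockCyclic_mem_genNormal_iff X).mp hX (k + 1)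
  rw [add_sub_cancel_right, sub_eq_iff_eq_add] at h3
  have h4 : (X k)ᴴ * X k = V.1ᴴ * (Matrix.diagonal fun j => ((x j + α k : ℝ) : ℂ)) * V.1 := by
    have h5 : (modulus α x k)ᴴ * modulus α x k =
        Matrix.diagonal fun j => ((x j + α k : ℝ) : ℂ) := by
      rw [modulus, Matrix.diagonal_conjTranspose, Matrix.diagonal_mul_diagonal]
      congr 1
      funext j
      rw [Pi.star_apply, Complex.star_def, Complex.conj_ofReal, ← Complex.ofReal_mul,
        Real.mul_self_sqrt (h.nonneg j)]
    rw [h2, ← h5]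
    simp only [Matrix.conjTranspose_mul, Matrix.mul_assoc, unitary_conjTranspose_mul_cancel]
  have h6 : (Matrix.diagonal fun _ : Fin N => (lam (k + 1) : ℂ)) =
      V.1ᴴ * (Matrix.diagonal fun _ => (lam (k + 1) : ℂ)) * V.1 := by
    have : (Matrix.diagonal fun _ : Fin N => (lam (k + 1) : ℂ)) = (lam (k + 1) : ℂ) • 1 := by
      rw [Matrix.smul_one_eq_diagonal]
    rw [this, Matrix.mul_smul, Matrix.smul_mul, Matrix.mul_one, unitary_conjTranspose_mul]
  rw [Diagonalizes, h3, h4, h6, hVinv, Matrix.conjTranspose_conjTranspose, ← Matrix.add_mul,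
    ← Matrix.mul_add, Matrix.diagonal_add]
  congr 3
  funext j
  rw [hα, add_sub_cancel_right]
  push_cast
  ring

theorem exists_diagonalizes (α : Fin m → ℝ) (X : Fin m → Matrix (Fin N) (Fin N) ℂ) (k : Fin m) :
    ∃ (x : Fin N → ℝ) (S : U N), Diagonalizes α X x k S := by
  have hH : (X k * (X k)ᴴ).IsHermitian := Matrix.isHermitian_mul_conjTranspose_self _
  refine ⟨fun j => hH.eigenvalues j - α k, hH.eigenvectorUnitary, ?_⟩
  have h := hH.spectral_theorem
  rw [Unitary.conjStarAlgAut_apply] at h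
  rw [Diagonalizes]
  refine h.trans ?_
  congr 3
  funext j
  simp

theorem val_add_one_of_ne_zero {k : Fin m} (hk : k + 1 ≠ 0) : (k + 1).val = k.val + 1 := by
  refine Fin.val_add_one_of_lt' ?_
  by_contra hcon
  have h1 : k.val + 1 = m := by have := k.2; omega
  have h2 : Fin.ofNat m (k.val + 1) = k + 1 := by apply Fin.ext; simp [Fin.val_add]
  refine hk ?_
  rw [← h2, h1]
  apply Fin.ext
  simp

/-- The eigenbasis construction leaves the phase `Θ` in the last block, whereas `diagBlock` expects
it in block 0; the torus elements `u k` move it there. If some entry of the cycle is 0, then `z = 0`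
and `diagBlock` uses the argument 0, so the phase has to be absorbed in that vanishing entry. -/
theorem exists_gauge {α : Fin m → ℝ} {x : ℝ} (hx : ∀ k, 0 ≤ x + α k) (Θ : Circle) :
    ∃ u : Fin m → Circle, ∀ k, (u k : ℂ) * diagEntry α (chart α (x, Complex.arg Θ)) k *
      star (u (k + 1) : ℂ) =
        (Real.sqrt (x + α k) : ℂ) * (if k + 1 = 0 then (Θ : ℂ) else 1) := by
  have hΘ : (Θ : ℂ) * star (Θ : ℂ) = 1 := by simp [Complex.mul_conj]
  by_cases hz : ∀ k, 0 < x + α k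
  · have hexp : Complex.exp (Complex.arg (chart α (x, Complex.arg Θ)).1 * Complex.I) = Θ := by
      rw [exp_arg_chart hz]
      have := Complex.norm_mul_exp_arg_mul_I (Θ : ℂ)
      rwa [Circle.norm_coe, Complex.ofReal_one, one_mul] at this
    -- The jump from 1 to `Θ` between indices 0 and 1 cancels the phase of block 0; the jump back to
    -- 1 at the end of the cycle puts it in the last block.
    refine ⟨fun k => if k = 0 then 1 else Θ, fun k => ?_⟩
    simp only [diagEntry, hexp]
    change _ * ((Real.sqrt (x + α k) : ℂ) * _) * _ = _
    by_cases hk : k = 0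
    · subst hk
      by_cases hk' : (0 : Fin m) + 1 = 0
      · simp only [hk', if_true, Circle.coe_one, star_one]
        ring
      · simp only [hk', if_true, if_false, Circle.coe_one]
        linear_combination (Real.sqrt (x + α 0) : ℂ) * hΘ
    · by_cases hk' : k + 1 = 0
      · simp [hk, hk']
        ring
      · simp only [hk, hk', if_false]
        linear_combination (Real.sqrt (x + α k) : ℂ) * hΘ
  · push Not at hz
    obtain ⟨k₀, hk₀⟩ := hz
    have hzero : (chart α (x, Complex.arg Θ)).1 = 0 := by
      simp only [chart]
      rw [eval_Q, Finset.prod_eq_zero (Finset.mem_univ k₀) (le_antisymm hk₀ (hx k₀))]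
      simp
    -- The jump from 1 to `Θ` occurs across block `k₀`, where the entry is 0 and a phase has no
    -- effect.
    refine ⟨fun k => if k₀ < k then Θ else 1, fun k => ?_⟩
    simp only [diagEntry, hzero]
    change _ * ((Real.sqrt (x + α k) : ℂ) * _) * _ = _
    have harg : (if k = 0 then Complex.exp ((Complex.arg (0 : ℂ)) * Complex.I) else 1) = 1 := by
      simp
    rw [harg, mul_one]
    rcases lt_trichotomy k k₀ with hk | hk | hk
    · have h1 : (k + 1).val = k.val + 1 := Fin.val_add_one_of_lt' (by
        have := k₀.2
        have := Fin.lt_def.mp hk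
        omega)
      have h2 : ¬ k + 1 = 0 := fun h => by
        rw [h] at h1; simp at h1
      have h3 : ¬ k₀ < k + 1 := by
        rw [Fin.lt_def, h1]
        have := Fin.lt_def.mp hk
        omega
      simp [h2, h3, hk.not_gt]
    · subst hk
      rw [le_antisymm hk₀ (hx k)]
      simp
    · by_cases h2 : k + 1 = 0
      · simp [h2, hk]
        ring
      · have h1 := val_add_one_of_ne_zero h2
        have h3 : k₀ < k + 1 := by
          rw [Fin.lt_def, h1]
          have := Fin.lt_def.mp hk
          omega
        simp only [h2, h3, hk, if_true, if_false]
        linear_combination (Real.sqrt (x + α k) : ℂ) * hΘ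

/-- The sequence is indexed by `ℕ` and not by `Fin m`: after one turn, `S m` diagonalizes the same
matrix as `S 0` without having to be equal to it. -/
theorem exists_diagonalizes_sequence {lam α : Fin m → ℝ} (hα : ∀ i, lam i = α i - α (i - 1))
    {X : Fin m → Matrix (Fin N) (Fin N) ℂ} (hX : blockCyclic X ∈ genNormal m N lam) :
    ∃ (x : Fin N → ℝ) (S : ℕ → U N), ∀ n, Diagonalizes α X x (Fin.ofNat m n) (S n) ∧
      X (Fin.ofNat m n) = (S n).1 * modulus α x (Fin.ofNat m n) * (S (n + 1)).1ᴴ := by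
  obtain ⟨x, S₀, hS₀⟩ := exists_diagonalizes α X 0
  have hn (n : ℕ) : Fin.ofNat m (n + 1) = Fin.ofNat m n + 1 := by
    apply Fin.ext
    simp [Fin.val_add]
  have hnext (n : ℕ) (S : {S : U N // Diagonalizes α X x (Fin.ofNat m n) S}) :
      ∃ S' : {S : U N // Diagonalizes α X x (Fin.ofNat m (n + 1)) S},
        X (Fin.ofNat m n) = S.1.1 * modulus α x (Fin.ofNat m n) * S'.1.1ᴴ := by
    obtain ⟨S', h1, h2⟩ := S.2.exists_next hα hX
    exact ⟨⟨S', by rwa [hn]⟩, h1⟩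
  choose next hnext' using hnext
  let seq : (n : ℕ) → {S : U N // Diagonalizes α X x (Fin.ofNat m n) S} := fun n =>
    Nat.rec ⟨S₀, hS₀⟩ (fun n S => next n S) n
  exact ⟨x, fun n => (seq n).1, fun n => ⟨(seq n).2, hnext' n (seq n)⟩⟩

omit [NeZero m] in
theorem commute_diagonal_of_pos_mul {x : Fin N → ℝ} {c : ℝ} {R : Matrix (Fin N) (Fin N) ℂ}
    (h : R * (Matrix.diagonal fun j => ((x j + c : ℝ) : ℂ)) =
      (Matrix.diagonal fun j => ((x j + c : ℝ) : ℂ)) * R) :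
    R * (Matrix.diagonal fun j => (x j : ℂ)) = (Matrix.diagonal fun j => (x j : ℂ)) * R := by
  ext i j
  have := congr_fun (congr_fun h i) j
  rw [Matrix.mul_diagonal, Matrix.diagonal_mul] at this ⊢
  push_cast at this
  linear_combination this

/-- A unitary matrix which commutes with a real diagonal matrix is diagonalized together with it. -/
theorem exists_unitary_diagonalizing (x : Fin N → ℝ) (R : U N)
    (h : R.1 * (Matrix.diagonal fun j => (x j : ℂ)) = (Matrix.diagonal fun j => (x j : ℂ)) * R.1) :
    ∃ (W : U N) (σ : Equiv.Perm (Fin N)) (Θ : Fin N → Circle),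
      (∀ i j, W.1 i j ≠ 0 → x i = x (σ j)) ∧ R * W = W * diagU N Θ := by
  set D : Matrix (Fin N) (Fin N) ℂ := Matrix.diagonal fun j => (x j : ℂ) with hD
  have hDH : Dᴴ = D := by
    rw [hD, Matrix.diagonal_conjTranspose]
    congr 1
    funext j
    simp
  have h' : R.1ᴴ * D = D * R.1ᴴ := by
    have := congr_arg Matrix.conjTranspose h
    rw [Matrix.conjTranspose_mul, Matrix.conjTranspose_mul, hDH] at this
    exact this.symm
  have hR : R.1ᴴ * R.1 = R.1 * R.1ᴴ := by
    rw [unitary_conjTranspose_mul, unitary_mul_conjTranspose]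
  -- The unitary `R` is replaced by the two Hermitian matrices `R + R†` and `i (R - R†)`, which
  -- commute with each other and with `D`.
  obtain ⟨W, d, hd⟩ := exists_unitary_joint_diagonalization
    ![D, R.1 + R.1ᴴ, Complex.I • (R.1 - R.1ᴴ)] (by
      intro i
      fin_cases i
      · exact hDH
      · change (R.1 + R.1ᴴ)ᴴ = _
        rw [Matrix.conjTranspose_add, Matrix.conjTranspose_conjTranspose, add_comm]; rfl
      · change (Complex.I • (R.1 - R.1ᴴ))ᴴ = Complex.I • (R.1 - R.1ᴴ)
        rw [Matrix.conjTranspose_smul, Matrix.conjTranspose_sub, Matrix.conjTranspose_conjTranspose,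
          ← neg_sub R.1, smul_neg]
        simp) (by
      have c1 : D * (R.1 + R.1ᴴ) = (R.1 + R.1ᴴ) * D := by
        rw [Matrix.mul_add, Matrix.add_mul, h, h']
      have c2 : D * (Complex.I • (R.1 - R.1ᴴ)) = (Complex.I • (R.1 - R.1ᴴ)) * D := by
        rw [Matrix.mul_smul, Matrix.smul_mul, Matrix.mul_sub, Matrix.sub_mul, h, h']
      have c3 : (R.1 + R.1ᴴ) * (Complex.I • (R.1 - R.1ᴴ)) =
          (Complex.I • (R.1 - R.1ᴴ)) * (R.1 + R.1ᴴ) := by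
        rw [Matrix.mul_smul, Matrix.smul_mul]
        congr 1
        simp only [Matrix.mul_sub, Matrix.sub_mul, Matrix.add_mul, Matrix.mul_add, hR]
        abel
      intro i j
      fin_cases i <;> fin_cases j <;>
        first | rfl | exact c1 | exact c1.symm | exact c2 | exact c2.symm | exact c3 | exact c3.symm)
  obtain ⟨σ, hσ⟩ := exists_perm_apply_ne_zero W
  have hx (i j : Fin N) : (x i : ℂ) * W.1 i j = W.1 i j * d 0 j := by
    have := congr_fun (congr_fun (hd 0) i) j
    rw [Matrix.mul_diagonal] at this
    rw [← this]
    change _ = (D * W.1) i j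
    rw [hD, Matrix.diagonal_mul]
  have hx' (i j : Fin N) (hij : W.1 i j ≠ 0) : (x i : ℂ) = d 0 j := by
    have := hx i j
    rw [mul_comm] at this
    exact mul_left_cancel₀ hij this
  -- The eigenvalues of `R = ((R + R†) - i · i (R - R†)) / 2`.
  set ρ : Fin N → ℂ := fun j => (d 1 j - Complex.I * d 2 j) / 2 with hρ
  have hRW : R.1 * W.1 = W.1 * Matrix.diagonal ρ := by
    have e1 : (R.1 + R.1ᴴ) * W.1 = W.1 * Matrix.diagonal (d 1) := hd 1
    have e2 : (Complex.I • (R.1 - R.1ᴴ)) * W.1 = W.1 * Matrix.diagonal (d 2) := hd 2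
    rw [Matrix.smul_mul] at e2
    ext i j
    have f1 := congr_fun (congr_fun e1 i) j
    have f2 := congr_fun (congr_fun e2 i) j
    rw [Matrix.add_mul, Matrix.add_apply, Matrix.mul_diagonal] at f1
    rw [Matrix.smul_apply, Matrix.sub_mul, Matrix.sub_apply, Matrix.mul_diagonal, smul_eq_mul] at f2
    rw [Matrix.mul_diagonal, hρ]
    linear_combination f1 / 2 - Complex.I / 2 * f2 +
      (((R.1 * W.1) i j - (R.1ᴴ * W.1) i j) / 2) * Complex.I_mul_I
  have hρ1 : ((W⁻¹ * (R * W) : U N) : Matrix (Fin N) (Fin N) ℂ) = Matrix.diagonal ρ := by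
    change W.1ᴴ * (R.1 * W.1) = _
    rw [hRW, unitary_conjTranspose_mul_cancel]
  have hnorm (j : Fin N) : ‖ρ j‖ = 1 := by
    have h1 := congr_fun (congr_fun (unitary_mul_conjTranspose (W⁻¹ * (R * W))) j) j
    rw [hρ1, Matrix.diagonal_conjTranspose, Matrix.diagonal_mul_diagonal, Matrix.diagonal_apply_eq,
      Matrix.one_apply_eq, Pi.star_apply, Complex.star_def, Complex.mul_conj'] at h1
    exact (pow_eq_one_iff_of_nonneg (norm_nonneg _) two_ne_zero).mp (by exact_mod_cast h1)
  refine ⟨W, σ, fun j => ⟨ρ j, by simpa [Submonoid.unitSphere] using hnorm j⟩, fun i j hij => ?_, ?_⟩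
  · have := (hx' i j hij).trans (hx' (σ j) j (hσ j)).symm
    exact_mod_cast this
  · rw [← inv_mul_eq_iff_eq_mul]
    exact Subtype.ext hρ1

/-- Every generalized normal matrix has coordinates. -/
theorem exists_orbitPoint_eq {lam α : Fin m → ℝ} (hα : ∀ i, lam i = α i - α (i - 1))
    {A : BlockMat m N} (hA : A ∈ genNormal m N lam) :
    ∃ p : Fin N → ℂ × ℝ, (∀ j, p j ∈ surface α) ∧ ∃ S, orbitPoint α p S = A := by
  obtain ⟨X, rfl⟩ := exists_eq_blockCyclic hA
  obtain ⟨x, S, hS⟩ := exists_diagonalizes_sequence hα hA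
  have hm : Fin.ofNat m m = 0 := by apply Fin.ext; simp
  have hofNat (k : Fin m) : Fin.ofNat m k.val = k := by apply Fin.ext; simp
  have hnonneg (j : Fin N) (k : Fin m) : 0 ≤ x j + α k := by
    have := (hS k.val).1.nonneg j
    rwa [hofNat] at this
  -- The holonomy of one turn. Both `S 0` and `S m` diagonalize `X_0 X_0†`, so it commutes with the
  -- diagonal of the `x_j`.
  set R : U N := (S m)⁻¹ * S 0 with hR
  have hcomm : R.1 * (Matrix.diagonal fun j => ((x j + α 0 : ℝ) : ℂ)) =
      (Matrix.diagonal fun j => ((x j + α 0 : ℝ) : ℂ)) * R.1 := by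
    have h0 : Diagonalizes α X x 0 (S 0) := (hS 0).1
    have h1 : Diagonalizes α X x 0 (S m) := by
      have := (hS m).1
      rwa [hm] at this
    have h2 := h0.symm.trans h1
    change (S m).1ᴴ * (S 0).1 * _ = _ * ((S m).1ᴴ * (S 0).1)
    have h3 := congr_arg (fun M => (S m).1ᴴ * M * (S 0).1) h2
    simpa only [Matrix.mul_assoc, unitary_conjTranspose_mul, Matrix.mul_one,
      unitary_conjTranspose_mul_cancel] using h3
  obtain ⟨W, σ, Θ, hW, hRW⟩ := exists_unitary_diagonalizing x R (commute_diagonal_of_pos_mul hcomm)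
  have hmod (k : Fin m) : modulus α x k * W.1 = W.1 * modulus α (x ∘ σ) k := by
    ext i j
    rw [modulus, modulus, Matrix.diagonal_mul, Matrix.mul_diagonal]
    by_cases hij : W.1 i j = 0
    · simp [hij]
    · rw [hW i j hij, mul_comm]; rfl
  set T : ℕ → U N := fun n => S n * W with hT
  have hXT (n : ℕ) : X (Fin.ofNat m n) = (T n).1 * modulus α (x ∘ σ) (Fin.ofNat m n) * (T (n + 1)).1ᴴ := by
    change _ = (S n).1 * W.1 * _ * ((S (n + 1)).1 * W.1)ᴴ
    rw [(hS n).2, Matrix.conjTranspose_mul, Matrix.mul_assoc (S n).1 W.1, ← hmod]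
    simp only [Matrix.mul_assoc, unitary_mul_conjTranspose_cancel]
  -- In eigenbases adapted to the holonomy, the cycle closes up to the diagonal phases `Θ`, which
  -- thus appear in the last block only.
  have hTm : T 0 = T m * diagU N Θ := by
    simp only [hT]
    rw [mul_assoc, ← hRW, hR]
    group
  choose u hu using fun j => exists_gauge (fun k => hnonneg (σ j) k) (Θ j)
  refine ⟨fun j => chart α ((x ∘ σ) j, Complex.arg (Θ j)),
    fun j => chart_mem_surface (fun k => hnonneg (σ j) k) _,
    fun k => T k.val * diagU N fun j => u j k, ?_⟩
  unfold orbitPoint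
  congr 1
  funext k
  have hdiag (t : Fin N → Circle) : (diagU N t).1 = Matrix.diagonal fun j => (t j : ℂ) := rfl
  have hcore : (diagU N fun j => u j k).1 *
      diagBlock α (fun j => chart α ((x ∘ σ) j, Complex.arg (Θ j))) k *
      (diagU N fun j => u j (k + 1)).1ᴴ = modulus α (x ∘ σ) k *
        Matrix.diagonal fun j => if k + 1 = 0 then (Θ j : ℂ) else 1 := by
    rw [hdiag, hdiag, diagBlock_eq, Matrix.diagonal_conjTranspose, Matrix.diagonal_mul_diagonal,
      Matrix.diagonal_mul_diagonal, modulus, Matrix.diagonal_mul_diagonal]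
    congr 1
    funext j
    exact hu j k
  have hlast : X k = (T k.val).1 * (modulus α (x ∘ σ) k *
      Matrix.diagonal fun j => if k + 1 = 0 then (Θ j : ℂ) else 1) * (T (k + 1).val).1ᴴ := by
    have h1 := hXT k.val
    rw [hofNat] at h1
    rw [h1]
    by_cases hk : k + 1 = 0
    · have hk' : k.val + 1 = m := by
        by_contra hcon
        have h2 := Fin.val_add_one_of_lt' (i := k) (by have := k.2; omega)
        rw [hk] at h2
        simp at h2
      rw [hk']
      simp only [hk, if_true]
      change _ = _ * ((modulus α (x ∘ σ) k) * (diagU N Θ).1) * (T 0).1ᴴ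
      rw [hTm]
      change _ = _ * ((modulus α (x ∘ σ) k) * (diagU N Θ).1) * ((T m).1 * (diagU N Θ).1)ᴴ
      simp only [Matrix.conjTranspose_mul, Matrix.mul_assoc, unitary_mul_conjTranspose_cancel]
    · have hk' := val_add_one_of_ne_zero hk
      rw [hk']
      simp only [hk, if_false, Matrix.diagonal_one, Matrix.mul_one]
  rw [hlast, ← hcore]
  change (T k.val).1 * (diagU N fun j => u j k).1 * _ *
    ((T (k + 1).val).1 * (diagU N fun j => u j (k + 1)).1)ᴴ = _
  simp only [Matrix.conjTranspose_mul, Matrix.mul_assoc]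

end

section

/-! ### Integration over the unitary groups in the chart -/

/-! ### Densities and images of finite powers of a measure. -/

section Pi

variable {β γ : Type*} [MeasurableSpace β] [MeasurableSpace γ]

theorem lintegral_pi_succ (κ : Measure β) [SigmaFinite κ] (n : ℕ) {f : (Fin (n + 1) → β) → ℝ≥0∞}
    (hf : Measurable f) : ∫⁻ h, f h ∂Measure.pi (fun _ => κ) =
      ∫⁻ a, ∫⁻ b, f (Fin.cons a b) ∂Measure.pi (fun _ : Fin n => κ) ∂κ := by
  have h := (measurePreserving_piFinSuccAbove (fun _ : Fin (n + 1) => κ) 0).symm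
  rw [← h.lintegral_comp hf]
  refine (lintegral_prod _ (hf.comp h.measurable).aemeasurable).trans ?_
  simp [MeasurableEquiv.piFinSuccAbove_symm_apply, Fin.insertNthEquiv, Fin.insertNth_zero']

theorem measurable_finCons {n : ℕ} :
    Measurable fun p : β × (Fin n → β) => (Fin.cons p.1 p.2 : Fin (n + 1) → β) := by
  refine measurable_pi_lambda _ fun i => ?_
  refine Fin.cases ?_ (fun i => ?_) i
  · simpa using measurable_fst
  · simp only [Fin.cons_succ]
    exact (measurable_pi_apply i).comp measurable_snd

theorem lintegral_pi_withDensity (κ : Measure β) [SigmaFinite κ] {ρ : β → ℝ≥0∞} (hρ : Measurable ρ)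
    [SigmaFinite (κ.withDensity ρ)] (n : ℕ) {f : (Fin n → β) → ℝ≥0∞} (hf : Measurable f) :
    ∫⁻ h, f h ∂Measure.pi (fun _ => κ.withDensity ρ) =
      ∫⁻ h, (∏ k, ρ (h k)) * f h ∂Measure.pi (fun _ => κ) := by
  induction n with
  | zero =>
    rw [Measure.pi_of_empty (fun _ : Fin 0 => κ.withDensity ρ),
      Measure.pi_of_empty (fun _ : Fin 0 => κ)]
    simp
  | succ n ih =>
    have hprod (n : ℕ) : Measurable fun h : Fin n → β => ∏ k, ρ (h k) :=
      Finset.measurable_prod _ fun k _ => hρ.comp (measurable_pi_apply k)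
    rw [lintegral_pi_succ _ _ hf,
      lintegral_pi_succ κ n (f := fun h => (∏ k, ρ (h k)) * f h) ((hprod _).mul hf)]
    have hmeas : Measurable fun p : β × (Fin n → β) => f (Fin.cons p.1 p.2) :=
      hf.comp measurable_finCons
    have h1 (a : β) : ∫⁻ b, f (Fin.cons a b) ∂Measure.pi (fun _ : Fin n => κ.withDensity ρ) =
        ∫⁻ b, (∏ k, ρ (b k)) * f (Fin.cons a b) ∂Measure.pi (fun _ : Fin n => κ) :=
      ih (hmeas.comp measurable_prodMk_left)
    simp only [h1]
    have hm2 : Measurable fun a => ∫⁻ b, (∏ k, ρ (b k)) * f (Fin.cons a b)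
        ∂Measure.pi (fun _ : Fin n => κ) :=
      Measurable.lintegral_prod_right' (((hprod n).comp measurable_snd).mul hmeas)
    rw [lintegral_withDensity_eq_lintegral_mul _ hρ hm2]
    refine lintegral_congr fun a => ?_
    rw [Pi.mul_apply, ← lintegral_const_mul (f := fun b => (∏ k, ρ (b k)) * f (Fin.cons a b)) _
      ((hprod n).mul (hmeas.comp measurable_prodMk_left))]
    refine lintegral_congr fun b => ?_
    rw [Fin.prod_univ_succ]
    simp [mul_assoc]

theorem map_pi_of_map {n : ℕ} (κ : Measure β) (K : Measure γ) [SigmaFinite κ] [SigmaFinite K]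
    {g : β → γ} (hg : Measurable g) (h : Measure.map g κ = K) :
    Measure.map (fun b (k : Fin n) => g (b k)) (Measure.pi fun _ => κ) = Measure.pi fun _ => K := by
  subst h
  exact Measure.pi_map_pi (μ := fun _ : Fin n => κ) (f := fun _ => g) fun _ => hg.aemeasurable

end Pi

variable {m N : ℕ}

/-- The volume of the unitary group in the chart. -/
def chartMeasure (N : ℕ) : Measure (RMat N) :=
  (volume.restrict (chartDomain N)).withDensity fun h => ENNReal.ofReal (chartDensity h)

theorem map_chartU_chartMeasure (N : ℕ) :
    Measure.map chartU (chartMeasure N) = (volumeU N).restrict (chartImage N) :=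
  map_chartU_eq_restrict N

instance : IsFiniteMeasure (chartMeasure N) := ⟨by
  have h := congr_arg (fun μ => μ Set.univ) (map_chartU_chartMeasure N)
  simp only [Measure.restrict_apply_univ] at h
  rw [Measure.map_apply continuous_chartU.measurable MeasurableSet.univ, Set.preimage_univ] at h
  rw [h]
  exact volumeU_chartImage_lt_top N⟩

theorem volumeU_image_mul_right (g : U N) (s : Set (U N)) :
    volumeU N ((fun h => h * g) '' s) = volumeU N s := by
  rw [volumeU_apply, volumeU_apply]
  set τ : MatSpace (Fin N) → MatSpace (Fin N) := fun x =>
    toSpace ((Matrix.of fun a b => x (a, b)) * (g : Matrix (Fin N) (Fin N) ℂ)) with hτ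
  have hiso : Isometry τ := isometry_of_frob (fun M => M * (g : Matrix (Fin N) (Fin N) ℂ))
    (fun M => rfl) (fun M M' => (Matrix.sub_mul _ _ _).symm) (fun M => frob_mul_unitary g.2 M)
  rw [← hiso.euclideanHausdorffMeasure_image (unitaryToSpace '' s), Set.image_image, Set.image_image]
  rfl

instance : (volumeU N).IsMulRightInvariant := by
  refine ⟨fun g => ?_⟩
  ext s hs
  rw [Measure.map_apply (measurable_mul_const g) hs, ← volumeU_image_mul_right g,
    Set.image_preimage_eq _ (Group.mulRight_bijective g).surjective]

theorem map_mul_diagU_restrict (t : Fin N → Circle) :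
    Measure.map (fun S => S * diagU N t) ((volumeU N).restrict (chartImage N)) =
      (volumeU N).restrict (chartImage N) := by
  have hpre : (fun S : U N => S * diagU N t) ⁻¹' chartImage N = chartImage N := by
    ext g
    exact mul_diagU_mem_chartImage_iff t
  conv_lhs => rw [← hpre]
  rw [← Measure.restrict_map (measurable_mul_const _) (measurableSet_chartImage N),
    map_mul_right_eq_self]

/-- The cube `[0, 2π)^N`. -/
def angleCube (N : ℕ) : Set (Fin N → ℝ) := Set.univ.pi fun _ => Set.Ico 0 (2 * Real.pi)

theorem measurableSet_angleCube (N : ℕ) : MeasurableSet (angleCube N) :=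
  MeasurableSet.univ_pi fun _ => measurableSet_Ico

theorem volume_angleCube (N : ℕ) : volume (angleCube N) = ENNReal.ofReal ((2 * Real.pi) ^ N) := by
  rw [angleCube, volume_pi_pi]
  simp only [Real.volume_Ico, sub_zero, Finset.prod_const, Finset.card_univ, Fintype.card_fin]
  rw [ENNReal.ofReal_pow Real.two_pi_pos.le]

/-- The exchange of the diagonal of a matrix with a vector. -/
def swapDiag (N : ℕ) : (RMat N × (Fin N → ℝ)) ≃ₗ[ℝ] (RMat N × (Fin N → ℝ)) where
  toFun q := (fun a b => if a = b then q.2 a else q.1 a b, fun j => q.1 j j)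
  map_add' q q' := by
    ext a b
    · simp only [Prod.fst_add, Prod.snd_add, Pi.add_apply, Prod.mk_add_mk]
      split_ifs <;> rfl
    · rfl
  map_smul' c q := by
    ext a b
    · simp only [Prod.smul_fst, Prod.smul_snd, Pi.smul_apply, Prod.smul_mk, RingHom.id_apply]
      split_ifs <;> rfl
    · rfl
  invFun q := (fun a b => if a = b then q.2 a else q.1 a b, fun j => q.1 j j)
  left_inv q := by
    ext a b
    · by_cases h : a = b <;> simp [h]
    · simp
  right_inv q := by
    ext a b
    · by_cases h : a = b <;> simp [h]
    · simp

theorem offDiag_swapDiag (q : RMat N × (Fin N → ℝ)) :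
    offDiag (swapDiag N q).1 = offDiag q.1 := by
  funext a b
  by_cases h : a = b <;> simp [offDiag, swapDiag, h]

theorem measurePreserving_swapDiag (N : ℕ) : MeasurePreserving
    ((swapDiag N).toContinuousLinearEquiv) (volume : Measure (RMat N × (Fin N → ℝ))) volume := by
  have : (volume : Measure (RMat N × (Fin N → ℝ))).IsAddHaarMeasure := by
    have := isAddHaarMeasure_volume_pi (ι := Fin N) (A := Fin N → ℝ)
    exact isAddHaarMeasure_volume_prod
  have hvol : (volume : Measure (RMat N × (Fin N → ℝ)))
      ((Set.univ.pi fun _ => Set.univ.pi fun _ => Set.Icc (0 : ℝ) 1) ×ˢ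
        (Set.univ.pi fun _ => Set.Icc (0 : ℝ) 1)) = 1 := by
    rw [Measure.volume_eq_prod, Measure.prod_prod]
    simp only [volume_pi_pi, Real.volume_Icc]
    simp
  refine measurePreserving_of_measure_eq _ _ _ _ ?_ (hvol.trans_ne one_ne_zero)
    (hvol.trans_ne ENNReal.one_ne_top) ?_
  · exact (MeasurableSet.univ_pi fun _ => MeasurableSet.univ_pi fun _ => measurableSet_Icc).prod
      (MeasurableSet.univ_pi fun _ => measurableSet_Icc)
  · congr 1
    ext q
    simp only [Set.mem_preimage, Set.mem_prod, Set.mem_univ_pi]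
    constructor
    · rintro ⟨h1, h2⟩
      refine ⟨fun a b => ?_, fun j => by simpa [swapDiag] using h1 j j⟩
      by_cases hab : a = b
      · subst hab; exact h2 a
      · simpa [swapDiag, hab] using h1 a b
    · rintro ⟨h1, h2⟩
      refine ⟨fun a b => ?_, fun j => h1 j j⟩
      by_cases hab : a = b
      · simpa [swapDiag, hab] using h2 b
      · simpa [swapDiag, hab] using h1 a b

/-- The angles and the diagonal coordinates range over the same cube and `chartDensity` ignores the
diagonal, so the exchange preserves both the domain and the density. -/
theorem lintegral_swapDiag {f : RMat N × (Fin N → ℝ) → ℝ≥0∞} (hf : Measurable f) :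
    ∫⁻ h, (∫⁻ θ in angleCube N, f (h, θ)) ∂chartMeasure N =
      ∫⁻ h, (∫⁻ θ in angleCube N, f (swapDiag N (h, θ))) ∂chartMeasure N := by
  have hρ : Measurable fun h : RMat N => ENNReal.ofReal (chartDensity h) :=
    continuous_chartDensity.measurable.ennreal_ofReal
  have key {f : RMat N × (Fin N → ℝ) → ℝ≥0∞} (hf : Measurable f) :
      ∫⁻ h, (∫⁻ θ in angleCube N, f (h, θ)) ∂chartMeasure N =
        ∫⁻ q in chartDomain N ×ˢ angleCube N, ENNReal.ofReal (chartDensity q.1) * f q := by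
    have hm : Measurable fun h => ∫⁻ θ in angleCube N, f (h, θ) :=
      hf.lintegral_prod_right'
    rw [chartMeasure, lintegral_withDensity_eq_lintegral_mul _ hρ hm, Measure.volume_eq_prod,
      ← Measure.prod_restrict, lintegral_prod (fun q => ENNReal.ofReal (chartDensity q.1) * f q)
        ((hρ.comp measurable_fst).mul hf).aemeasurable]
    refine lintegral_congr fun h => ?_
    exact (lintegral_const_mul _ (hf.comp measurable_prodMk_left)).symm
  have hsw : Measurable (swapDiag N) := (measurePreserving_swapDiag N).measurable
  rw [key hf, key (f := fun q => f (swapDiag N q)) (hf.comp hsw),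
    ← (measurePreserving_swapDiag N).setLIntegral_comp_preimage
    ((measurableSet_chartDomain N).prod (measurableSet_angleCube N))
    (f := fun q => ENNReal.ofReal (chartDensity q.1) * f q) ((hρ.comp measurable_fst).mul hf)]
  have hpre : ((swapDiag N).toContinuousLinearEquiv) ⁻¹' (chartDomain N ×ˢ angleCube N) =
      chartDomain N ×ˢ angleCube N := by
    ext q
    have h1 : (swapDiag N q).1 ∈ chartDomain N ↔ ‖offDiag q.1‖ < chartRadius N ∧ q.2 ∈ angleCube N := by
      rw [chartDomain, Set.mem_ofPred_eq, offDiag_swapDiag, angleCube, Set.mem_univ_pi]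
      simp [swapDiag]
    have h2 : (swapDiag N q).2 ∈ angleCube N ↔ ∀ j, q.1 j j ∈ Set.Ico 0 (2 * Real.pi) := by
      rw [angleCube, Set.mem_univ_pi]
      rfl
    change (swapDiag N q).1 ∈ chartDomain N ∧ (swapDiag N q).2 ∈ angleCube N ↔
      q.1 ∈ chartDomain N ∧ q.2 ∈ angleCube N
    rw [h1, h2, chartDomain, Set.mem_ofPred_eq]
    tauto
  rw [hpre]
  refine lintegral_congr fun q => ?_
  have h3 : chartDensity (swapDiag N q).1 = chartDensity q.1 := by
    rw [← chartDensity_offDiag, offDiag_swapDiag, chartDensity_offDiag]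
  change ENNReal.ofReal (chartDensity (swapDiag N q).1) * f (swapDiag N q) = _
  rw [h3]

/-- Integration of a function of the angles `θ` and of `S ∈ U(N)^m` which is invariant under the
diagonal torus: the angles can be put in the diagonal of the coordinates of `S`. -/
theorem lintegral_angles [NeZero m] {H : (Fin N → ℝ) × (Fin m → U N) → ℝ≥0∞} (hH : Measurable H)
    (hinv : ∀ θ S t, H (θ, fun k => S k * diagU N t) = H (θ, S)) :
    ∫⁻ θ in angleCube N, ∫⁻ S, H (θ, S)
        ∂Measure.pi (fun _ : Fin m => (volumeU N).restrict (chartImage N)) =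
      ENNReal.ofReal ((2 * Real.pi) ^ N) *
        ∫⁻ h, H (fun j => h 0 j j, paramU h) ∂Measure.pi (fun _ : Fin m => chartMeasure N) := by
  obtain ⟨n, rfl⟩ : ∃ n, m = n + 1 := Nat.exists_eq_succ_of_ne_zero (NeZero.ne m)
  set K := (volumeU N).restrict (chartImage N) with hK
  have hc : Measurable (chartU (N := N)) := continuous_chartU.measurable
  have hcay : Measurable (cayleyU (N := N)) := continuous_cayleyU.measurable
  have hKmap : Measure.map chartU (chartMeasure N) = K := map_chartU_chartMeasure N
  set L : RMat N × (Fin N → ℝ) → ℝ≥0∞ := fun q =>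
    ∫⁻ S, H (q.2, Fin.cons (cayleyU q.1) S) ∂Measure.pi (fun _ : Fin n => K) with hL
  have hLm : Measurable L := by
    refine Measurable.lintegral_prod_right' (f := fun p : (RMat N × (Fin N → ℝ)) × (Fin n → U N) =>
      H (p.1.2, Fin.cons (cayleyU p.1.1) p.2)) (hH.comp ?_)
    exact (measurable_snd.comp measurable_fst).prodMk (measurable_finCons.comp
      ((hcay.comp (measurable_fst.comp measurable_fst)).prodMk measurable_snd))
  have hHθ (θ : Fin N → ℝ) : Measurable fun S : Fin (n + 1) → U N => H (θ, S) :=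
    hH.comp measurable_prodMk_left
  have hHc (θ : Fin N → ℝ) (g : U N) : Measurable fun S : Fin n → U N => H (θ, Fin.cons g S) :=
    (hHθ θ).comp (measurable_finCons.comp measurable_prodMk_left)
  -- the integral over `S`
  have h1 (θ : Fin N → ℝ) : ∫⁻ S, H (θ, S) ∂Measure.pi (fun _ : Fin (n + 1) => K) =
      ∫⁻ h, L (h, θ) ∂chartMeasure N := by
    have hm : Measurable fun g : U N => ∫⁻ S, H (θ, Fin.cons g S) ∂Measure.pi (fun _ : Fin n => K) :=
      Measurable.lintegral_prod_right' (f := fun p : U N × (Fin n → U N) =>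
        H (θ, Fin.cons p.1 p.2)) ((hHθ θ).comp measurable_finCons)
    rw [lintegral_pi_succ _ _ (hHθ θ), ← hKmap, lintegral_map (by rw [hKmap]; exact hm) hc]
    refine lintegral_congr fun h => ?_
    rw [hKmap]
    -- The phases of the factor of index 0 are also multiplied into the other factors, which their
    -- measures allow by right invariance; invariance of `H` under the torus then drops them,
    -- leaving the bare Cayley transform.
    have hmap : Measure.map (fun (S : Fin n → U N) k => S k * diagU N (phase h))
        (Measure.pi fun _ => K) = Measure.pi fun _ => K :=
      map_pi_of_map K K (measurable_mul_const _) (map_mul_diagU_restrict _)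
    have hmeas : Measurable fun (S : Fin n → U N) k => S k * diagU N (phase h) :=
      measurable_pi_lambda _ fun k => (measurable_mul_const _).comp (measurable_pi_apply k)
    change _ = ∫⁻ S, H (θ, Fin.cons (cayleyU h) S) ∂Measure.pi (fun _ : Fin n => K)
    rw [← hmap, lintegral_map (hHc _ _) hmeas, hmap]
    refine lintegral_congr fun S => ?_
    rw [← hinv θ (Fin.cons (cayleyU h) S) (phase h)]
    congr 2
    funext k
    refine Fin.cases ?_ (fun k => ?_) k
    · rfl
    · rfl
  simp only [h1]
  rw [lintegral_lintegral_swap (f := fun θ h => L (h, θ)) (hLm.comp measurable_swap).aemeasurable,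
    lintegral_swapDiag hLm]
  -- `L` sees its matrix argument only through the Cayley transform, so after the exchange nothing
  -- depends on `θ`, and the integral over the cube gives `(2π)^N`.
  have h2 (h : RMat N) (θ : Fin N → ℝ) : L (swapDiag N (h, θ)) = L (h, fun j => h j j) := by
    have : cayleyU (swapDiag N (h, θ)).1 = cayleyU h := by
      rw [← cayleyU_offDiag, offDiag_swapDiag, cayleyU_offDiag]
    simp only [hL, this]
    rfl
  simp only [h2, setLIntegral_const, volume_angleCube]
  rw [lintegral_mul_const (f := fun h => L (h, fun j => h j j)) _
    (hLm.comp (measurable_id.prodMk (by fun_prop))), mul_comm]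
  congr 1
  -- the integral over the coordinates
  have hpU : Measurable fun h : Fin (n + 1) → RMat N => (paramU h : Fin (n + 1) → U N) := by
    refine measurable_pi_lambda _ fun k => ?_
    unfold paramU
    split_ifs
    · exact hcay.comp (measurable_pi_apply _)
    · exact hc.comp (measurable_pi_apply _)
  have hm : Measurable fun h : Fin (n + 1) → RMat N => H (fun j => h 0 j j, paramU h) :=
    hH.comp ((by fun_prop : Measurable fun h : Fin (n + 1) → RMat N => fun j => h 0 j j).prodMk hpU)
  rw [lintegral_pi_succ _ _ hm]
  refine lintegral_congr fun h => ?_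
  have hmap := map_pi_of_map (n := n) (chartMeasure N) K hc hKmap
  have hmeas : Measurable fun (b : Fin n → RMat N) k => chartU (b k) :=
    measurable_pi_lambda _ fun k => hc.comp (measurable_pi_apply k)
  change ∫⁻ S, H (fun j => h j j, Fin.cons (cayleyU h) S) ∂Measure.pi (fun _ : Fin n => K) = _
  rw [← hmap, lintegral_map (hHc _ _) hmeas]
  refine lintegral_congr fun b => ?_
  congr 2
  funext k
  refine Fin.cases ?_ (fun k => ?_) k
  · simp [paramU]
  · simp [paramU, Fin.succ_ne_zero]

end

section

/-! ### The volume of the generalized normal matrices near the identity of the group -/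

variable {m N : ℕ}

theorem continuous_chart (α : Fin m → ℝ) : Continuous (chart α) := by
  unfold chart
  refine Continuous.prodMk (Continuous.mul ?_ (by fun_prop)) (by fun_prop)
  exact Complex.continuous_ofReal.comp
    (Real.continuous_sqrt.comp ((Q α).continuous.comp continuous_fst))

theorem continuous_density (α : Fin m → ℝ) : Continuous (density α : (Fin N → ℂ × ℝ) → ℝ) := by
  unfold density
  refine Continuous.mul (Continuous.mul continuous_const ?_) ?_
  · refine continuous_finsetProd _ fun i _ => Real.continuous_sqrt.comp ?_
    exact (Q α).derivative.continuous.comp (by fun_prop)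
  · refine continuous_finsetProd _ fun i _ => continuous_finsetProd _ fun j _ => ?_
    fun_prop

/-- The points of `Σ` with coordinates `x` and `θ`. -/
def chartPoint (α : Fin m → ℝ) (p : (Fin N → ℝ) × (Fin N → ℝ)) : Fin N → ℂ × ℝ :=
  fun j => chart α (p.1 j, p.2 j)

theorem continuous_chartPoint (α : Fin m → ℝ) :
    Continuous (chartPoint α : (Fin N → ℝ) × (Fin N → ℝ) → _) :=
  continuous_pi fun j => (continuous_chart α).comp (by fun_prop)

/-- The regular ordered eigenvalues. -/
def orderedRegular (α : Fin m → ℝ) (N : ℕ) : Set (Fin N → ℝ) := {x | Regular α x ∧ StrictMono x}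

theorem measurableSet_regular (α : Fin m → ℝ) (N : ℕ) :
    MeasurableSet {x : Fin N → ℝ | Regular α x} := by
  have : {x : Fin N → ℝ | Regular α x} = ⋂ j, ⋂ k, {x : Fin N → ℝ | 0 < x j + α k} := by
    ext x; simp [Regular]
  rw [this]
  exact MeasurableSet.iInter fun j => MeasurableSet.iInter fun k =>
    measurableSet_lt measurable_const (by fun_prop)

theorem measurableSet_strictMono (N : ℕ) : MeasurableSet {x : Fin N → ℝ | StrictMono x} := by
  have : {x : Fin N → ℝ | StrictMono x} =
      ⋂ i, ⋂ j, {x : Fin N → ℝ | i < j → x i < x j} := by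
    ext x; simp [StrictMono]
  rw [this]
  refine MeasurableSet.iInter fun i => MeasurableSet.iInter fun j => ?_
  by_cases h : i < j
  · simpa [h] using measurableSet_lt (measurable_pi_apply i) (measurable_pi_apply j)
  · simp [h]

theorem measurableSet_orderedRegular (α : Fin m → ℝ) (N : ℕ) :
    MeasurableSet (orderedRegular α N) :=
  (measurableSet_regular α N).inter (measurableSet_strictMono N)

variable [NeZero m]

omit [NeZero m] in
theorem paramDomain_eq (α : Fin m → ℝ) (N : ℕ) :
    paramDomain α N = orderedRegular α N ×ˢ Set.univ.pi fun _ => chartDomain N := by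
  ext q
  simp [paramDomain, orderedRegular, and_assoc]

omit [NeZero m] in
theorem measurableSet_paramDomain (α : Fin m → ℝ) (N : ℕ) : MeasurableSet (paramDomain α N) := by
  rw [paramDomain_eq]
  exact (measurableSet_orderedRegular α N).prod
    (MeasurableSet.univ_pi fun _ => measurableSet_chartDomain N)

theorem eval_Q_strictMonoOn {α : Fin m → ℝ} {x y : ℝ} (hx : ∀ k, 0 < x + α k) (hxy : x < y) :
    (Q α).eval x < (Q α).eval y := by
  rw [eval_Q, eval_Q]
  exact Finset.prod_lt_prod_of_nonempty (fun k _ => hx k) (fun k _ => by linarith)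
    Finset.univ_nonempty

theorem eval_derivative_Q_pos {α : Fin m → ℝ} {x : ℝ} (hx : ∀ k, 0 < x + α k) :
    0 < (Q α).derivative.eval x := by
  rw [Q, Polynomial.derivative_prod_finset]
  simp only [Polynomial.eval_finsetSum, Polynomial.eval_prod,
    Polynomial.eval_add, Polynomial.eval_X, Polynomial.eval_C, Polynomial.derivative_add,
    Polynomial.derivative_X, Polynomial.derivative_C, add_zero, mul_one]
  exact Finset.sum_pos (fun k _ => Finset.prod_pos fun l _ => hx l) Finset.univ_nonempty

/-- `|z_j|² = Q(x_j)` is strictly increasing in `x_j` on the regular part, so distinct `x_j` give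
distinct `z_j`. -/
theorem density_pos {α : Fin m → ℝ} {p : Fin N → ℂ × ℝ} (hp : ∀ j, p j ∈ surface α)
    (hreg : ∀ j k, 0 < (p j).2 + α k) (hmono : StrictMono fun j => (p j).2) : 0 < density α p := by
  unfold density
  refine mul_pos (mul_pos (by positivity) ?_) ?_
  · exact Finset.prod_pos fun i _ => Real.sqrt_pos.mpr (eval_derivative_Q_pos (hreg i))
  · refine Finset.prod_pos fun i _ => Finset.prod_pos fun j hj => ?_
    have h1 := eval_Q_strictMonoOn (hreg i) (hmono (Finset.mem_Ioi.mp hj))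
    simp only [← (hp _).2] at h1
    have h2 : (p i).1 ≠ (p j).1 := fun h => h1.ne (by rw [h])
    have := norm_pos_iff.mpr (sub_ne_zero.mpr h2)
    positivity

theorem continuous_surfacePoint (α : Fin m → ℝ) :
    Continuous (surfacePoint α : Coords m N → _) :=
  continuous_pi fun j => (continuous_chart α).comp (by fun_prop)

theorem areaData_param (α : Fin m → ℝ) (N : ℕ) : AreaData volume (coordsEquiv m N)
    (fun q => toSpace (param α q)) (paramDomain α N) (paramDensity α) where
  measurePreserving := measurePreserving_coordsEquiv m N
  measurableSet := measurableSet_paramDomain α N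
  injOn := fun q hq q' hq' h => param_injOn α N hq hq' (toSpace_injective h)
  continuousOn := by
    refine Continuous.continuousOn ?_
    unfold paramDensity
    refine ((continuous_density α).comp (continuous_surfacePoint α)).mul ?_
    exact continuous_finsetProd _ fun k _ => continuous_chartDensity.comp (by fun_prop)
  exists_deriv := by
    rintro q ⟨hq1, hq2, hq3⟩
    have hd (k : Fin m) : chartDensity (q.2 k) ≠ 0 := (chartDensity_mem (hq3 k).1).1.ne'
    obtain ⟨f', B, h1, h2, h3⟩ := exists_deriv_param hq1 (hd 0)
    refine ⟨f', B, h1, h2, h3, mul_ne_zero ?_ (Finset.prod_ne_zero_iff.mpr fun k _ => hd k)⟩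
    exact (density_pos (surfacePoint_mem hq1) (fun j => hq1 j) hq2).ne'

theorem measurable_diagEntry (α : Fin m → ℝ) (k : Fin m) :
    Measurable fun p : ℂ × ℝ => diagEntry α p k := by
  unfold diagEntry
  refine Measurable.mul (by fun_prop) ?_
  split_ifs
  · exact Complex.measurable_exp.comp ((Complex.measurable_ofReal.comp
      (Complex.measurable_arg.comp measurable_fst)).mul_const _)
  · exact measurable_const

theorem orbitPoint_apply (α : Fin m → ℝ) (p : Fin N → ℂ × ℝ) (S : Fin m → U N)
    (r c : Fin m × Fin N) : orbitPoint α p S r c = if c.1 = r.1 + 1 then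
      ∑ j, diagEntry α (p j) r.1 * (S r.1 r.2 j * star (S (r.1 + 1) c.2 j)) else 0 := by
  simp only [orbitPoint, blockCyclic, diagBlock_eq]
  split_ifs with h
  · rw [Matrix.mul_apply]
    refine Finset.sum_congr rfl fun j _ => ?_
    rw [Matrix.mul_diagonal, Matrix.conjTranspose_apply]
    ring
  · rfl

theorem measurable_entry (a b : Fin N) : Measurable fun S : U N => (S : Matrix _ _ ℂ) a b :=
  (continuous_subtype_val.matrix_elem a b).measurable

theorem measurable_orbitPoint (α : Fin m → ℝ) :
    Measurable fun q : (Fin N → ℂ × ℝ) × (Fin m → U N) => toSpace (orbitPoint α q.1 q.2) := by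
  refine measurable_toSpace_of_entries
    (f := fun q : (Fin N → ℂ × ℝ) × (Fin m → U N) => orbitPoint α q.1 q.2) fun r c => ?_
  simp only [orbitPoint_apply]
  by_cases h : c.1 = r.1 + 1
  · simp only [h, if_true]
    refine Finset.measurable_sum _ fun j _ => Measurable.mul ?_ (Measurable.mul ?_ ?_)
    · exact (measurable_diagEntry α r.1).comp ((measurable_pi_apply j).comp measurable_fst)
    · exact (measurable_entry r.2 j).comp ((measurable_pi_apply r.1).comp measurable_snd)
    · exact continuous_star.measurable.comp
        ((measurable_entry c.2 j).comp ((measurable_pi_apply (r.1 + 1)).comp measurable_snd))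
  · simp only [h, if_false]
    exact measurable_const

/-- The matrices as a function of `x`, `θ` and `S ∈ U(N)^m`. -/
def angleParam (α : Fin m → ℝ) (q : ((Fin N → ℝ) × (Fin N → ℝ)) × (Fin m → U N)) :
    MatSpace (Fin m × Fin N) :=
  toSpace (orbitPoint α (chartPoint α q.1) q.2)

theorem measurable_angleParam (α : Fin m → ℝ) : Measurable (angleParam (N := N) α) := by
  have h : Measurable fun q : ((Fin N → ℝ) × (Fin N → ℝ)) × (Fin m → U N) =>
      (chartPoint α q.1, q.2) :=
    ((continuous_chartPoint α).measurable.comp measurable_fst).prodMk measurable_snd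
  have h' := (measurable_orbitPoint (N := N) α).comp h
  simp only [Function.comp_def] at h'
  exact h'

/-- The measure `2^{-N} ∏ √Q'(x_i) ∏ |z_i - z_j|² dx dθ` for ordered eigenvalues. -/
def orderedMeasure (α : Fin m → ℝ) (N : ℕ) : Measure ((Fin N → ℝ) × (Fin N → ℝ)) :=
  (volume.restrict (orderedRegular α N ×ˢ angleCube N)).withDensity
    fun p => ENNReal.ofReal (density α (chartPoint α p))

instance (α : Fin m → ℝ) : SFinite (orderedMeasure α N) := by
  unfold orderedMeasure; infer_instance

/-- The image of `dx dθ dS`. -/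
def angleMeasure (α : Fin m → ℝ) (N : ℕ) : Measure (MatSpace (Fin m × Fin N)) :=
  (ENNReal.ofReal ((2 * Real.pi) ^ N))⁻¹ •
    Measure.map (angleParam α) ((orderedMeasure α N).prod (Measure.pi fun _ : Fin m => volumeU N))

/-- The matrices with ordered eigenvalues and unitary coordinates near the identity. -/
def paramImage (α : Fin m → ℝ) (N : ℕ) : Set (MatSpace (Fin m × Fin N)) :=
  (fun q => toSpace (param α q)) '' paramDomain α N

theorem continuousOn_param (α : Fin m → ℝ) (N : ℕ) :
    ContinuousOn (fun q => toSpace (param α q)) (paramDomain α N) := by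
  refine (areaData_param α N).continuousOn_map

theorem measurableSet_paramImage (α : Fin m → ℝ) (N : ℕ) : MeasurableSet (paramImage α N) :=
  (measurableSet_paramDomain α N).image_of_continuousOn_injOn (continuousOn_param α N)
    (areaData_param α N).injOn

theorem continuous_param (α : Fin m → ℝ) :
    Continuous fun q : Coords m N => toSpace (param α q) := by
  refine continuous_toSpace fun r c => ?_
  unfold param blockCyclic
  by_cases h : c.1 = r.1 + 1
  · simp only [h, if_true]
    have hc (k : Fin m) (a b : Fin N) : Continuous fun q : Coords m N => cayley (q.2 k) a b :=
      (contDiff_cayley a b).continuous.comp (by fun_prop)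
    have hb (k : Fin m) (j : Fin N) : Continuous fun q : Coords m N => blockEntry α q k j := by
      unfold blockEntry blockAngle
      split_ifs <;> fun_prop
    simp only [Matrix.mul_apply (N := Matrix.conjTranspose _), Matrix.mul_diagonal,
      Matrix.conjTranspose_apply]
    exact continuous_finsetSum _ fun j _ => ((hc _ _ _).mul (hb _ _)).mul (hc _ _ _).star
  · simp only [h, if_false]
    exact continuous_const

theorem angleParam_mul_diagU (α : Fin m → ℝ) (p : (Fin N → ℝ) × (Fin N → ℝ)) (S : Fin m → U N)
    (t : Fin N → Circle) :
    angleParam α (p, fun k => S k * diagU N t) = angleParam α (p, S) :=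
  congr_arg toSpace (orbitPoint_mul α (chartPoint α p) S (T := fun _ => diagU N t) ⟨t, rfl⟩)

theorem toSpace_param {α : Fin m → ℝ} {q : Coords m N} (hq : Regular α q.1) :
    toSpace (param α q) = angleParam α ((q.1, fun j => q.2 0 j j), paramU q.2) :=
  congr_arg toSpace (param_eq_orbitPoint hq)

theorem paramU_mem_chartImage {h : Fin m → RMat N} (hh : ∀ k, h k ∈ chartDomain N) (k : Fin m) :
    paramU h k ∈ chartImage N := by
  unfold paramU
  split_ifs
  · exact ⟨h 0, 1, (hh 0).1, by rw [map_one, mul_one]⟩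
  · exact ⟨h k, phase (h k), (hh k).1, rfl⟩

/-- Writing `S 0 = C(y) t` and multiplying every `S k` by `t⁻¹` does not change the matrix. The
diagonal coordinates of index 0 are then free to hold `θ`. -/
theorem exists_param_eq {α : Fin m → ℝ} {p : Fin N → ℂ × ℝ} {S : Fin m → U N}
    (hS : ∀ k, S k ∈ chartImage N) {θ : Fin N → ℝ}
    (hθ : ∀ j, Complex.exp (Complex.arg (p j).1 * Complex.I) = Complex.exp (θ j * Complex.I)) :
    ∃ h : Fin m → RMat N, ‖offDiag (h 0)‖ < chartRadius N ∧ (∀ j, h 0 j j = θ j) ∧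
      (∀ k, k ≠ 0 → h k ∈ chartDomain N) ∧
      param α (fun j => (p j).2, h) = orbitPoint α p S := by
  obtain ⟨y, t, hy, hyt⟩ := hS 0
  have h1 (k : Fin m) : ∃ h ∈ chartDomain N, chartU h = S k * diagU N t⁻¹ := by
    have := (mul_diagU_mem_chartImage_iff t⁻¹).mpr (hS k)
    rwa [← chartImage_eq] at this
  choose h hh1 hh2 using h1
  set h0 : RMat N := fun a b => if a = b then θ a else y a b with hh0
  have hoff : offDiag h0 = offDiag y := by
    funext a b
    by_cases hab : a = b <;> simp [h0, offDiag, hab]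
  have hdiag (j : Fin N) : h0 j j = θ j := by simp [h0]
  refine ⟨fun k => if k = 0 then h0 else h k, by simpa [hoff] using hy, by simpa using hdiag,
    fun k hk => by simpa [hk] using hh1 k, ?_⟩
  rw [param_eq_orbitPoint_of (p := p) (fun j => rfl) (by simpa [hdiag] using hθ),
    ← orbitPoint_mul α p S (T := fun _ => diagU N t⁻¹) ⟨t⁻¹, rfl⟩]
  congr 1
  funext k
  by_cases hk : k = 0
  · subst hk
    simp only [paramU, if_true, Pi.mul_apply]
    rw [hyt, mul_assoc, ← map_mul, mul_inv_cancel, map_one, mul_one, ← cayleyU_offDiag, hoff,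
      cayleyU_offDiag]
  · simp only [paramU, hk, if_false, Pi.mul_apply]
    exact hh2 k

theorem angleParam_mem_paramImage {α : Fin m → ℝ} {p : (Fin N → ℝ) × (Fin N → ℝ)}
    (hp : p ∈ orderedRegular α N ×ˢ angleCube N) {S : Fin m → U N}
    (hS : ∀ k, S k ∈ chartImage N) : angleParam α (p, S) ∈ paramImage α N := by
  obtain ⟨h, h0, hdiag, hk, heq⟩ := exists_param_eq (p := chartPoint α p) hS
    fun j => exp_arg_chart (hp.1.1 j) (p.2 j)
  refine ⟨(p.1, h), ⟨hp.1.1, hp.1.2, fun k => ?_⟩, congr_arg toSpace heq⟩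
  by_cases hk0 : k = 0
  · subst hk0
    exact ⟨h0, fun j => by
      dsimp only
      rw [hdiag]
      exact hp.2 j (Set.mem_univ j)⟩
  · exact hk k hk0

/-- On the ordered regular part `S` is determined by the matrix up to the torus, under which the
chart image is invariant. Membership thus depends on `S` alone, which makes the preimage a product.
-/
theorem angleParam_mem_paramImage_iff {α : Fin m → ℝ} {p : (Fin N → ℝ) × (Fin N → ℝ)}
    (hp : p ∈ orderedRegular α N ×ˢ angleCube N) (S : Fin m → U N) :
    angleParam α (p, S) ∈ paramImage α N ↔ S ∈ Set.univ.pi fun _ => chartImage N := by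
  refine ⟨?_, fun hS => angleParam_mem_paramImage hp fun k => hS k (Set.mem_univ k)⟩
  rintro ⟨q, ⟨hq1, hq2, hq3⟩, hq⟩ k -
  have h1 : orbitPoint α (surfacePoint α q) (paramU q.2) = orbitPoint α (chartPoint α p) S :=
    toSpace_injective ((toSpace_param hq1).symm.trans hq)
  obtain ⟨-, t, ht⟩ := orbitPoint_injective_of_strictMono (surfacePoint_mem hq1)
    (fun j => chart_mem_surface (fun k => (hp.1.1 j k).le) _) hq2 hp.1.2 hq1 h1
  rw [← mul_diagU_mem_chartImage_iff t, ← ht k]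
  exact paramU_mem_chartImage hq3 k

theorem restrict_preimage_paramImage (α : Fin m → ℝ) (N : ℕ) :
    ((orderedMeasure α N).prod (Measure.pi fun _ : Fin m => volumeU N)).restrict
        (angleParam α ⁻¹' paramImage α N) =
      (orderedMeasure α N).prod
        (Measure.pi fun _ : Fin m => (volumeU N).restrict (chartImage N)) := by
  have hae : ∀ᵐ p ∂orderedMeasure α N, p ∈ orderedRegular α N ×ˢ angleCube N := by
    refine (withDensity_absolutelyContinuous _ _).ae_le ?_
    exact ae_restrict_mem ((measurableSet_orderedRegular α N).prod (measurableSet_angleCube N))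
  have h1 : angleParam α ⁻¹' paramImage α N
      =ᵐ[(orderedMeasure α N).prod (Measure.pi fun _ : Fin m => volumeU N)]
      Set.univ ×ˢ Set.univ.pi fun _ => chartImage N := by
    have h2 := (Measure.quasiMeasurePreserving_fst (μ := orderedMeasure α N)
      (ν := Measure.pi fun _ : Fin m => volumeU N)).ae hae
    filter_upwards [h2] with q hq
    refine propext ?_
    exact (angleParam_mem_paramImage_iff hq q.2).trans
      ⟨fun h => ⟨Set.mem_univ _, h⟩, fun h => h.2⟩
  rw [Measure.restrict_congr_set h1, ← Measure.prod_restrict, Measure.restrict_univ,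
    Measure.restrict_pi_pi]

theorem measurable_paramU : Measurable fun h : Fin m → RMat N => (paramU h : Fin m → U N) := by
  refine measurable_pi_lambda _ fun k => ?_
  unfold paramU
  split_ifs
  · exact continuous_cayleyU.measurable.comp (measurable_pi_apply _)
  · exact continuous_chartU.measurable.comp (measurable_pi_apply _)

/-- The area formula for `param`, with the factors `chartDensity` absorbed in `chartMeasure`. -/
theorem lintegral_paramImage (α : Fin m → ℝ) {F : MatSpace (Fin m × Fin N) → ℝ≥0∞}
    (hF : Measurable F) :
    ∫⁻ A in paramImage α N, F A ∂Measure.euclideanHausdorffMeasure (m * N ^ 2 + N) =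
      ∫⁻ x in orderedRegular α N, ∫⁻ h, ENNReal.ofReal
          (density α (chartPoint α (x, fun j => h 0 j j))) *
        F (angleParam α ((x, fun j => h 0 j j), paramU h))
          ∂Measure.pi (fun _ : Fin m => chartMeasure N) := by
  have hpm := (continuous_param (N := N) α).measurable
  have hρ : Measurable fun h : RMat N => ENNReal.ofReal (chartDensity h) :=
    continuous_chartDensity.measurable.ennreal_ofReal
  have hD : Measurable fun q : Coords m N => ENNReal.ofReal (paramDensity α q) := by
    refine Measurable.ennreal_ofReal (Continuous.measurable ?_)
    unfold paramDensity
    refine ((continuous_density α).comp (continuous_surfacePoint α)).mul ?_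
    exact continuous_finsetProd _ fun k _ => continuous_chartDensity.comp (by fun_prop)
  have hG : Measurable fun q : Coords m N =>
      ENNReal.ofReal (paramDensity α q) * F (toSpace (param α q)) := hD.mul (hF.comp hpm)
  rw [← finrank_coords, paramImage, (areaData_param α N).restrict_image hpm, lintegral_map hF hpm,
    lintegral_withDensity_eq_lintegral_mul _ hD (g := fun q => F (toSpace (param α q))) (hF.comp hpm),
    paramDomain_eq,
    Measure.volume_eq_prod, ← Measure.prod_restrict]
  refine (lintegral_prod (fun q : Coords m N =>
      ENNReal.ofReal (paramDensity α q) * F (toSpace (param α q))) hG.aemeasurable).trans ?_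
  refine setLIntegral_congr_fun (measurableSet_orderedRegular α N) fun x hx => ?_
  have hH : Measurable fun h : Fin m → RMat N =>
      ENNReal.ofReal (density α (chartPoint α (x, fun j => h 0 j j))) *
        F (angleParam α ((x, fun j => h 0 j j), paramU h)) := by
    have h1 : Measurable fun h : Fin m → RMat N => (x, fun j => h 0 j j) := by fun_prop
    refine Measurable.mul ?_ ?_
    · exact ((continuous_density α).comp
        (continuous_chartPoint α)).measurable.ennreal_ofReal.comp h1
    · exact hF.comp ((measurable_angleParam α).comp (h1.prodMk measurable_paramU))
  have hfin : SigmaFinite ((volume.restrict (chartDomain N)).withDensity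
      fun h => ENNReal.ofReal (chartDensity h)) :=
    inferInstanceAs (SigmaFinite (chartMeasure N))
  have h2 := lintegral_pi_withDensity (volume.restrict (chartDomain N)) hρ m hH
  refine Eq.trans ?_ h2.symm
  rw [volume_pi, Measure.restrict_pi_pi]
  refine lintegral_congr fun h => ?_
  rw [toSpace_param (q := (x, h)) hx.1, paramDensity, ENNReal.ofReal_mul,
    ENNReal.ofReal_prod_of_nonneg, mul_left_comm, mul_assoc]
  · rfl
  · exact fun k _ => abs_nonneg _
  · exact (density_pos (surfacePoint_mem (q := (x, h)) hx.1) (fun j => hx.1 j) hx.2).le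

/-- By `lintegral_angles`, replacing independent angles `θ` by the diagonal of `h 0` costs exactly
the factor `(2π)^N` that the normalization of `angleMeasure` removes. -/
theorem restrict_paramImage (α : Fin m → ℝ) (N : ℕ) :
    (Measure.euclideanHausdorffMeasure (m * N ^ 2 + N)).restrict (paramImage α N) =
      (angleMeasure α N).restrict (paramImage α N) := by
  refine Measure.ext_of_lintegral _ fun F hF => ?_
  have hm := measurable_angleParam (N := N) α
  have hdens : Measurable fun p : (Fin N → ℝ) × (Fin N → ℝ) =>
      ENNReal.ofReal (density α (chartPoint α p)) :=
    ((continuous_density α).comp (continuous_chartPoint α)).measurable.ennreal_ofReal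
  have hFm : Measurable fun q => F (angleParam (N := N) α q) := hF.comp hm
  have hFi : Measurable fun p => ∫⁻ S, F (angleParam (N := N) α (p, S))
      ∂Measure.pi (fun _ : Fin m => (volumeU N).restrict (chartImage N)) :=
    hFm.lintegral_prod_right'
  have hpos : ENNReal.ofReal ((2 * Real.pi) ^ N) ≠ 0 := by
    rw [Ne, ENNReal.ofReal_eq_zero, not_le]
    have := Real.pi_pos
    positivity
  rw [lintegral_paramImage α hF, angleMeasure, Measure.restrict_smul, lintegral_smul_measure,
    Measure.restrict_map hm (measurableSet_paramImage α N), restrict_preimage_paramImage,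
    lintegral_map hF hm, lintegral_prod _ hFm.aemeasurable, orderedMeasure,
    lintegral_withDensity_eq_lintegral_mul _ hdens hFi, Measure.volume_eq_prod,
    ← Measure.prod_restrict]
  simp only [Pi.mul_apply]
  rw [lintegral_prod (fun p => ENNReal.ofReal (density α (chartPoint α p)) *
    ∫⁻ S, F (angleParam (N := N) α (p, S))
      ∂Measure.pi (fun _ : Fin m => (volumeU N).restrict (chartImage N)))
      (hdens.mul hFi).aemeasurable]
  have key (x : Fin N → ℝ) : ∫⁻ θ in angleCube N, ENNReal.ofReal (density α (chartPoint α (x, θ))) *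
      ∫⁻ S, F (angleParam (N := N) α ((x, θ), S))
        ∂Measure.pi (fun _ : Fin m => (volumeU N).restrict (chartImage N)) =
      ENNReal.ofReal ((2 * Real.pi) ^ N) *
        ∫⁻ h, ENNReal.ofReal (density α (chartPoint α (x, fun j => h 0 j j))) *
          F (angleParam α ((x, fun j => h 0 j j), paramU h))
            ∂Measure.pi (fun _ : Fin m => chartMeasure N) := by
    have hx : Measurable fun r : (Fin N → ℝ) × (Fin m → U N) => ((x, r.1), r.2) := by fun_prop
    have hH : Measurable fun r : (Fin N → ℝ) × (Fin m → U N) =>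
        ENNReal.ofReal (density α (chartPoint α (x, r.1))) * F (angleParam α ((x, r.1), r.2)) :=
      ((hdens.comp measurable_fst).comp hx).mul (hFm.comp hx)
    rw [← lintegral_angles hH fun θ S t => by
      dsimp only
      rw [angleParam_mul_diagU]]
    refine lintegral_congr fun θ => ?_
    exact (lintegral_const_mul _ ((hFm.comp hx).comp measurable_prodMk_left)).symm
  simp only [key]
  rw [lintegral_const_mul' _ _ ENNReal.ofReal_ne_top, smul_eq_mul, ← mul_assoc,
    ENNReal.inv_mul_cancel hpos ENNReal.ofReal_ne_top, one_mul]

end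

section

/-! ### Matrices with coinciding or vanishing eigenvalues -/

variable {m N : ℕ} [NeZero m]

/-- The blocks as a smooth function of the moduli of the diagonal entries and of the angles. -/
def polarParam (q : (Fin m → Fin N → ℝ) × (Fin m → RMat N)) : BlockMat m N :=
  blockCyclic fun k => cayley (q.2 k) * Matrix.diagonal
    (fun j => (q.1 k j : ℂ) * Complex.exp (blockAngle q.2 k j * Complex.I)) *
    (cayley (q.2 (k + 1)))ᴴ

theorem contDiff_polarParam : ContDiff ℝ 1 fun q : (Fin m → Fin N → ℝ) × (Fin m → RMat N) =>
    toSpace (polarParam q) := by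
  refine contDiff_piLp' 2 fun i => ?_
  change ContDiff ℝ 1 fun q : (Fin m → Fin N → ℝ) × (Fin m → RMat N) => polarParam q i.1 i.2
  obtain ⟨i, j⟩ := i
  simp only [polarParam, blockCyclic]
  split_ifs
  · have hc (k : Fin m) (a b : Fin N) :
        ContDiff ℝ 1 (fun q : (Fin m → Fin N → ℝ) × (Fin m → RMat N) => cayley (q.2 k) a b) :=
      ((contDiff_cayley a b).of_le le_top).comp (by fun_prop)
    have hb (k : Fin m) (c : Fin N) :
        ContDiff ℝ 1 (fun q : (Fin m → Fin N → ℝ) × (Fin m → RMat N) =>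
          (q.1 k c : ℂ) * Complex.exp (blockAngle q.2 k c * Complex.I)) := by
      have h2 : ContDiff ℝ 1 (fun q : (Fin m → Fin N → ℝ) × (Fin m → RMat N) =>
          blockAngle q.2 k c) := by
        unfold blockAngle
        split_ifs <;> fun_prop
      exact (Complex.ofRealCLM.contDiff.comp (by fun_prop)).mul
        ((Complex.ofRealCLM.contDiff.comp h2).mul contDiff_const).cexp
    simp only [Matrix.mul_apply (N := Matrix.conjTranspose _), Matrix.mul_diagonal,
      Matrix.conjTranspose_apply]
    refine ContDiff.sum fun c _ => ((hc _ _ _).mul (hb _ _)).mul ?_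
    exact Complex.conjCLE.contDiff.comp (hc (i.1 + 1) j.2 c)
  · exact contDiff_const

/-- The function is the modulus of `s + i √γ`. -/
theorem lipschitzWith_sqrt_sq_add {γ : ℝ} (hγ : 0 ≤ γ) :
    LipschitzWith 1 fun s : ℝ => Real.sqrt (s ^ 2 + γ) := by
  have h (s : ℝ) : Real.sqrt (s ^ 2 + γ) = ‖(s : ℂ) + Real.sqrt γ * Complex.I‖ := by
    rw [Complex.norm_add_mul_I, Real.sq_sqrt hγ]
  refine LipschitzWith.of_dist_le_mul fun s t => ?_
  rw [h, h, NNReal.coe_one, one_mul, Real.dist_eq, Real.dist_eq]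
  refine (abs_norm_sub_norm_le _ _).trans ?_
  rw [add_sub_add_right_eq_sub, ← Complex.ofReal_sub, Complex.norm_real, Real.norm_eq_abs]

/-- The coordinates `s` with `x = s² - c` instead of `x`. -/
def squareCoords (c : ℝ) (q : Coords m N) : Coords m N := (fun j => q.1 j ^ 2 - c, q.2)

/-- As functions of `x` the moduli `√(x + α_k)` are not Lipschitz where they vanish. With `x = s² -
c` they become `√(s² + (α_k - c))`, which are Lipschitz in `s` because `c ≤ α_k`; everything else is
smooth. -/
theorem locallyLipschitz_param_squareCoords {α : Fin m → ℝ} {c : ℝ} (hc : ∀ k, c ≤ α k) :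
    LocallyLipschitz fun q : Coords m N => toSpace (param α (squareCoords c q)) := by
  have h1 : LipschitzWith 1 fun q : Coords m N =>
      ((fun k j => Real.sqrt (q.1 j ^ 2 + (α k - c)), q.2) :
        (Fin m → Fin N → ℝ) × (Fin m → RMat N)) := by
    have h2 : LipschitzWith 1 fun q : Coords m N =>
        ((fun k j => Real.sqrt (q.1 j ^ 2 + (α k - c))) : Fin m → Fin N → ℝ) := by
      refine LipschitzWith.of_dist_le_mul fun q q' => ?_
      rw [NNReal.coe_one, one_mul]
      refine (dist_pi_le_iff dist_nonneg).mpr fun k => (dist_pi_le_iff dist_nonneg).mpr fun j => ?_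
      refine ((lipschitzWith_sqrt_sq_add (sub_nonneg.mpr (hc k))).dist_le_mul _ _).trans ?_
      rw [NNReal.coe_one, one_mul]
      exact (dist_le_pi_dist q.1 q'.1 j).trans (le_max_left _ _)
    simpa using h2.prodMk LipschitzWith.prod_snd
  have h3 := contDiff_polarParam (m := m) (N := N).locallyLipschitz.comp h1.locallyLipschitz
  have h4 : (fun q : Coords m N => toSpace (param α (squareCoords c q))) =
      (fun q => toSpace (polarParam q)) ∘ fun q : Coords m N =>
        ((fun k j => Real.sqrt (q.1 j ^ 2 + (α k - c)), q.2) :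
          (Fin m → Fin N → ℝ) × (Fin m → RMat N)) := by
    funext q
    have h5 (k : Fin m) (j : Fin N) : q.1 j ^ 2 - c + α k = q.1 j ^ 2 + (α k - c) := by ring
    have h6 (k : Fin m) : blockEntry α (squareCoords c q) k = fun j =>
        (Real.sqrt (q.1 j ^ 2 + (α k - c)) : ℂ) * Complex.exp (blockAngle q.2 k j * Complex.I) := by
      funext j
      rw [blockEntry, squareCoords, h5]
    simp only [Function.comp_apply, param, polarParam, h6]
    rfl
  rw [h4]
  exact h3

/-- The coordinates `s` with vanishing or coinciding entries. -/
def singularCoords (m N : ℕ) : Set (Coords m N) :=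
  {q | (∃ j, q.1 j = 0) ∨ ∃ i j, i ≠ j ∧ q.1 i = q.1 j}

omit [NeZero m] in
theorem volume_ker_eq_zero (l : Coords m N →ₗ[ℝ] ℝ) (hl : l ≠ 0) :
    volume {q : Coords m N | l q = 0} = 0 :=
  Measure.addHaar_submodule volume (LinearMap.ker l) fun h => hl (LinearMap.ker_eq_top.mp h)

omit [NeZero m] in
theorem volume_singularCoords (m N : ℕ) : volume (singularCoords m N) = 0 := by
  have h : singularCoords m N = (⋃ j, {q : Coords m N | q.1 j = 0}) ∪
      ⋃ i, ⋃ j, {q : Coords m N | i ≠ j ∧ q.1 i = q.1 j} := by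
    ext q; simp [singularCoords]
  rw [h, measure_union_null_iff, measure_iUnion_null_iff, measure_iUnion_null_iff]
  refine ⟨fun j => ?_, fun i => measure_iUnion_null fun j => ?_⟩
  · refine volume_ker_eq_zero ((LinearMap.proj j).comp (LinearMap.fst ℝ _ _)) fun h => ?_
    have := LinearMap.congr_fun h (Pi.single j 1, 0)
    simp at this
  · by_cases hij : i = j
    · simp [hij]
    · set l : Coords m N →ₗ[ℝ] ℝ := ((LinearMap.proj i : (Fin N → ℝ) →ₗ[ℝ] ℝ) -
        (LinearMap.proj j : (Fin N → ℝ) →ₗ[ℝ] ℝ)).comp (LinearMap.fst ℝ _ _) with hl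
      have hl0 : l ≠ 0 := fun h => by
        have := LinearMap.congr_fun h (Pi.single i 1, 0)
        simp [hl, Ne.symm hij] at this
      refine measure_mono_null ?_ (volume_ker_eq_zero l hl0)
      rintro q ⟨-, hq⟩
      simp [hl, hq]

/-- The matrices with vanishing or coinciding eigenvalues, with unitary coordinates near the
identity. -/
def singularImage (α : Fin m → ℝ) (N : ℕ) (c : ℝ) : Set (MatSpace (Fin m × Fin N)) :=
  (fun q => toSpace (param α (squareCoords c q))) '' singularCoords m N

/-- The singular coordinates lie in finitely many hyperplanes of a space whose dimension is that of
the Hausdorff measure, and locally Lipschitz maps preserve null sets. -/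
theorem euclideanHausdorffMeasure_singularImage {α : Fin m → ℝ} {c : ℝ} (hc : ∀ k, c ≤ α k) :
    Measure.euclideanHausdorffMeasure (m * N ^ 2 + N) (singularImage α N c) = 0 := by
  rw [← finrank_coords, ← (coordsEquiv m N).toLinearEquiv.finrank_eq]
  refine euclideanHausdorffMeasure_image_eq_zero (μ := volume) (fun q _ => ?_)
    (volume_singularCoords m N)
  obtain ⟨K, t, ht, hK⟩ := locallyLipschitz_param_squareCoords (N := N) hc q
  exact ⟨K, t, ht, hK⟩

/-- As `α k₀` is the smallest of the `α k`, the vanishing of any `x_j + α_k` forces that of `x_j +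
α_{k₀} = s_j²`. -/
theorem orbitPoint_mem_singularImage {α : Fin m → ℝ} {k₀ : Fin m} (hc : ∀ k, α k₀ ≤ α k)
    {p : Fin N → ℂ × ℝ} (hp : ∀ j, p j ∈ surface α)
    (hsing : ¬ ((∀ j k, 0 < (p j).2 + α k) ∧ Function.Injective fun j => (p j).2))
    {S : Fin m → U N} (hS : ∀ k, S k ∈ chartImage N) :
    toSpace (orbitPoint α p S) ∈ singularImage α N (α k₀) := by
  obtain ⟨h, -, -, -, heq⟩ := exists_param_eq (p := p) (θ := fun j => Complex.arg (p j).1) hS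
    fun j => rfl
  refine ⟨(fun j => Real.sqrt ((p j).2 + α k₀), h), ?_, ?_⟩
  · by_contra hn
    simp only [singularCoords, Set.mem_ofPred_eq, not_or, not_exists, not_and] at hn
    refine hsing ⟨fun j k => ?_, fun i j hij => ?_⟩
    · have h1 := (Real.sqrt_ne_zero ((hp j).1 k₀)).mp (hn.1 j)
      have h2 := (hp j).1 k₀
      have h3 := hc k
      rcases h2.lt_or_eq with h4 | h4
      · linarith
      · exact absurd h4.symm h1
    · by_contra hne
      exact hn.2 i j hne (by dsimp only at hij ⊢; rw [hij])
  · dsimp only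
    rw [← heq]
    congr 2
    refine Prod.ext (funext fun j => ?_) rfl
    simp only [squareCoords]
    rw [Real.sq_sqrt ((hp j).1 k₀)]
    ring

end

section

/-! ### Translation by the unitary groups -/

variable {m N : ℕ} [NeZero m]

/-- The block diagonal unitary matrices. -/
def blockDiagU (g : Fin m → U N) : BlockMat m N :=
  fun r c => if r.1 = c.1 then (g r.1 : Matrix (Fin N) (Fin N) ℂ) r.2 c.2 else 0

omit [NeZero m] in
theorem blockDiagU_mul_apply (g : Fin m → U N) (A : BlockMat m N) (r c : Fin m × Fin N) :
    (blockDiagU g * A) r c = ∑ b, (g r.1 : Matrix (Fin N) (Fin N) ℂ) r.2 b * A (r.1, b) c := by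
  rw [Matrix.mul_apply, Fintype.sum_prod_type, Finset.sum_eq_single r.1]
  · simp [blockDiagU]
  · intro k _ hk
    simp [blockDiagU, Ne.symm hk]
  · simp

omit [NeZero m] in
theorem mul_blockDiagU_conjTranspose_apply (g : Fin m → U N) (A : BlockMat m N)
    (r c : Fin m × Fin N) : (A * (blockDiagU g)ᴴ) r c =
      ∑ b, A r (c.1, b) * star ((g c.1 : Matrix (Fin N) (Fin N) ℂ) c.2 b) := by
  rw [Matrix.mul_apply, Fintype.sum_prod_type, Finset.sum_eq_single c.1]
  · simp [blockDiagU, Matrix.conjTranspose_apply]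
  · intro k _ hk
    simp [blockDiagU, Matrix.conjTranspose_apply, Ne.symm hk]
  · simp

omit [NeZero m] in
theorem blockDiagU_mul (g g' : Fin m → U N) :
    blockDiagU g * blockDiagU g' = blockDiagU (g * g') := by
  ext r c
  rw [blockDiagU_mul_apply]
  simp only [blockDiagU]
  split_ifs with h
  · exact (Matrix.mul_apply (M := (g r.1 : Matrix (Fin N) (Fin N) ℂ))
      (N := (g' r.1 : Matrix (Fin N) (Fin N) ℂ))).symm
  · simp

omit [NeZero m] in
theorem blockDiagU_one : blockDiagU (1 : Fin m → U N) = 1 := by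
  ext ⟨i, a⟩ ⟨j, b⟩
  simp only [blockDiagU, Matrix.one_apply, Prod.mk.injEq]
  by_cases h : i = j <;> simp [h, Matrix.one_apply]

omit [NeZero m] in
theorem blockDiagU_conjTranspose (g : Fin m → U N) : (blockDiagU g)ᴴ = blockDiagU g⁻¹ := by
  ext ⟨i, a⟩ ⟨j, b⟩
  simp only [blockDiagU, Matrix.conjTranspose_apply]
  by_cases h : i = j
  · subst h
    simp
  · simp [h, Ne.symm h]

omit [NeZero m] in
theorem blockDiagU_mem (g : Fin m → U N) :
    blockDiagU g ∈ Matrix.unitaryGroup (Fin m × Fin N) ℂ := by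
  rw [Matrix.mem_unitaryGroup_iff, Matrix.star_eq_conjTranspose, blockDiagU_conjTranspose,
    blockDiagU_mul, mul_inv_cancel, blockDiagU_one]

theorem blockDiagU_mul_blockCyclic (g : Fin m → U N) (X : Fin m → Matrix (Fin N) (Fin N) ℂ) :
    blockDiagU g * blockCyclic X * (blockDiagU g)ᴴ = blockCyclic fun k =>
      (g k : Matrix (Fin N) (Fin N) ℂ) * X k * (g (k + 1) : Matrix (Fin N) (Fin N) ℂ)ᴴ := by
  ext r c
  rw [mul_blockDiagU_conjTranspose_apply]
  simp only [blockDiagU_mul_apply]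
  by_cases h : c.1 = r.1 + 1
  · simp only [blockCyclic, h, if_true]
    rw [Matrix.mul_apply (N := (g (r.1 + 1) : Matrix (Fin N) (Fin N) ℂ)ᴴ)]
    refine Finset.sum_congr rfl fun b _ => ?_
    rw [Matrix.conjTranspose_apply, Matrix.mul_apply]
  · simp [blockCyclic, h]

theorem blockDiagU_mul_orbitPoint (α : Fin m → ℝ) (p : Fin N → ℂ × ℝ) (g S : Fin m → U N) :
    blockDiagU g * orbitPoint α p S * (blockDiagU g)ᴴ = orbitPoint α p (g * S) := by
  unfold orbitPoint
  rw [blockDiagU_mul_blockCyclic]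
  congr 1
  funext k
  simp only [Pi.mul_apply, Submonoid.coe_mul, Matrix.conjTranspose_mul, Matrix.mul_assoc]

/-- Conjugation by block diagonal unitary matrices. -/
def translate (g : Fin m → U N) (x : MatSpace (Fin m × Fin N)) : MatSpace (Fin m × Fin N) :=
  toSpace (blockDiagU g * (Matrix.of fun a b => x (a, b)) * (blockDiagU g)ᴴ)

omit [NeZero m] in
theorem translate_toSpace (g : Fin m → U N) (A : BlockMat m N) :
    translate g (toSpace A) = toSpace (blockDiagU g * A * (blockDiagU g)ᴴ) := rfl

omit [NeZero m] in
theorem isometry_translate (g : Fin m → U N) : Isometry (translate g) := by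
  refine isometry_of_frob (fun M => blockDiagU g * M * (blockDiagU g)ᴴ) (fun M => rfl)
    (fun M M' => ?_) fun M => ?_
  · rw [Matrix.mul_sub, Matrix.sub_mul]
  · rw [frob_mul_unitary (V := (blockDiagU g)ᴴ) (Unitary.star_mem (blockDiagU_mem g)),
      frob_unitary_mul (blockDiagU_mem g)]

omit [NeZero m] in
theorem translate_translate_inv (g : Fin m → U N) (x : MatSpace (Fin m × Fin N)) :
    translate g (translate g⁻¹ x) = x := by
  obtain ⟨A, rfl⟩ : ∃ A : BlockMat m N, x = toSpace A := ⟨Matrix.of fun a b => x (a, b), rfl⟩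
  rw [translate_toSpace, translate_toSpace]
  congr 1
  have h1 : blockDiagU g * blockDiagU g⁻¹ = 1 := by
    rw [blockDiagU_mul, mul_inv_cancel, blockDiagU_one]
  calc _ = (blockDiagU g * blockDiagU g⁻¹) * A * (blockDiagU g * blockDiagU g⁻¹)ᴴ := by
        rw [Matrix.conjTranspose_mul]
        simp only [Matrix.mul_assoc]
    _ = A := by rw [h1]; simp

/-- Conjugation by block diagonal unitary matrices, as an isometry. -/
def translateEquiv (g : Fin m → U N) : MatSpace (Fin m × Fin N) ≃ᵢ MatSpace (Fin m × Fin N) where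
  toFun := translate g
  invFun := translate g⁻¹
  left_inv x := by simpa using translate_translate_inv g⁻¹ x
  right_inv x := translate_translate_inv g x
  isometry_toFun := isometry_translate g

theorem translate_angleParam (α : Fin m → ℝ) (g S : Fin m → U N)
    (p : (Fin N → ℝ) × (Fin N → ℝ)) :
    translate g (angleParam α (p, S)) = angleParam α (p, g * S) :=
  congr_arg toSpace (blockDiagU_mul_orbitPoint α (chartPoint α p) g S)

theorem map_translate_angleMeasure (α : Fin m → ℝ) (g : Fin m → U N) :
    Measure.map (translate g) (angleMeasure α N) = angleMeasure α N := by
  have hg : Measurable (translate g) := (isometry_translate g).continuous.measurable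
  have hmul : Measurable fun S : Fin m → U N => g * S := measurable_const_mul g
  rw [angleMeasure, Measure.map_smul, Measure.map_map hg (measurable_angleParam α)]
  congr 1
  have h1 : translate g ∘ angleParam (N := N) α = angleParam α ∘ Prod.map id (g * ·) := by
    funext q
    exact translate_angleParam α g q.2 q.1
  have hinv : Measure.map (g * ·) (Measure.pi fun _ : Fin m => volumeU N) =
      Measure.pi fun _ : Fin m => volumeU N := by
    refine (Measure.pi_map_pi (μ := fun _ : Fin m => volumeU N) (f := fun k => (g k * ·))
      fun k => (measurable_const_mul (g k)).aemeasurable).trans ?_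
    simp only [map_mul_left_eq_self]
  rw [h1, ← Measure.map_map (measurable_angleParam α) (measurable_id.prodMap hmul),
    ← Measure.map_prod_map _ _ measurable_id hmul, Measure.map_id, hinv]

/-- Conjugation is an isometry, and it acts on the coordinates by left translation of `S`; each of
the two measures is invariant. -/
theorem restrict_translate_paramImage (α : Fin m → ℝ) (g : Fin m → U N) :
    (Measure.euclideanHausdorffMeasure (m * N ^ 2 + N)).restrict (translate g '' paramImage α N) =
      (angleMeasure α N).restrict (translate g '' paramImage α N) := by
  have hemb : MeasurableEmbedding (translate (N := N) g) :=
    (translateEquiv g).toHomeomorph.measurableEmbedding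
  have h1 : Measure.map (translate g) (Measure.euclideanHausdorffMeasure (m * N ^ 2 + N)) =
      (Measure.euclideanHausdorffMeasure (m * N ^ 2 + N) : Measure (MatSpace (Fin m × Fin N))) :=
    ((translateEquiv g).measurePreserving_euclideanHausdorffMeasure _).map_eq
  have hpre : translate g ⁻¹' (translate g '' paramImage α N) = paramImage α N :=
    Set.preimage_image_eq _ (isometry_translate g).injective
  conv_lhs => rw [← h1, hemb.restrict_map, hpre, restrict_paramImage, ← hpre, ← hemb.restrict_map,
    map_translate_angleMeasure]

/-! ### The Euclidean measure -/

omit [NeZero m] in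
theorem exists_chartPoint_eq {α : Fin m → ℝ} {p : Fin N → ℂ × ℝ} (hp : ∀ j, p j ∈ surface α) :
    ∃ θ ∈ angleCube N, p = chartPoint α (fun j => (p j).2, θ) := by
  choose θ hθ hθe using fun j => exists_circle_exp_eq (Circle.exp (Complex.arg (p j).1))
  refine ⟨θ, fun j _ => hθ j, funext fun j => Prod.ext ?_ rfl⟩
  have h1 : Complex.exp (θ j * Complex.I) = Complex.exp (Complex.arg (p j).1 * Complex.I) := by
    have := congr_arg (Subtype.val) (hθe j)
    simpa using this
  simp only [chartPoint, chart]
  rw [h1, ← (hp j).2, Real.sqrt_sq (norm_nonneg _), Complex.norm_mul_exp_arg_mul_I]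

/-- Countably many translates of the chart image cover `U(N)^m`. The union `W` of the corresponding
regular pieces carries all of `angleMeasure`, and the two measures agree on it. What `W` misses of
the generalized normal matrices lies in the null set `Z` of translated singular images. -/
theorem euclideanMeasure_eq_angleMeasure {lam α : Fin m → ℝ} (hα : ∀ i, lam i = α i - α (i - 1)) :
    euclideanMeasure m N lam = angleMeasure α N := by
  set 𝒱 : Set (Fin m → U N) := Set.univ.pi fun _ => chartImage N with h𝒱
  have hnhds (g : Fin m → U N) : (fun S => g * S) '' 𝒱 ∈ nhds g := by
    have h1 : 𝒱 ∈ nhds (1 : Fin m → U N) :=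
      set_pi_mem_nhds Set.finite_univ fun k _ => chartImage_mem_nhds N
    have h2 := (Homeomorph.mulLeft g).isOpenMap.image_mem_nhds h1
    simpa using h2
  obtain ⟨s, hs, hcover⟩ := TopologicalSpace.countable_cover_nhds hnhds
  have hex (S : Fin m → U N) : ∃ g ∈ s, ∃ S' ∈ 𝒱, S = g * S' := by
    have h1 : S ∈ ⋃ g ∈ s, (fun S => g * S) '' 𝒱 := hcover ▸ Set.mem_univ S
    simp only [Set.mem_iUnion] at h1
    obtain ⟨g, hg, S', hS', rfl⟩ := h1
    exact ⟨g, hg, S', hS', rfl⟩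
  set W : Set (MatSpace (Fin m × Fin N)) := ⋃ g ∈ s, translate g '' paramImage α N with hW
  have hWm : MeasurableSet W := MeasurableSet.biUnion hs fun g _ =>
    (translateEquiv g).toHomeomorph.measurableEmbedding.measurableSet_image.mpr
      (measurableSet_paramImage α N)
  have hmemW {p : (Fin N → ℝ) × (Fin N → ℝ)} (hp : p ∈ orderedRegular α N ×ˢ angleCube N)
      (S : Fin m → U N) : angleParam α (p, S) ∈ W := by
    obtain ⟨g, hg, S', hS', rfl⟩ := hex S
    rw [← translate_angleParam]
    exact Set.mem_biUnion hg (Set.mem_image_of_mem _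
      (angleParam_mem_paramImage hp fun k => hS' k (Set.mem_univ k)))
  have h1 : (Measure.euclideanHausdorffMeasure (m * N ^ 2 + N)).restrict W =
      (angleMeasure α N).restrict W :=
    (Measure.restrict_biUnion_congr hs).mpr fun g _ => restrict_translate_paramImage α g
  have h2 : (angleMeasure α N).restrict W = angleMeasure α N := by
    refine Measure.restrict_eq_self_of_ae_mem ?_
    refine Measure.ae_smul_measure ?_ _
    refine (ae_map_iff (p := fun x => x ∈ W) (measurable_angleParam α).aemeasurable hWm).mpr ?_
    have hae : ∀ᵐ p ∂orderedMeasure α N, p ∈ orderedRegular α N ×ˢ angleCube N := by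
      refine (withDensity_absolutelyContinuous _ _).ae_le ?_
      exact ae_restrict_mem ((measurableSet_orderedRegular α N).prod (measurableSet_angleCube N))
    filter_upwards [(Measure.quasiMeasurePreserving_fst (μ := orderedMeasure α N)
      (ν := Measure.pi fun _ : Fin m => volumeU N)).ae hae] with q hq
    exact hmemW hq q.2
  obtain ⟨k₀, hk₀⟩ := Finite.exists_min α
  set Z : Set (MatSpace (Fin m × Fin N)) := ⋃ g ∈ s, translate g '' singularImage α N (α k₀)
  have hZ : Measure.euclideanHausdorffMeasure (m * N ^ 2 + N) Z = 0 := by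
    refine (measure_biUnion_null_iff hs).mpr fun g _ => ?_
    rw [(isometry_translate g).euclideanHausdorffMeasure_image,
      euclideanHausdorffMeasure_singularImage hk₀]
  have hWA : W ⊆ toSpace '' genNormal m N lam := by
    refine Set.iUnion₂_subset fun g _ => ?_
    rintro _ ⟨_, ⟨q, hq, rfl⟩, rfl⟩
    dsimp only
    rw [param_eq_orbitPoint hq.1, translate_toSpace, blockDiagU_mul_orbitPoint]
    exact Set.mem_image_of_mem _ (orbitPoint_mem_genNormal hα (surfacePoint_mem hq.1) _)
  have hAW : toSpace '' genNormal m N lam ⊆ W ∪ Z := by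
    rintro _ ⟨A, hA, rfl⟩
    obtain ⟨p, hp, S, rfl⟩ := exists_orbitPoint_eq hα hA
    by_cases hreg : (∀ j k, 0 < (p j).2 + α k) ∧ Function.Injective fun j => (p j).2
    · left
      set σ := Tuple.sort fun j => (p j).2 with hσ
      rw [← orbitPoint_comp_perm α p σ]
      have hpσ (j : Fin N) : (p ∘ σ) j ∈ surface α := hp (σ j)
      obtain ⟨θ, hθ, heq⟩ := exists_chartPoint_eq hpσ
      rw [heq]
      refine hmemW (p := (fun j => ((p ∘ σ) j).2, θ)) ⟨⟨fun j k => hreg.1 (σ j) k, ?_⟩, hθ⟩ _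
      have hmono : Monotone ((fun j => (p j).2) ∘ σ) := Tuple.monotone_sort _
      exact hmono.strictMono_of_injective (hreg.2.comp σ.injective)
    · right
      obtain ⟨g, hg, S', hS', rfl⟩ := hex S
      rw [← blockDiagU_mul_orbitPoint, ← translate_toSpace]
      exact Set.mem_biUnion hg (Set.mem_image_of_mem _
        (orbitPoint_mem_singularImage hk₀ hp hreg fun k => hS' k (Set.mem_univ k)))
  have h3 : W =ᵐ[Measure.euclideanHausdorffMeasure (m * N ^ 2 + N)]
      toSpace '' genNormal m N lam := by
    refine Filter.EventuallyLE.antisymm hWA.eventuallyLE ?_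
    refine ae_le_set.mpr (measure_mono_null ?_ hZ)
    rintro x ⟨hx, hxW⟩
    exact (hAW hx).resolve_left hxW
  rw [euclideanMeasure, ← Measure.restrict_congr_set h3, h1, h2]

end

section

/-! ### Symmetrization -/

variable {m N : ℕ}

theorem measurePreserving_comp_perm (σ : Equiv.Perm (Fin N)) :
    MeasurePreserving fun x : Fin N → ℝ => x ∘ σ := by
  have hm : Measurable fun x : Fin N → ℝ => x ∘ σ :=
    measurable_pi_lambda _ fun j => measurable_pi_apply (σ j)
  refine ⟨hm, ?_⟩
  rw [volume_pi]
  refine (Measure.pi_eq fun s hs => ?_).symm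
  have hpre : (fun x : Fin N → ℝ => x ∘ σ) ⁻¹' (Set.univ.pi s) =
      Set.univ.pi fun i => s (σ.symm i) := by
    ext x
    simp only [Set.mem_preimage, Set.mem_univ_pi, Function.comp_apply]
    exact ⟨fun h i => by simpa using h (σ.symm i), fun h i => by simpa using h (σ i)⟩
  rw [Measure.map_apply hm (MeasurableSet.univ_pi hs), hpre, Measure.pi_pi]
  exact Equiv.prod_comp σ.symm fun i => volume (s i)

/-- The measurable equivalence `x ↦ x ∘ σ`. -/
def compPerm (σ : Equiv.Perm (Fin N)) : (Fin N → ℝ) ≃ᵐ (Fin N → ℝ) where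
  toFun x := x ∘ σ
  invFun x := x ∘ σ.symm
  left_inv x := by ext; simp
  right_inv x := by ext; simp
  measurable_toFun := (measurePreserving_comp_perm σ).measurable
  measurable_invFun := (measurePreserving_comp_perm σ.symm).measurable

/-- The set of all eigenvalues. -/
def nonnegRegion (α : Fin m → ℝ) (N : ℕ) : Set (Fin N → ℝ) :=
  Set.univ.pi fun _ => {x | ∀ i, 0 ≤ x + α i}

theorem ae_ne (i j : Fin N) (hij : i ≠ j) : ∀ᵐ x : Fin N → ℝ, x i ≠ x j := by
  set l : (Fin N → ℝ) →ₗ[ℝ] ℝ := (LinearMap.proj i : (Fin N → ℝ) →ₗ[ℝ] ℝ) - LinearMap.proj j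
  have hl0 : l ≠ 0 := fun h => by
    have := LinearMap.congr_fun h (Pi.single i 1)
    simp [l, Ne.symm hij] at this
  have h1 := Measure.addHaar_submodule volume (LinearMap.ker l)
    fun h => hl0 (LinearMap.ker_eq_top.mp h)
  rw [ae_iff]
  refine measure_mono_null (fun x hx => ?_) h1
  simpa [l, sub_eq_zero] using hx

/-- Almost every point has distinct coordinates off the boundary, so it lies in exactly one of the
`N!` chambers obtained from the ordered one by permutations. -/
theorem setLIntegral_nonnegRegion (α : Fin m → ℝ) {k : (Fin N → ℝ) → ℝ≥0∞}
    (hsymm : ∀ (σ : Equiv.Perm (Fin N)) x, k (x ∘ σ) = k x) :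
    ∫⁻ x in nonnegRegion α N, k x = (N ! : ℝ≥0∞) * ∫⁻ x in orderedRegular α N, k x := by
  set s : Equiv.Perm (Fin N) → Set (Fin N → ℝ) := fun σ =>
    (fun x => x ∘ σ) ⁻¹' orderedRegular α N with hs
  have hms (σ : Equiv.Perm (Fin N)) : MeasurableSet (s σ) :=
    (measurePreserving_comp_perm σ).measurable (measurableSet_orderedRegular α N)
  have hdisj : Pairwise (Function.onFun Disjoint s) := by
    intro σ τ hστ
    refine Set.disjoint_left.mpr fun x hx hx' => hστ ?_
    have h1 : σ⁻¹ * τ = 1 := eq_of_strictMono_of_perm hx.2 hx'.2 (by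
      funext i; simp)
    exact (inv_mul_eq_one.mp h1)
  have hunion : nonnegRegion α N =ᵐ[volume] ⋃ σ, s σ := by
    have h1 : ∀ᵐ x : Fin N → ℝ, (∀ i j, i ≠ j → x i ≠ x j) ∧ ∀ j k, x j ≠ -α k := by
      refine Filter.Eventually.and ?_ ?_
      · refine ae_all_iff.mpr fun i => ae_all_iff.mpr fun j => ?_
        by_cases hij : i = j
        · simp [hij]
        · simpa [hij] using ae_ne i j hij
      · refine ae_all_iff.mpr fun j => ae_all_iff.mpr fun k => ?_
        exact Measure.ae_eval_ne (μ := fun _ : Fin N => (volume : Measure ℝ)) j (-α k)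
    filter_upwards [h1] with x hx
    refine propext ⟨fun h => ?_, fun h => ?_⟩
    · refine Set.mem_iUnion.mpr ⟨Tuple.sort x, fun j k => ?_, ?_⟩
      · refine lt_of_le_of_ne (h (Tuple.sort x j) (Set.mem_univ _) k) fun h0 => ?_
        exact hx.2 (Tuple.sort x j) k (by simp only [Function.comp_apply] at h0; linarith)
      · refine (Tuple.monotone_sort x).strictMono_of_injective (Function.Injective.comp ?_
          (Equiv.injective _))
        intro i j hij
        by_contra hne
        exact hx.1 i j hne hij
    · obtain ⟨σ, hσ⟩ := Set.mem_iUnion.mp h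
      intro j _ k
      have := hσ.1 (σ.symm j) k
      simp only [Function.comp_apply, Equiv.apply_symm_apply] at this
      exact this.le
  rw [setLIntegral_congr hunion, lintegral_iUnion hms hdisj, tsum_fintype]
  have h2 (σ : Equiv.Perm (Fin N)) : ∫⁻ x in s σ, k x = ∫⁻ x in orderedRegular α N, k x := by
    simpa only [hsymm] using (measurePreserving_comp_perm σ).setLIntegral_comp_preimage_emb
      (compPerm σ).measurableEmbedding k (orderedRegular α N)
  simp only [h2, Finset.sum_const, Finset.card_univ, Fintype.card_perm, Fintype.card_fin,
    nsmul_eq_mul]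

/-- The product of differences is the squared modulus of a Vandermonde determinant, which a
permutation changes only by a sign. -/
theorem density_comp_perm (α : Fin m → ℝ) (p : Fin N → ℂ × ℝ) (σ : Equiv.Perm (Fin N)) :
    density α (p ∘ σ) = density α p := by
  have h (p : Fin N → ℂ × ℝ) : ∏ i, ∏ j ∈ Finset.Ioi i, ‖(p i).1 - (p j).1‖ ^ 2 =
      ‖(Matrix.vandermonde fun i => (p i).1).det‖ ^ 2 := by
    rw [Matrix.det_vandermonde, norm_prod, ← Finset.prod_pow]
    refine Finset.prod_congr rfl fun i _ => ?_
    rw [norm_prod, ← Finset.prod_pow]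
    exact Finset.prod_congr rfl fun j _ => by rw [norm_sub_rev]
  rw [density, density, h, h]
  congr 1
  · congr 1
    exact Equiv.prod_comp σ fun i => Real.sqrt ((Q α).derivative.eval (p i).2)
  · have h1 : (Matrix.vandermonde fun i => ((p ∘ σ) i).1) =
        (Matrix.vandermonde fun i => (p i).1).submatrix σ id := rfl
    rw [h1, Matrix.det_permute, norm_mul]
    rcases Int.units_eq_one_or (Equiv.Perm.sign σ) with h2 | h2 <;> simp [h2]

/-- Over each `x` the angles have total mass `2π`, so the projection to the line is `2π` times a
restricted Lebesgue measure. -/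
instance (α : Fin m → ℝ) : SigmaFinite (surfaceMeasure α) := by
  refine SigmaFinite.of_map _ measurable_snd.aemeasurable ?_
  rw [surfaceMeasure, Measure.map_map measurable_snd (continuous_chart α).measurable]
  change SigmaFinite (Measure.map Prod.fst _)
  rw [Measure.volume_eq_prod, ← Measure.prod_restrict, Measure.map_fst_prod]
  simp only [Measure.restrict_apply_univ, Real.volume_Ico]
  exact inferInstanceAs (SigmaFinite ((2 * Real.pi - 0).toNNReal •
    (volume : Measure ℝ).restrict {x | ∀ i, 0 ≤ x + α i}))

theorem lintegral_pi_surfaceMeasure (α : Fin m → ℝ) {K : (Fin N → ℂ × ℝ) → ℝ≥0∞}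
    (hK : Measurable K) : ∫⁻ p, K p ∂Measure.pi (fun _ => surfaceMeasure α) =
      ∫⁻ x in nonnegRegion α N, ∫⁻ θ in angleCube N, K (chartPoint α (x, θ)) := by
  set R : Set (ℝ × ℝ) := {x : ℝ | ∀ i, 0 ≤ x + α i} ×ˢ Set.Ico 0 (2 * Real.pi) with hR
  have hRm : MeasurableSet R := by
    refine MeasurableSet.prod ?_ measurableSet_Ico
    have : {x : ℝ | ∀ i, 0 ≤ x + α i} = ⋂ i, {x : ℝ | 0 ≤ x + α i} := by ext; simp
    rw [this]
    exact MeasurableSet.iInter fun i => measurableSet_le measurable_const (by fun_prop)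
  have hc := (continuous_chart α).measurable
  have h1 : Measure.pi (fun _ : Fin N => surfaceMeasure α) =
      Measure.map (fun w j => chart α (w j)) (Measure.pi fun _ => volume.restrict R) :=
    (map_pi_of_map (volume.restrict R) (surfaceMeasure α) hc rfl).symm
  have hc' : Measurable fun (w : Fin N → ℝ × ℝ) j => chart α (w j) :=
    measurable_pi_lambda _ fun j => hc.comp (measurable_pi_apply j)
  rw [h1, lintegral_map hK hc', ← Measure.restrict_pi_pi]
  have hmp := volume_measurePreserving_arrowProdEquivProdArrow ℝ ℝ (Fin N)
  have hKc : Measurable fun q : (Fin N → ℝ) × (Fin N → ℝ) => K (chartPoint α q) :=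
    hK.comp (continuous_chartPoint α).measurable
  have h2 := hmp.setLIntegral_comp_preimage_emb
    (MeasurableEquiv.arrowProdEquivProdArrow ℝ ℝ (Fin N)).measurableEmbedding
    (fun q => K (chartPoint α q)) (nonnegRegion α N ×ˢ angleCube N)
  have hpre : MeasurableEquiv.arrowProdEquivProdArrow ℝ ℝ (Fin N) ⁻¹'
      (nonnegRegion α N ×ˢ angleCube N) = Set.univ.pi fun _ => R := by
    ext w
    simp only [Set.mem_preimage, Set.mem_prod, nonnegRegion, angleCube, Set.mem_univ_pi, hR]
    exact forall_and.symm
  rw [hpre] at h2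
  refine Eq.trans h2 ?_
  rw [Measure.volume_eq_prod, ← Measure.prod_restrict]
  exact lintegral_prod _ hKc.aemeasurable

end

section

/-! ### The Euclidean measure in the coordinates -/

variable {m N : ℕ}

/-- The products of the entries of `S_k` and of the adjoint of `S_l`, on `U(N)^m / U(1)^N`. -/
def flagEntry (k l : Fin m) (a b j : Fin N) (u : Flag m N) : ℂ :=
  Quotient.liftOn' u (fun S => (S k : Matrix (Fin N) (Fin N) ℂ) a j *
      star ((S l : Matrix (Fin N) (Fin N) ℂ) b j)) fun S S' h => by
    obtain ⟨t, ht⟩ := QuotientGroup.leftRel_apply.mp h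
    obtain rfl : S * (fun _ => diagU N t) = S' := by
      rw [eq_comm, ← inv_mul_eq_iff_eq_mul, ← ht]
      rfl
    have h1 : (t j : ℂ) * star (t j : ℂ) = 1 := by simp [Complex.mul_conj]
    have h2 (k : Fin m) (a : Fin N) : ((S k * diagU N t : U N) : Matrix (Fin N) (Fin N) ℂ) a j =
        (S k : Matrix (Fin N) (Fin N) ℂ) a j * t j :=
      Matrix.mul_diagonal _ _ _ _
    simp only [Pi.mul_apply, h2, star_mul]
    linear_combination (-(S k : Matrix (Fin N) (Fin N) ℂ) a j *
      star ((S l : Matrix (Fin N) (Fin N) ℂ) b j)) * h1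

theorem measurable_flagEntry (k l : Fin m) (a b j : Fin N) :
    Measurable (flagEntry (m := m) k l a b j) := by
  refine measurable_from_quotient.mpr ?_
  exact ((measurable_entry a j).comp (measurable_pi_apply k)).mul
    (continuous_star.measurable.comp ((measurable_entry b j).comp (measurable_pi_apply l)))

variable [NeZero m]

theorem coord_apply (α : Fin m → ℝ) (q : (Fin N → ℂ × ℝ) × Flag m N) (r c : Fin m × Fin N) :
    coord α q r c = if c.1 = r.1 + 1 then
      ∑ j, diagEntry α (q.1 j) r.1 * flagEntry r.1 (r.1 + 1) r.2 c.2 j q.2 else 0 := by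
  obtain ⟨p, u⟩ := q
  induction u using Quotient.inductionOn'
  exact orbitPoint_apply α p _ r c

/-- On a product with a quotient, joint measurability does not follow from that of the lift to
`U(N)^m`. The entries are instead sums of products of a function of the points and a function
`flagEntry` of the class. -/
theorem measurable_coord (α : Fin m → ℝ) :
    Measurable fun q : (Fin N → ℂ × ℝ) × Flag m N => toSpace (coord α q) := by
  refine measurable_toSpace_of_entries (f := fun q : (Fin N → ℂ × ℝ) × Flag m N => coord α q)
    fun r c => ?_
  simp only [coord_apply]
  by_cases h : c.1 = r.1 + 1
  · simp only [h, if_true]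
    refine Finset.measurable_sum _ fun j _ => Measurable.mul ?_ ?_
    · exact (measurable_diagEntry α r.1).comp ((measurable_pi_apply j).comp measurable_fst)
    · exact (measurable_flagEntry r.1 (r.1 + 1) r.2 c.2 j).comp measurable_snd
  · simp only [h, if_false]
    exact measurable_const

omit [NeZero m] in
theorem pi_volumeU (m N : ℕ) : Measure.pi (fun _ : Fin m => volumeU N) =
    volU N ^ m • Measure.pi fun _ : Fin m => haarU N := by
  refine Measure.pi_eq fun s _ => ?_
  rw [Measure.smul_apply, Measure.pi_pi, volumeU_eq_smul_haarU]
  simp only [Measure.smul_apply, smul_eq_mul, Finset.prod_mul_distrib, Finset.prod_const,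
    Finset.card_univ, Fintype.card_fin]

omit [NeZero m] in
theorem map_mul_right_pi_volumeU (g : Fin m → U N) :
    Measure.map (fun S => S * g) (Measure.pi fun _ : Fin m => volumeU N) =
      Measure.pi fun _ : Fin m => volumeU N := by
  refine (Measure.pi_map_pi (μ := fun _ : Fin m => volumeU N) (f := fun k => (· * g k))
    fun k => (measurable_mul_const (g k)).aemeasurable).trans ?_
  simp only [map_mul_right_eq_self]

/-- The average over the group of a function of the matrix with coordinates `p` and `S`. -/
def groupIntegral (α : Fin m → ℝ) (F : MatSpace (Fin m × Fin N) → ℝ≥0∞) (p : Fin N → ℂ × ℝ) :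
    ℝ≥0∞ :=
  ∫⁻ S, F (toSpace (orbitPoint α p S)) ∂Measure.pi fun _ : Fin m => volumeU N

theorem measurable_groupIntegral (α : Fin m → ℝ) {F : MatSpace (Fin m × Fin N) → ℝ≥0∞}
    (hF : Measurable F) : Measurable (groupIntegral α F) :=
  Measurable.lintegral_prod_right' (f := fun q : (Fin N → ℂ × ℝ) × (Fin m → U N) =>
    F (toSpace (orbitPoint α q.1 q.2))) (hF.comp (measurable_orbitPoint α))

/-- Relabelling the points amounts to right multiplication of all `S k` by a permutation matrix,
which preserves the volume. -/
theorem groupIntegral_comp_perm (α : Fin m → ℝ) {F : MatSpace (Fin m × Fin N) → ℝ≥0∞}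
    (hF : Measurable F) (p : Fin N → ℂ × ℝ) (σ : Equiv.Perm (Fin N)) :
    groupIntegral α F (p ∘ σ) = groupIntegral α F p := by
  have h1 (p : Fin N → ℂ × ℝ) :
      Measurable fun S : Fin m → U N => F (toSpace (orbitPoint α p S)) := by
    have h := (measurable_orbitPoint (m := m) (N := N) α).comp (measurable_prodMk_left (x := p))
    simp only [Function.comp_def] at h
    exact hF.comp h
  have h2 := map_mul_right_pi_volumeU (m := m) (fun _ => permU σ)
  rw [groupIntegral, ← h2, lintegral_map (h1 _) (measurable_mul_const _)]
  simp only [orbitPoint_comp_perm]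
  rfl

theorem lintegral_angleMeasure (α : Fin m → ℝ) {F : MatSpace (Fin m × Fin N) → ℝ≥0∞}
    (hF : Measurable F) : ∫⁻ A, F A ∂angleMeasure α N = (ENNReal.ofReal ((2 * Real.pi) ^ N))⁻¹ *
      ∫⁻ x in orderedRegular α N, ∫⁻ θ in angleCube N,
        ENNReal.ofReal (density α (chartPoint α (x, θ))) *
          groupIntegral α F (chartPoint α (x, θ)) := by
  have hm := measurable_angleParam (N := N) α
  have hdens : Measurable fun p : (Fin N → ℝ) × (Fin N → ℝ) =>
      ENNReal.ofReal (density α (chartPoint α p)) :=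
    ((continuous_density α).comp (continuous_chartPoint α)).measurable.ennreal_ofReal
  have hG : Measurable fun p : (Fin N → ℝ) × (Fin N → ℝ) =>
      groupIntegral α F (chartPoint α p) :=
    (measurable_groupIntegral α hF).comp (continuous_chartPoint α).measurable
  rw [angleMeasure, lintegral_smul_measure, smul_eq_mul, lintegral_map hF hm]
  congr 1
  refine (lintegral_prod (fun q => F (angleParam (N := N) α q)) (hF.comp hm).aemeasurable).trans ?_
  change ∫⁻ p, groupIntegral α F (chartPoint α p) ∂orderedMeasure α N = _
  rw [orderedMeasure, lintegral_withDensity_eq_lintegral_mul _ hdens hG, Measure.volume_eq_prod,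
    ← Measure.prod_restrict]
  exact lintegral_prod _ (hdens.mul hG).aemeasurable

theorem lintegral_flagMeasure (m N : ℕ) {f : Flag m N → ℝ≥0∞} (hf : Measurable f) :
    ∫⁻ u, f u ∂flagMeasure m N = (ENNReal.ofReal ((2 * Real.pi) ^ N))⁻¹ *
      ∫⁻ S : Fin m → U N, f S ∂Measure.pi fun _ : Fin m => volumeU N := by
  have hmk : Measurable (QuotientGroup.mk : (Fin m → U N) → Flag m N) := measurable_quotient_mk''
  rw [flagMeasure, lintegral_smul_measure, lintegral_map hf hmk, pi_volumeU,
    lintegral_smul_measure, smul_eq_mul, smul_eq_mul, ← mul_assoc, ENNReal.div_eq_inv_mul]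

instance : SFinite (flagMeasure m N) := by unfold flagMeasure; infer_instance

theorem lintegral_coord (α : Fin m → ℝ) {F : MatSpace (Fin m × Fin N) → ℝ≥0∞}
    (hF : Measurable F) :
    ∫⁻ q, F (toSpace (coord α q)) ∂((Measure.pi fun _ : Fin N => surfaceMeasure α).withDensity
        fun p => ENNReal.ofReal (density α p)).prod (flagMeasure m N) =
      (ENNReal.ofReal ((2 * Real.pi) ^ N))⁻¹ * ∫⁻ p, ENNReal.ofReal (density α p) *
        groupIntegral α F p ∂Measure.pi fun _ : Fin N => surfaceMeasure α := by
  have hm : Measurable fun q : (Fin N → ℂ × ℝ) × Flag m N => F (toSpace (coord α q)) :=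
    hF.comp (measurable_coord α)
  have hdens : Measurable fun p : Fin N → ℂ × ℝ => ENNReal.ofReal (density α p) :=
    (continuous_density α).measurable.ennreal_ofReal
  have h1 (p : Fin N → ℂ × ℝ) : ∫⁻ u, F (toSpace (coord α (p, u))) ∂flagMeasure m N =
      (ENNReal.ofReal ((2 * Real.pi) ^ N))⁻¹ * groupIntegral α F p :=
    lintegral_flagMeasure m N (f := fun u => F (toSpace (coord α (p, u))))
      (hm.comp measurable_prodMk_left)
  have hG := measurable_groupIntegral α hF
  rw [lintegral_prod _ hm.aemeasurable]
  simp only [h1]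
  rw [lintegral_const_mul _ hG, lintegral_withDensity_eq_lintegral_mul _ hdens hG]
  rfl

/-- The density and the average over the group are symmetric in the points of Σ, so integrating over
all `x` multiplies the integral over ordered `x` by `N!`. The averages over `U(N)^m` and over its
quotient differ by the factor `(2π)^N`. -/
theorem angleMeasure_eq (α : Fin m → ℝ) (N : ℕ) : angleMeasure α N = ((N ! : ℝ≥0∞)⁻¹) •
    Measure.map (fun q : (Fin N → ℂ × ℝ) × Flag m N => toSpace (coord α q))
      (((Measure.pi fun _ : Fin N => surfaceMeasure α).withDensity
        fun p => ENNReal.ofReal (density α p)).prod (flagMeasure m N)) := by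
  refine Measure.ext_of_lintegral _ fun F hF => ?_
  have hK : Measurable fun p : Fin N → ℂ × ℝ =>
      ENNReal.ofReal (density α p) * groupIntegral α F p :=
    (continuous_density α).measurable.ennreal_ofReal.mul (measurable_groupIntegral α hF)
  have hKσ (σ : Equiv.Perm (Fin N)) (x θ : Fin N → ℝ) :
      ENNReal.ofReal (density α (chartPoint α (x ∘ σ, θ ∘ σ))) *
        groupIntegral α F (chartPoint α (x ∘ σ, θ ∘ σ)) =
      ENNReal.ofReal (density α (chartPoint α (x, θ))) *
        groupIntegral α F (chartPoint α (x, θ)) := by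
    have h1 : chartPoint α (x ∘ σ, θ ∘ σ) = chartPoint α (x, θ) ∘ σ := rfl
    rw [h1, density_comp_perm, groupIntegral_comp_perm α hF]
  have hcube (σ : Equiv.Perm (Fin N)) : (fun θ => θ ∘ σ) ⁻¹' angleCube N = angleCube N := by
    ext θ
    simp only [Set.mem_preimage, angleCube, Set.mem_univ_pi, Function.comp_apply]
    exact ⟨fun h i => by simpa using h (σ.symm i), fun h i => h (σ i)⟩
  -- Permuting `x` alone is not a symmetry of the integrand; integration over the cube allows `θ` to
  -- be permuted along with it.
  have hsymm (σ : Equiv.Perm (Fin N)) (x : Fin N → ℝ) :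
      ∫⁻ θ in angleCube N, ENNReal.ofReal (density α (chartPoint α (x ∘ σ, θ))) *
        groupIntegral α F (chartPoint α (x ∘ σ, θ)) =
      ∫⁻ θ in angleCube N, ENNReal.ofReal (density α (chartPoint α (x, θ))) *
        groupIntegral α F (chartPoint α (x, θ)) := by
    rw [← (measurePreserving_comp_perm σ).setLIntegral_comp_preimage_emb
      (compPerm σ).measurableEmbedding _ (angleCube N), hcube]
    simp only [hKσ]
  have hfac : (N ! : ℝ≥0∞) ≠ 0 := by exact_mod_cast N.factorial_ne_zero
  rw [lintegral_angleMeasure α hF, lintegral_smul_measure, smul_eq_mul,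
    lintegral_map hF (measurable_coord α), lintegral_coord α hF, lintegral_pi_surfaceMeasure α hK,
    setLIntegral_nonnegRegion α hsymm, mul_left_comm, ← mul_assoc (N ! : ℝ≥0∞)⁻¹,
    ENNReal.inv_mul_cancel hfac (ENNReal.natCast_ne_top _), one_mul]

end

end GenNormal

end

theorem theorem2 (m N : ℕ) [NeZero m] (lam α : Fin m → ℝ) (hα : ∀ i, lam i = α i - α (i - 1)) :
    -- `coord` gives coordinates: orbits in `N_m(lam, ℂ)` correspond to points of `Σ^N / S_N`
    ((∀ p : Fin N → ℂ × ℝ, (∀ j, p j ∈ GenNormal.surface α) → ∀ u : GenNormal.Flag m N,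
        GenNormal.coord α (p, u) ∈ GenNormal.genNormal m N lam) ∧
      (∀ A ∈ GenNormal.genNormal m N lam, ∃ p : Fin N → ℂ × ℝ,
        (∀ j, p j ∈ GenNormal.surface α) ∧ ∃ u, GenNormal.coord α (p, u) = A) ∧
      (∀ p p' : Fin N → ℂ × ℝ, (∀ j, p j ∈ GenNormal.surface α) →
        (∀ j, p' j ∈ GenNormal.surface α) →
        ((∃ u u', GenNormal.coord α (p, u) = GenNormal.coord α (p', u')) ↔
          ∃ σ : Equiv.Perm (Fin N), p' = p ∘ σ))) ∧
    -- the formula for the Euclidean measure; the factor `1 / N!` turns the integral over `Σ^N`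
    -- into an integral over `Σ^N / S_N`
    (Measurable fun q : (Fin N → ℂ × ℝ) × GenNormal.Flag m N =>
        GenNormal.toSpace (GenNormal.coord α q)) ∧
    GenNormal.euclideanMeasure m N lam =
      ((N ! : ℝ≥0∞)⁻¹) •
        Measure.map (fun q : (Fin N → ℂ × ℝ) × GenNormal.Flag m N =>
            GenNormal.toSpace (GenNormal.coord α q))
          (((Measure.pi fun _ : Fin N => GenNormal.surfaceMeasure α).withDensity
              fun p => ENNReal.ofReal (GenNormal.density α p)).prod
            (GenNormal.flagMeasure m N)) := by
  refine ⟨⟨fun p hp u => ?_, fun A hA => ?_, fun p p' hp hp' => ⟨?_, ?_⟩⟩,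
    GenNormal.measurable_coord α, ?_⟩
  · induction u using Quotient.inductionOn'
    exact GenNormal.orbitPoint_mem_genNormal hα hp _
  · obtain ⟨p, hp, S, hS⟩ := GenNormal.exists_orbitPoint_eq hα hA
    exact ⟨p, hp, QuotientGroup.mk S, hS⟩
  · rintro ⟨u, u', h⟩
    induction u using Quotient.inductionOn'
    induction u' using Quotient.inductionOn'
    exact GenNormal.exists_perm_of_orbitPoint_eq hp hp' h
  · rintro ⟨σ, rfl⟩
    -- The same permutation matrix in every factor undoes the relabelling.
    exact ⟨QuotientGroup.mk 1, QuotientGroup.mk (1 * fun _ => GenNormal.permU σ),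
      (GenNormal.orbitPoint_comp_perm α p σ 1).symm⟩
  · rw [GenNormal.euclideanMeasure_eq_angleMeasure hα, GenNormal.angleMeasure_eq]
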